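/- Let $F$ be a field of characteristic $0$ and $X$ a well-ordered set. A Gelfand--Dorfman algebra is an $F$-space $G$ with bilinear operations $\circ,[\,,]$ such that $(G,\circ)$ is Novikov, i.e. $(x\circ y)\circ z-x\circ(y\circ z)=(y\circ x)\circ z-y\circ(x\circ z)$ and $(x\circ y)\circ z=(x\circ z)\circ y$, such that $(G,[\,,])$ is a Lie algebra, and such that $y\circ[x,z]=[x,y\circ z]-[z,y\circ x]+[y,x]\circ z-[y,z]\circ x$. It is called special if it embeds into $P^{(d)}$ for some (not necessarily unital) Poisson algebra $P$ with a derivation $d$ of both products, where in $P^{(d)}$ one puts $x\circ y=x\,d(y)$, $[x,y]=\{x,y\}$. Let $\mathrm{SGD}\langle X\rangle$ be the free special Gelfand--Dorfman algebra generated by $X$. Let $X_\infty=\{x^{(n)}: x\in X,\ n\ge 0\}$, with $x^{(m)}>y^{(n)}$ iff $m>n$, or $m=n$ and $x>y$. Order the associative words in $X_\infty$ lexicographically, with $u<1$ for every nonempty $u$. An associative word $w$ is Lyndon--Shirshov if $w>vu$ whenever $w=uv$ with $u,v$ nonempty. A nonassociative word is an LS-word if it is a letter, or if it is $[[u_1],[u_2]]$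 where the associative word $u_1u_2$ is Lyndon--Shirshov, $[u_1],[u_2]$ are LS-words, $u_1>u_2$, and $u_2\ge u_{12}$ if $[u_1]=[[u_{11}],[u_{12}]]$. LS-words are compared first by degree and then by their associative words. The weight of a commutative product of LS-words is defined by $\mathrm{wt}(x^{(n)})=n-1$, $\mathrm{wt}\{u,v\}=\mathrm{wt}(u)+\mathrm{wt}(v)+1$, $\mathrm{wt}(uv)=\mathrm{wt}(u)+\mathrm{wt}(v)$. Let $N(X)$ be the set of all products of LS-words of weight $-1$, written in the canonical form $$x_{i_1}\cdots x_{i_k}B_1\cdots B_m A_n\cdots A_1 x_{j_l}^{(r_l)}\cdots x_{j_1}^{(r_1)},$$ where $r_1,\dots,r_l\ge1$, the $A_i,B_j$ are LS-words of degree at least $2$, each $A_i$ but no $B_j$ contains a letter $x^{(n)}$ with $n\ge 1$, and $x_{i_1}\le\dots\le x_{i_k}$, $B_1\le\dots\le B_m$, $A_n\ge\dots\ge A_1$, $x_{j_l}^{(r_l)}\ge\dots\ge x_{j_1}^{(r_1)}$. Define a map $\psi$ from $N(X)$ to the monomials of the free magma with two operations $\circ,[\,,]$ generated by $X$ as follows.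 Put $\varphi(c_1\cdots c_p\,x^{(p)})=c_p\circ(c_{p-1}\circ\cdots(c_1\circ x)\cdots)$. For an LS-word $w$ of degree $t\ge2$ containing $k=r_1+\dots+r_t\ge1$ derivatives among its letters $x_{i_1}^{(r_1)},\dots,x_{i_t}^{(r_t)}$, choose a permutation that rearranges these letters into a sequence $x_{j_1}^{(p_1)}\ge\dots\ge x_{j_t}^{(p_t)}$. Let $\psi(c_1\cdots c_k\,w)$ be obtained from $w$ by keeping the arrangement of brackets and replacing the letter that has been moved to place $m$ by $\varphi(c_{k-p_1-\dots-p_m+1}\cdots c_{k-p_1-\dots-p_{m-1}}\,x_{j_m}^{(p_m)})$, for $m=1,\dots,t$. For $a\in N(X)$ begin with the list $c=(x_{i_1},\dots,x_{i_k},B_1,\dots,B_m)$. For $A=A_n,\dots,A_1$ in turn, if $A$ contains $q$ derivatives, replace the last $q$ entries $c'$ of the list by the single entry $\psi(c'A)$. Then, for $x^{(r)}=x_{j_l}^{(r_l)},\dots,x_{j_1}^{(r_1)}$ in turn, replace the last $r$ entries $c'$ by the single entry $\varphi(c'x^{(r)})$. Exactly one entry is left at the end, and it is $\psi(a)$. Then,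 for every choice of the permutations above, $\psi$ followed by the natural map to $\mathrm{SGD}\langle X\rangle$ is injective on $N(X)$, and (the image of) $N_\psi=\{\psi(a): a\in N(X)\}$ is a linear basis of $\mathrm{SGD}\langle X\rangle$. -/

import Mathlib

universe u v w

namespace SGD

/-! ### Gelfand--Dorfman algebras, differential Poisson algebras, speciality

All binary operations are bilinear maps on modules over the ground field. -/

section Varieties

variable {F : Type v} [Field F] {G : Type w} [AddCommGroup G] [Module F G]

/-- `(G, ∘)` is a Novikov algebra. -/
structure IsNovikov (circ : G →ₗ[F] G →ₗ[F] G) : Prop where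
  left_symm : ∀ x y z, circ (circ x y) z - circ x (circ y z) =
    circ (circ y x) z - circ y (circ x z)
  right_comm : ∀ x y z, circ (circ x y) z = circ (circ x z) y

/-- `(G, [,])` is a Lie algebra (the ground field has characteristic `0` throughout). -/
structure IsLieBracket (brk : G →ₗ[F] G →ₗ[F] G) : Prop where
  skew : ∀ x y, brk x y = - brk y x
  jacobi : ∀ x y z, brk (brk x y) z + brk (brk y z) x + brk (brk z x) y = 0

/-- `(G, ∘, [,])` is a Gelfand--Dorfman algebra. -/
structure IsGelfandDorfman (circ brk : G →ₗ[F] G →ₗ[F] G) : Prop where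
  novikov : IsNovikov circ
  lie : IsLieBracket brk
  compat : ∀ x y z, circ y (brk x z) =
    brk x (circ y z) - brk z (circ y x) + circ (brk y x) z - circ (brk y z) x

/-- `(P, ·, {,})` is a (not necessarily unital) Poisson algebra. -/
structure IsPoisson (mul brk : G →ₗ[F] G →ₗ[F] G) : Prop where
  mul_comm : ∀ x y, mul x y = mul y x
  mul_assoc : ∀ x y z, mul (mul x y) z = mul x (mul y z)
  lie : IsLieBracket brk
  leibniz : ∀ x y z, brk x (mul y z) = mul (brk x y) z + mul y (brk x z)

/-- `d` is a derivation of the bilinear product `mul`. -/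
def IsDerivation (mul : G →ₗ[F] G →ₗ[F] G) (d : G →ₗ[F] G) : Prop :=
  ∀ x y, d (mul x y) = mul (d x) y + mul x (d y)

/-- A Gelfand--Dorfman algebra is special if it embeds injectively into `P^(d)` for a Poisson
algebra `P` with a derivation `d` of both products, where in `P^(d)` one puts
`x ∘ y = x · d y` and `[x, y] = {x, y}`. -/
def IsSpecialGD (circ brk : G →ₗ[F] G →ₗ[F] G) : Prop :=
  IsGelfandDorfman circ brk ∧
    ∃ (P : Type w) (_ : AddCommGroup P) (_ : Module F P)
      (mul pbrk : P →ₗ[F] P →ₗ[F] P) (d : P →ₗ[F] P) (j : G →ₗ[F] P),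
      IsPoisson mul pbrk ∧ IsDerivation mul d ∧ IsDerivation pbrk d ∧
      Function.Injective j ∧
      (∀ x y, j (circ x y) = mul (j x) (d (j y))) ∧
      (∀ x y, j (brk x y) = pbrk (j x) (j y))

end Varieties

/-! ### The free magma with two operations and the free special Gelfand--Dorfman algebra -/

/-- Monomials of the free algebra with two binary operations `∘` and `[,]` generated by `X`. -/
inductive Magma₂ (X : Type u) : Type u
  | of : X → Magma₂ X
  | circ : Magma₂ X → Magma₂ X → Magma₂ X
  | brk : Magma₂ X → Magma₂ X → Magma₂ X

/-- Value of a monomial in an algebra with two operations, under an assignment of the letters. -/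
def Magma₂.eval {X : Type u} {F : Type v} [Field F] {G : Type w} [AddCommGroup G] [Module F G]
    (circ brk : G →ₗ[F] G →ₗ[F] G) (ρ : X → G) : Magma₂ X → G
  | .of x => ρ x
  | .circ a b => circ (a.eval circ brk ρ) (b.eval circ brk ρ)
  | .brk a b => brk (a.eval circ brk ρ) (b.eval circ brk ρ)

section Free

variable (F : Type v) [Field F] (X : Type u)

/-- The elements of the free algebra with two operations that vanish in all special
Gelfand--Dorfman algebras under all assignments of the letters. -/
def specialIdentities : Submodule F (Magma₂ X →₀ F) where
  carrier := {f | ∀ (G : Type (max u v)) [AddCommGroup G] [Module F G]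
    (circ brk : G →ₗ[F] G →ₗ[F] G), IsSpecialGD circ brk → ∀ ρ : X → G,
      Finsupp.linearCombination F (Magma₂.eval circ brk ρ) f = 0}
  add_mem' hf hg G _ _ circ brk h ρ := by
    rw [map_add, hf G circ brk h ρ, hg G circ brk h ρ, add_zero]
  zero_mem' G _ _ circ brk h ρ := map_zero _
  smul_mem' c f hf G _ _ circ brk h ρ := by
    rw [map_smul, hf G circ brk h ρ, smul_zero]

/-- The free special Gelfand--Dorfman algebra generated by `X`: the quotient of the free algebra
with two operations by all identities of special Gelfand--Dorfman algebras. -/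
abbrev FreeSGD : Type (max u v) := (Magma₂ X →₀ F) ⧸ specialIdentities F X

/-- The class of a monomial in the free special Gelfand--Dorfman algebra. -/
noncomputable def FreeSGD.mon (m : Magma₂ X) : FreeSGD F X :=
  (specialIdentities F X).mkQ (Finsupp.single m 1)

variable {F X}

/-- The homomorphism from the free special algebra to a special algebra `G` that extends `ρ`. -/
noncomputable def FreeSGD.lift {G : Type (max u v)} [AddCommGroup G] [Module F G]
    {circ brk : G →ₗ[F] G →ₗ[F] G} (h : IsSpecialGD circ brk) (ρ : X → G) :
    FreeSGD F X →ₗ[F] G :=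
  (specialIdentities F X).liftQ (Finsupp.linearCombination F (Magma₂.eval circ brk ρ))
    fun _ hf => hf G circ brk h ρ

theorem FreeSGD.lift_mon {G : Type (max u v)} [AddCommGroup G] [Module F G]
    {circ brk : G →ₗ[F] G →ₗ[F] G} (h : IsSpecialGD circ brk) (ρ : X → G) (m : Magma₂ X) :
    FreeSGD.lift h ρ (FreeSGD.mon F X m) = m.eval circ brk ρ :=
  (Submodule.liftQ_apply _ _ _).trans (by simp)

theorem FreeSGD.ext_lift {a b : FreeSGD F X}
    (hab : ∀ (G : Type (max u v)) [AddCommGroup G] [Module F G]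
      (circ brk : G →ₗ[F] G →ₗ[F] G) (h : IsSpecialGD circ brk) (ρ : X → G),
      FreeSGD.lift h ρ a = FreeSGD.lift h ρ b) : a = b := by
  obtain ⟨f, rfl⟩ := (specialIdentities F X).mkQ_surjective a
  obtain ⟨g, rfl⟩ := (specialIdentities F X).mkQ_surjective b
  rw [← sub_eq_zero, ← map_sub, Submodule.mkQ_apply, Submodule.Quotient.mk_eq_zero]
  intro G _ _ circ brk h ρ
  have := hab G circ brk h ρ
  rw [← sub_eq_zero, ← map_sub, ← map_sub] at this
  exact this

theorem FreeSGD.hom_ext {G : Type w} [AddCommGroup G] [Module F G] {f g : FreeSGD F X →ₗ[F] G}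
    (h : ∀ m, f (FreeSGD.mon F X m) = g (FreeSGD.mon F X m)) : f = g := by
  apply Submodule.linearMap_qext
  apply Finsupp.lhom_ext'
  intro m
  apply LinearMap.ext_ring
  exact h m

/-- Bilinear extension of a binary operation on monomials to the free algebra. -/
noncomputable def magmaMul (op : Magma₂ X → Magma₂ X → Magma₂ X) :
    (Magma₂ X →₀ F) →ₗ[F] (Magma₂ X →₀ F) →ₗ[F] (Magma₂ X →₀ F) :=
  Finsupp.linearCombination F fun a => Finsupp.lmapDomain F F (op a)

theorem magmaMul_single (op : Magma₂ X → Magma₂ X → Magma₂ X) (a b : Magma₂ X) :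
    magmaMul op (Finsupp.single a (1 : F)) (Finsupp.single b 1) = Finsupp.single (op a b) 1 := by
  simp [magmaMul, Finsupp.mapDomain_single]

theorem linearCombination_magmaMul {G : Type w} [AddCommGroup G] [Module F G]
    (op : Magma₂ X → Magma₂ X → Magma₂ X) (mul : G →ₗ[F] G →ₗ[F] G) (e : Magma₂ X → G)
    (he : ∀ a b, e (op a b) = mul (e a) (e b)) (f g : Magma₂ X →₀ F) :
    Finsupp.linearCombination F e (magmaMul op f g) =
      mul (Finsupp.linearCombination F e f) (Finsupp.linearCombination F e g) := by
  have : (magmaMul op).compr₂ (Finsupp.linearCombination F e) =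
      mul.compl₁₂ (Finsupp.linearCombination F e) (Finsupp.linearCombination F e) := by
    ext a b
    simp [magmaMul_single, he]
  exact LinearMap.congr_fun (LinearMap.congr_fun this f) g

/-- A bilinear operation on the free algebra that respects the special identities, on the
quotient. -/
noncomputable def FreeSGD.descend (B : (Magma₂ X →₀ F) →ₗ[F] (Magma₂ X →₀ F) →ₗ[F] (Magma₂ X →₀ F))
    (h₁ : ∀ f ∈ specialIdentities F X, ∀ g, B f g ∈ specialIdentities F X)
    (h₂ : ∀ f, ∀ g ∈ specialIdentities F X, B f g ∈ specialIdentities F X) :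
    FreeSGD F X →ₗ[F] FreeSGD F X →ₗ[F] FreeSGD F X :=
  (specialIdentities F X).liftQ
    { toFun := fun f => (specialIdentities F X).mapQ (specialIdentities F X) (B f) (h₂ f)
      map_add' := fun f g => by
        apply Submodule.linearMap_qext
        ext
        simp
      map_smul' := fun c f => by
        apply Submodule.linearMap_qext
        ext
        simp }
    (fun f hf => by
      rw [LinearMap.mem_ker]
      apply Submodule.linearMap_qext
      apply LinearMap.ext
      intro g
      simpa using h₁ f hf g)

/-- The operation `∘` of the free special Gelfand--Dorfman algebra. -/
noncomputable def FreeSGD.circ : FreeSGD F X →ₗ[F] FreeSGD F X →ₗ[F] FreeSGD F X :=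
  FreeSGD.descend (magmaMul Magma₂.circ)
    (fun f hf g G _ _ circ brk h ρ => by
      rw [linearCombination_magmaMul _ circ _ (fun _ _ => rfl), hf G circ brk h ρ]; simp)
    (fun f g hg G _ _ circ brk h ρ => by
      rw [linearCombination_magmaMul _ circ _ (fun _ _ => rfl), hg G circ brk h ρ]; simp)

/-- The operation `[,]` of the free special Gelfand--Dorfman algebra. -/
noncomputable def FreeSGD.brk : FreeSGD F X →ₗ[F] FreeSGD F X →ₗ[F] FreeSGD F X :=
  FreeSGD.descend (magmaMul Magma₂.brk)
    (fun f hf g G _ _ circ brk h ρ => by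
      rw [linearCombination_magmaMul _ brk _ (fun _ _ => rfl), hf G circ brk h ρ]; simp)
    (fun f g hg G _ _ circ brk h ρ => by
      rw [linearCombination_magmaMul _ brk _ (fun _ _ => rfl), hg G circ brk h ρ]; simp)

theorem FreeSGD.mon_circ (a b : Magma₂ X) : FreeSGD.mon F X (.circ a b) =
    FreeSGD.circ (FreeSGD.mon F X a) (FreeSGD.mon F X b) := by
  exact congrArg (specialIdentities F X).mkQ (magmaMul_single Magma₂.circ a b).symm

theorem FreeSGD.mon_brk (a b : Magma₂ X) : FreeSGD.mon F X (.brk a b) =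
    FreeSGD.brk (FreeSGD.mon F X a) (FreeSGD.mon F X b) := by
  exact congrArg (specialIdentities F X).mkQ (magmaMul_single Magma₂.brk a b).symm

theorem FreeSGD.lift_circ {G : Type (max u v)} [AddCommGroup G] [Module F G]
    {circ brk : G →ₗ[F] G →ₗ[F] G} (h : IsSpecialGD circ brk) (ρ : X → G) (a b : FreeSGD F X) :
    FreeSGD.lift h ρ (FreeSGD.circ a b) = circ (FreeSGD.lift h ρ a) (FreeSGD.lift h ρ b) := by
  have : FreeSGD.circ.compr₂ (FreeSGD.lift h ρ) =
      circ.compl₁₂ (FreeSGD.lift h ρ) (FreeSGD.lift h ρ) := by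
    apply FreeSGD.hom_ext
    intro m
    apply FreeSGD.hom_ext
    intro m'
    simp [← FreeSGD.mon_circ, FreeSGD.lift_mon, Magma₂.eval]
  exact LinearMap.congr_fun (LinearMap.congr_fun this a) b

theorem FreeSGD.lift_brk {G : Type (max u v)} [AddCommGroup G] [Module F G]
    {circ brk : G →ₗ[F] G →ₗ[F] G} (h : IsSpecialGD circ brk) (ρ : X → G) (a b : FreeSGD F X) :
    FreeSGD.lift h ρ (FreeSGD.brk a b) = brk (FreeSGD.lift h ρ a) (FreeSGD.lift h ρ b) := by
  have : FreeSGD.brk.compr₂ (FreeSGD.lift h ρ) =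
      brk.compl₁₂ (FreeSGD.lift h ρ) (FreeSGD.lift h ρ) := by
    apply FreeSGD.hom_ext
    intro m
    apply FreeSGD.hom_ext
    intro m'
    simp [← FreeSGD.mon_brk, FreeSGD.lift_mon, Magma₂.eval]
  exact LinearMap.congr_fun (LinearMap.congr_fun this a) b

theorem FreeSGD.isGelfandDorfman :
    IsGelfandDorfman (FreeSGD.circ : FreeSGD F X →ₗ[F] _) FreeSGD.brk where
  novikov :=
    { left_symm := fun x y z => FreeSGD.ext_lift fun G _ _ c b h ρ => by
        simp only [map_sub, FreeSGD.lift_circ]; exact h.1.novikov.left_symm _ _ _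
      right_comm := fun x y z => FreeSGD.ext_lift fun G _ _ c b h ρ => by
        simp only [FreeSGD.lift_circ]; exact h.1.novikov.right_comm _ _ _ }
  lie :=
    { skew := fun x y => FreeSGD.ext_lift fun G _ _ c b h ρ => by
        simp only [map_neg, FreeSGD.lift_brk]; exact h.1.lie.skew _ _
      jacobi := fun x y z => FreeSGD.ext_lift fun G _ _ c b h ρ => by
        simp only [map_add, map_zero, FreeSGD.lift_brk]; exact h.1.lie.jacobi _ _ _ }
  compat := fun x y z => FreeSGD.ext_lift fun G _ _ c b h ρ => by
    simp only [map_add, map_sub, FreeSGD.lift_brk, FreeSGD.lift_circ]; exact h.1.compat _ _ _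

/-- Coordinatewise bilinear operation on a product. -/
def piMul {I : Type w} {P : I → Type w} [∀ i, AddCommGroup (P i)] [∀ i, Module F (P i)]
    (mul : ∀ i, P i →ₗ[F] P i →ₗ[F] P i) :
    (∀ i, P i) →ₗ[F] (∀ i, P i) →ₗ[F] (∀ i, P i) :=
  LinearMap.mk₂ F (fun x y i => mul i (x i) (y i))
    (fun _ _ _ => by ext; simp) (fun _ _ _ => by ext; simp)
    (fun _ _ _ => by ext; simp) (fun _ _ _ => by ext; simp)

/-- The free special Gelfand--Dorfman algebra is special. -/
theorem FreeSGD.isSpecialGD :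
    IsSpecialGD (FreeSGD.circ : FreeSGD F X →ₗ[F] _) FreeSGD.brk := by
  refine ⟨FreeSGD.isGelfandDorfman, ?_⟩
  have key : ∀ a : {a : FreeSGD F X // a ≠ 0}, ∃ (P : Type (max u v)) (_ : AddCommGroup P)
      (_ : Module F P) (mul pbrk : P →ₗ[F] P →ₗ[F] P) (d : P →ₗ[F] P) (j : FreeSGD F X →ₗ[F] P),
      IsPoisson mul pbrk ∧ IsDerivation mul d ∧ IsDerivation pbrk d ∧ j a ≠ 0 ∧
      (∀ x y, j (FreeSGD.circ x y) = mul (j x) (d (j y))) ∧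
      (∀ x y, j (FreeSGD.brk x y) = pbrk (j x) (j y)) := by
    rintro ⟨a, ha⟩
    by_contra hcon
    apply ha
    apply FreeSGD.ext_lift
    intro G _ _ c b h ρ
    obtain ⟨P, i₁, i₂, mul, pbrk, d, j, h₁, h₂, h₃, h₄, h₅, h₆⟩ := h.2
    by_contra hne
    rw [map_zero] at hne
    refine hcon ⟨P, i₁, i₂, mul, pbrk, d, j ∘ₗ FreeSGD.lift h ρ, h₁, h₂, h₃, ?_, ?_, ?_⟩
    · intro h0
      exact hne (h₄ (by simpa using h0))
    · intro x y
      simp [FreeSGD.lift_circ, h₅]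
    · intro x y
      simp [FreeSGD.lift_brk, h₆]
  choose P i₁ i₂ mul pbrk d j h₁ h₂ h₃ h₄ h₅ h₆ using key
  refine ⟨∀ a, P a, inferInstance, inferInstance, piMul mul, piMul pbrk,
    LinearMap.pi fun a => d a ∘ₗ LinearMap.proj a, LinearMap.pi j, ?_, ?_, ?_, ?_, ?_, ?_⟩
  · exact
      { mul_comm := fun x y => by ext a; exact (h₁ a).mul_comm _ _
        mul_assoc := fun x y z => by ext a; exact (h₁ a).mul_assoc _ _ _
        lie :=
          { skew := fun x y => by ext a; exact (h₁ a).lie.skew _ _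
            jacobi := fun x y z => by ext a; exact (h₁ a).lie.jacobi _ _ _ }
        leibniz := fun x y z => by ext a; exact (h₁ a).leibniz _ _ _ }
  · intro x y; ext a; exact h₂ a _ _
  · intro x y; ext a; exact h₃ a _ _
  · rw [injective_iff_map_eq_zero]
    intro a ha
    by_contra hne
    exact h₄ ⟨a, hne⟩ (congrFun ha ⟨a, hne⟩)
  · intro x y; ext a; exact h₅ a _ _
  · intro x y; ext a; exact h₆ a _ _

/-- Universal property: a map from `X` to a special algebra extends uniquely to a homomorphism
from the free special algebra. -/
theorem FreeSGD.existsUnique_hom {G : Type (max u v)} [AddCommGroup G] [Module F G]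
    {circ brk : G →ₗ[F] G →ₗ[F] G} (h : IsSpecialGD circ brk) (ρ : X → G) :
    ∃! f : FreeSGD F X →ₗ[F] G, (∀ x, f (FreeSGD.mon F X (.of x)) = ρ x) ∧
      (∀ a b, f (FreeSGD.circ a b) = circ (f a) (f b)) ∧
      (∀ a b, f (FreeSGD.brk a b) = brk (f a) (f b)) := by
  refine ⟨FreeSGD.lift h ρ, ⟨fun x => FreeSGD.lift_mon h ρ _, FreeSGD.lift_circ h ρ,
    FreeSGD.lift_brk h ρ⟩, ?_⟩
  rintro f ⟨f₁, f₂, f₃⟩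
  apply FreeSGD.hom_ext
  intro m
  rw [FreeSGD.lift_mon]
  induction m with
  | of x => exact f₁ x
  | circ a b iha ihb => rw [FreeSGD.mon_circ, f₂, iha, ihb]; rfl
  | brk a b iha ihb => rw [FreeSGD.mon_brk, f₃, iha, ihb]; rfl

end Free

/-! ### Lyndon--Shirshov words -/

section LyndonShirshov

variable {Y : Type u}

/-- The leaves of a nonassociative word, from left to right. -/
def leaf : (w : FreeMagma Y) → Fin w.length → Y
  | .of y, _ => y
  | .mul a b, i => Fin.addCases (m := a.length) (n := b.length) (leaf a) (leaf b) i

/-- The associative word obtained from a nonassociative word by erasing all parentheses. -/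
def word (w : FreeMagma Y) : List Y := List.ofFn (leaf w)

/-- Replace the leaves of a nonassociative word, keeping the arrangement of parentheses. -/
def relabel {Z : Type w} : (w : FreeMagma Y) → (Fin w.length → Z) → FreeMagma Z
  | .of _, f => .of (f (0 : Fin 1))
  | .mul a b, f => .mul (relabel a fun i => f (Fin.castAdd b.length i))
      (relabel b fun i => f (Fin.natAdd a.length i))

variable [LinearOrder Y]

/-- The lexicographic order on associative words in which `u < 1` for each nonempty `u`, so that
a proper beginning of a word is greater than the whole word. -/
def wordLT : List Y → List Y → Prop
  | [], _ => False
  | _ :: _, [] => True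
  | a :: u, b :: v => a < b ∨ (a = b ∧ wordLT u v)

/-- Associative Lyndon--Shirshov words: if `w = uv` with nonempty `u`, `v`, then `w > vu`. -/
def IsAssocLS (w : List Y) : Prop :=
  ∀ u v : List Y, u ≠ [] → v ≠ [] → w = u ++ v → wordLT (v ++ u) w

/-- Nonassociative Lyndon--Shirshov words. In a product `[[u₁], [u₂]]` one requires `u₁ > u₂`, and
`u₂ ≥ u₁₂` if `[u₁] = [[u₁₁], [u₁₂]]`. -/
def IsLS : FreeMagma Y → Prop
  | .of _ => True
  | .mul u₁ u₂ => IsAssocLS (word (.mul u₁ u₂)) ∧ IsLS u₁ ∧ IsLS u₂ ∧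
      wordLT (word u₂) (word u₁) ∧
      ∀ u₁₁ u₁₂, u₁ = .mul u₁₁ u₁₂ → ¬ wordLT (word u₂) (word u₁₂)

/-- The order `A ≤ B` on Lyndon--Shirshov words: first by degree, then by the associative words. -/
def lieLE (A B : FreeMagma Y) : Prop :=
  A.length < B.length ∨ (A.length = B.length ∧ ¬ wordLT (word B) (word A))

end LyndonShirshov

/-! ### Canonical forms of monomials of weight `-1` -/

section Canonical

variable {X : Type u}

/-- The letters `x^(n)`: the pair `(n, x)`, ordered first by `n` and then by `x`. -/
abbrev DLetter (X : Type u) : Type u := ℕ ×ₗ X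

/-- The letter `x^(n)`. -/
def dl (x : X) (n : ℕ) : DLetter X := toLex (n, x)

/-- The order of derivative `n` of the letter `x^(n)`. -/
def DLetter.ord (y : DLetter X) : ℕ := (ofLex y).1

/-- The underlying generator `x` of the letter `x^(n)`. -/
def DLetter.gen (y : DLetter X) : X := (ofLex y).2

/-- The number of derivations occurring in a Lie word in the letters `x^(n)`. -/
def derivs : FreeMagma (DLetter X) → ℕ
  | .of y => DLetter.ord y
  | .mul a b => derivs a + derivs b

/-- The weight of a Lie word: `wt x = -1`, each derivation adds `1`, and
`wt {u, v} = wt u + wt v + 1`. -/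
def weight : FreeMagma (DLetter X) → ℤ
  | .of y => -1 + (DLetter.ord y : ℤ)
  | .mul a b => weight a + weight b + 1

/-- A monomial of weight `-1` of the standard basis of the free differential Poisson algebra on
`X`, that is, a commutative product of Lie Lyndon--Shirshov words in the letters `x^(n)`, in its
canonical form
`x_{i_1} ... x_{i_k} B_1 ... B_m A_n ... A_1 x_{j_l}^(r_l) ... x_{j_1}^(r_1)`.
The four lists hold the factors from left to right as displayed. -/
@[ext]
structure CanonicalForm (X : Type u) [LinearOrder X] where
  /-- `x_{i_1}, ..., x_{i_k}` -/
  xs : List X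
  /-- `B_1, ..., B_m` -/
  Bs : List (FreeMagma (DLetter X))
  /-- `A_n, ..., A_1` -/
  As : List (FreeMagma (DLetter X))
  /-- `x_{j_l}^(r_l), ..., x_{j_1}^(r_1)` -/
  ys : List (DLetter X)
  xs_sorted : xs.Pairwise (· ≤ ·)
  Bs_spec : ∀ B ∈ Bs, IsLS B ∧ 2 ≤ B.length ∧ derivs B = 0
  Bs_sorted : Bs.Pairwise lieLE
  As_spec : ∀ A ∈ As, IsLS A ∧ 2 ≤ A.length ∧ 1 ≤ derivs A
  As_sorted : As.Pairwise fun A A' => lieLE A' A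
  ys_spec : ∀ y ∈ ys, 1 ≤ DLetter.ord y
  ys_sorted : ys.Pairwise (· ≥ ·)
  weight_eq : ((xs.map fun x => weight (.of (dl x 0))).sum + (Bs.map weight).sum +
    (As.map weight).sum + (ys.map fun y => weight (.of y)).sum) = -1

end Canonical

/-! ### The map `ψ` -/

section Psi

variable {X : Type u}

/-- For each Lie word `w = x_1^(r_1) ... x_t^(r_t)` (with some arrangement of parentheses), a choice
of a permutation `π` of its letters such that the letter number `π 1` is the greatest one, the
letter number `π 2` is the next one, and so on. Only the mutual order of equal letters is left
open by the condition. -/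
def Sorting (X : Type u) [LinearOrder X] : Type u :=
  ∀ w : FreeMagma (DLetter X), {π : Equiv.Perm (Fin w.length) // Antitone (leaf w ∘ π)}

instance [LinearOrder X] : Nonempty (Sorting X) :=
  ⟨fun w => ⟨Fin.revPerm.trans (Tuple.sort (leaf w)), fun _ _ hij =>
    Tuple.monotone_sort (leaf w) (Fin.rev_le_rev.2 hij)⟩⟩

/-- `φ (c_1 ... c_p x^(p)) = c_p ∘ (c_{p-1} ∘ ... ∘ (c_1 ∘ x) ...)`. -/
def phi (c : List (Magma₂ X)) (x : X) : Magma₂ X :=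
  c.foldl (fun acc a => .circ a acc) (.of x)

/-- A nonassociative word in letters that are themselves monomials, read with the bracket `[,]`. -/
def toBrk : FreeMagma (Magma₂ X) → Magma₂ X
  | .of a => a
  | .mul a b => .brk (toBrk a) (toBrk b)

/-- The element `v_m = φ (c_{k-p_1-...-p_m+1} ... c_{k-p_1-...-p_{m-1}} x_{j_m}^(p_m))`, where
`x_{j_1}^(p_1), x_{j_2}^(p_2), ...` are the letters of `w` rearranged by the permutation `π`. -/
def vLetter (c : List (Magma₂ X)) (w : FreeMagma (DLetter X)) (π : Equiv.Perm (Fin w.length))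
    (m : Fin w.length) : Magma₂ X :=
  let p : Fin w.length → ℕ := fun i => DLetter.ord (leaf w (π i))
  let s : ℕ := ∑ i ∈ Finset.univ.filter (· < m), p i
  phi ((c.take (c.length - s)).drop (c.length - s - p m)) (DLetter.gen (leaf w (π m)))

/-- `ψ (c_1 ... c_k [w])` for a Lie word `[w]` with `k` derivations: the letter of `w` that is in
place number `m` of the rearranged word is replaced by `v_m`. -/
def psiLie (c : List (Magma₂ X)) (w : FreeMagma (DLetter X)) (π : Equiv.Perm (Fin w.length)) :
    Magma₂ X :=
  toBrk (relabel w fun i => vLetter c w π (π.symm i))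

/-- Replace the last `k` letters of the list `c_1, ..., c_m` by the one new letter that is
made of them. -/
def absorb (k : ℕ) (f : List (Magma₂ X) → Magma₂ X) (c : List (Magma₂ X)) : List (Magma₂ X) :=
  c.take (c.length - k) ++ [f (c.drop (c.length - k))]

theorem length_absorb (k : ℕ) (f : List (Magma₂ X) → Magma₂ X) (c : List (Magma₂ X)) :
    (absorb k f c).length = c.length - k + 1 := by
  simp [absorb]

theorem weight_eq_derivs (w : FreeMagma (DLetter X)) : weight w = (derivs w : ℤ) - 1 := by
  induction w with
  | ih1 y => change -1 + (DLetter.ord y : ℤ) = (DLetter.ord y : ℤ) - 1; ring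
  | ih2 a b iha ihb =>
    change weight a + weight b + 1 = ((derivs a + derivs b : ℕ) : ℤ) - 1
    rw [iha, ihb]; push_cast; ring

theorem length_foldl_absorb {α : Type w} (k : α → ℕ) (f : α → List (Magma₂ X) → Magma₂ X)
    (l : List α) (hk : ∀ a ∈ l, 1 ≤ k a) (c : List (Magma₂ X)) (r : ℕ)
    (hc : (c.length : ℤ) = r + 1 + (l.map fun a => (k a : ℤ) - 1).sum) :
    ((l.foldl (fun c a => absorb (k a) (f a) c) c).length : ℤ) = r + 1 := by
  induction l generalizing c with
  | nil => simpa using hc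
  | cons a l ih =>
    have hnn : 0 ≤ (l.map fun a => (k a : ℤ) - 1).sum := by
      apply List.sum_nonneg
      intro z hz
      obtain ⟨b, hb, rfl⟩ := List.mem_map.1 hz
      have := hk b (List.mem_cons_of_mem _ hb)
      omega
    rw [List.foldl_cons]
    apply ih (fun b hb => hk b (List.mem_cons_of_mem _ hb))
    rw [length_absorb]
    have := hk a List.mem_cons_self
    rw [List.map_cons, List.sum_cons] at hc
    omega

variable [LinearOrder X]

/-- The letters `c_1, ..., c_m` of weight `-1` of a canonical form: its factors `x_i`, followed by
the Lie words `B_i`, which do not involve derivations. -/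
def initialLetters (a : CanonicalForm X) : List (Magma₂ X) :=
  a.xs.map .of ++ a.Bs.map fun B => toBrk (relabel B fun i => .of (DLetter.gen (leaf B i)))

/-- First `A_n, ..., A_1` are turned one by one into new letters of weight `-1`, each of which is
greater than all the previous ones. -/
def stageLie (σ : Sorting X) (a : CanonicalForm X) : List (Magma₂ X) :=
  a.As.foldl (fun c A => absorb (derivs A) (fun c' => psiLie c' A (σ A)) c) (initialLetters a)

/-- Then the same happens to `x_{j_l}^(r_l), ..., x_{j_1}^(r_1)`. -/
def stageFinal (σ : Sorting X) (a : CanonicalForm X) : List (Magma₂ X) :=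
  a.ys.foldl (fun c y => absorb (DLetter.ord y) (fun c' => phi c' (DLetter.gen y)) c)
    (stageLie σ a)

/-- All letters are used up: exactly one element of weight `-1` is left. -/
theorem length_stageFinal (σ : Sorting X) (a : CanonicalForm X) :
    (stageFinal σ a).length = 1 := by
  have hw := a.weight_eq
  have hx : (a.xs.map fun x => weight (.of (dl x 0))).sum = -(a.xs.length : ℤ) := by
    have : ∀ x : X, weight (.of (dl x 0)) = -1 := fun x => rfl
    simp [this]
  have hB : (a.Bs.map weight).sum = -(a.Bs.length : ℤ) := by
    have : a.Bs.map weight = a.Bs.map fun _ => (-1 : ℤ) := by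
      apply List.map_congr_left
      intro B hB
      rw [weight_eq_derivs, (a.Bs_spec B hB).2.2]; rfl
    rw [this]; simp
  have hA : (a.As.map weight).sum = (a.As.map fun A => (derivs A : ℤ) - 1).sum :=
    congrArg List.sum (List.map_congr_left fun A _ => weight_eq_derivs A)
  have hy : (a.ys.map fun y => weight (.of y)).sum =
      (a.ys.map fun y => (DLetter.ord y : ℤ) - 1).sum :=
    congrArg List.sum (List.map_congr_left fun y _ => weight_eq_derivs (.of y))
  rw [hx, hB, hA, hy] at hw
  have hnn : 0 ≤ (a.ys.map fun y => (DLetter.ord y : ℤ) - 1).sum := by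
    apply List.sum_nonneg
    intro z hz
    obtain ⟨b, hb, rfl⟩ := List.mem_map.1 hz
    have := a.ys_spec b hb
    omega
  obtain ⟨r, hr⟩ := Int.eq_ofNat_of_zero_le hnn
  have h0 : ((initialLetters a).length : ℤ) = a.xs.length + a.Bs.length := by
    simp [initialLetters]
  have h1 : ((stageLie σ a).length : ℤ) = r + 1 := by
    apply length_foldl_absorb derivs (fun A c' => psiLie c' A (σ A)) a.As
      (fun A hA => (a.As_spec A hA).2.2)
    rw [h0]; omega
  have h2 : ((stageFinal σ a).length : ℤ) = (0 : ℕ) + 1 := by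
    apply length_foldl_absorb DLetter.ord (fun y c' => phi c' (DLetter.gen y)) a.ys a.ys_spec
    rw [h1, hr]; push_cast; ring
  omega

/-- The map `ψ` from canonical forms to monomials in the two operations `∘` and `[,]`. -/
def psi (σ : Sorting X) (a : CanonicalForm X) : Magma₂ X :=
  (stageFinal σ a)[0]'(by rw [length_stageFinal]; exact Nat.one_pos)

end Psi

end SGD

/-!
The free special Gelfand--Dorfman algebra is realized inside the free differential Poisson algebra
on `X`, and there `ψ(a)` turns out to be the monomial `a` plus lower monomials.

*The free differential Poisson algebra.* It is the symmetric algebra of the free Lie algebra on the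
letters `x^(n)`. Lyndon--Shirshov words form a basis of the free Lie algebra: they span because a
product `[a][b]` that is not itself a Lyndon--Shirshov word can be rewritten by the Jacobi identity
(`lie_mem_lsSpan`), and they are independent because in the free associative algebra each of them has
its own associative word as leading word (`assocHom_sub_mem_wordSpan`). Hence the commutative
products of Lyndon--Shirshov words form a basis of the symmetric algebra (`monoBasis`). The Lie
bracket extends to a Poisson bracket, the shift `x^(n) ↦ x^(n+1)` to a derivation, and the universal
property shows that an identity of special Gelfand--Dorfman algebras is nothing but a relation
between values in this algebra, that is, `toFreePoisson` is injective.

*Triangularity.* A word `c ∘ (... ∘ x)` expands to a product with all derivations on `x`, plus terms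
with fewer, but at least one, derivations on `x` (`pEval_phi`). By the Leibniz rule
`ψ(c_1 ... c_k w)` is `c_1 ... c_k w` modulo the ideal that is generated by Lie words with
derivations which are shorter than `w` or arise from `w` by lowering letters (`pEval_psiLie`); in the
Lyndon--Shirshov basis both kinds are less than `w` (`lieOf_mem_lsSpan_of_letterwiseLE`). The map `ψ`
creates the factors with derivations from the greatest to the least. So if monomials are compared
lexicographically by their increasing lists of factors with derivations, where a longer list is lower
than its beginnings, then `ψ(a)` has leading monomial `a` with coefficient `1`
(`pEval_psi_sub_mem`). The choice of the permutations does not affect the leading monomial.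

*Conclusion.* Unitriangularity gives linear independence. The operations `∘` and `[,]` preserve the
multiset of generators and the weight `-1`, there are finitely many monomials of weight `-1` with a
given multiset of generators, and each of them has a unique canonical form. So triangularity can be
inverted, and the elements `ψ(a)` span the part of weight `-1`, which contains the image of the free
special algebra.
-/

namespace SGD

/-! ### Lyndon--Shirshov words -/

section Words

variable {Y : Type u} [LinearOrder Y]

theorem wordLT_cons {a b : Y} {u v : List Y} :
    wordLT (a :: u) (b :: v) ↔ a < b ∨ (a = b ∧ wordLT u v) := Iff.rfl

theorem wordLT_nil_right {u : List Y} : wordLT u [] ↔ u ≠ [] := by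
  cases u <;> simp [wordLT]

theorem wordLT_irrefl (u : List Y) : ¬ wordLT u u := by
  induction u with
  | nil => exact fun h => h
  | cons a u ih => simp [wordLT_cons, ih]

theorem wordLT_trans {u v w : List Y} (h : wordLT u v) (h' : wordLT v w) : wordLT u w := by
  induction u generalizing v w with
  | nil => exact h.elim
  | cons a u ih =>
    cases w with
    | nil => simp [wordLT_nil_right]
    | cons c w =>
      cases v with
      | nil => exact h'.elim
      | cons b v =>
        rw [wordLT_cons] at *
        rcases h with h | ⟨rfl, h⟩ <;> rcases h' with h' | ⟨rfl, h'⟩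
        · exact Or.inl (h.trans h')
        · exact Or.inl h
        · exact Or.inl h'
        · exact Or.inr ⟨rfl, ih h h'⟩

theorem wordLT_asymm {u v : List Y} (h : wordLT u v) : ¬ wordLT v u :=
  fun h' => wordLT_irrefl u (wordLT_trans h h')

theorem wordLT_trichotomy (u v : List Y) : wordLT u v ∨ u = v ∨ wordLT v u := by
  induction u generalizing v with
  | nil => cases v <;> simp [wordLT]
  | cons a u ih =>
    cases v with
    | nil => simp [wordLT]
    | cons b v =>
      simp only [wordLT_cons, List.cons.injEq]
      rcases lt_trichotomy a b with h | rfl | h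
      · exact Or.inl (Or.inl h)
      · rcases ih v with h | rfl | h <;> simp [*]
      · exact Or.inr (Or.inr (Or.inl h))

theorem not_wordLT_iff {u v : List Y} : ¬ wordLT u v ↔ u = v ∨ wordLT v u := by
  constructor
  · intro h
    rcases wordLT_trichotomy u v with h' | h' | h'
    · exact (h h').elim
    · exact Or.inl h'
    · exact Or.inr h'
  · rintro (rfl | h)
    · exact wordLT_irrefl u
    · exact wordLT_asymm h

theorem wordLT_of_le_of_lt {u v w : List Y} (h : ¬ wordLT v u) (h' : wordLT v w) :
    wordLT u w := by
  rcases not_wordLT_iff.1 h with rfl | h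
  · exact h'
  · exact wordLT_trans h h'

theorem wordLT_of_lt_of_le {u v w : List Y} (h : wordLT u v) (h' : ¬ wordLT w v) :
    wordLT u w := by
  rcases not_wordLT_iff.1 h' with rfl | h'
  · exact h
  · exact wordLT_trans h h'

theorem wordLT_append_left {t u v : List Y} : wordLT (t ++ u) (t ++ v) ↔ wordLT u v := by
  induction t with
  | nil => rfl
  | cons a t ih => simp [wordLT_cons, ih]

/-- A proper beginning of a word is greater than the word. -/
theorem wordLT_append_self {u v : List Y} (h : v ≠ []) : wordLT (u ++ v) u := by
  simpa [wordLT_nil_right, h] using (wordLT_append_left (t := u) (u := v) (v := []))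

theorem wordLT_append_of_length_le {u v : List Y} (h : wordLT u v) (hl : u.length ≤ v.length)
    (x y : List Y) : wordLT (u ++ x) (v ++ y) := by
  induction u generalizing v with
  | nil => exact h.elim
  | cons a u ih =>
    cases v with
    | nil => simp at hl
    | cons b v =>
      rcases h with h | ⟨rfl, h⟩
      · exact Or.inl h
      · exact Or.inr ⟨rfl, ih h (by simpa using hl)⟩

/-- If `u < v`, then either `v` begins `u`, or the comparison is decided inside both words. -/
theorem wordLT_append_or {u v : List Y} (h : wordLT u v) :
    (∀ x y, wordLT (u ++ x) (v ++ y)) ∨ ∃ z, z ≠ [] ∧ u = v ++ z := by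
  induction u generalizing v with
  | nil => exact h.elim
  | cons a u ih =>
    cases v with
    | nil => exact Or.inr ⟨a :: u, by simp, by simp⟩
    | cons b v =>
      rcases h with h | ⟨rfl, h⟩
      · exact Or.inl fun x y => Or.inl h
      · rcases ih h with h | ⟨z, hz, rfl⟩
        · exact Or.inl fun x y => Or.inr ⟨rfl, h x y⟩
        · exact Or.inr ⟨z, hz, rfl⟩

/-- An associative word is Lyndon--Shirshov if and only if it is greater than each of its proper
endings. -/
theorem isAssocLS_iff {w : List Y} :
    IsAssocLS w ↔ ∀ u v : List Y, u ≠ [] → v ≠ [] → w = u ++ v → wordLT v w := by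
  constructor
  · rintro h u v hu hv rfl
    have hrot := h u v hu hv rfl
    rcases wordLT_trichotomy v (u ++ v) with h' | h' | h'
    · exact h'
    · have := congrArg List.length h'
      simp [hu] at this
    · rcases wordLT_append_or h' with h'' | ⟨z, hz, h''⟩
      · exact (wordLT_asymm hrot (by simpa using h'' [] u)).elim
      · -- A border `v` of the word: compare the two rotations that it yields.
        have hlen : u.length = z.length := by
          have := congrArg List.length h''
          simp at this; omega
        have hrot' := h v z hv hz h''
        rw [h'', wordLT_append_left] at hrot
        exact (wordLT_asymm hrot' (wordLT_append_of_length_le hrot hlen.le v v)).elim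
  · rintro h u v hu hv rfl
    have := wordLT_append_of_length_le (h u v hu hv rfl) (by simp) u []
    simpa using this

theorem IsAssocLS.append {a b : List Y} (ha : IsAssocLS a) (hb : IsAssocLS b) (ha0 : a ≠ [])
    (hab : wordLT b a) : IsAssocLS (a ++ b) := by
  rw [isAssocLS_iff] at *
  have hb' : wordLT b (a ++ b) := by
    rcases wordLT_append_or hab with h | ⟨z, hz, rfl⟩
    · simpa using h [] b
    · rw [wordLT_append_left]
      exact hb a z ha0 hz rfl
  intro u v hu hv huv
  rcases List.append_eq_append_iff.1 huv with ⟨t, rfl, rfl⟩ | ⟨t, rfl, rfl⟩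
  · rcases eq_or_ne t [] with rfl | ht
    · simpa using hb'
    · exact wordLT_trans (hb t v ht hv rfl) hb'
  · rcases eq_or_ne t [] with rfl | ht
    · simpa using hb'
    · exact wordLT_append_of_length_le (ha u t hu ht rfl) (by simp) b b

theorem isAssocLS_singleton (y : Y) : IsAssocLS [y] := by
  intro u v hu hv h
  rcases u with _ | ⟨a, u⟩
  · exact (hu rfl).elim
  · rcases v with _ | ⟨b, v⟩
    · exact (hv rfl).elim
    · have := congrArg List.length h
      simp at this

end Words

section Trees

variable {Y : Type u}

theorem word_of (y : Y) : word (.of y) = [y] := by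
  simp [word, leaf]

theorem word_mul (a b : FreeMagma Y) : word (.mul a b) = word a ++ word b := by
  change List.ofFn (n := a.length + b.length) (Fin.addCases (leaf a) (leaf b)) = _
  simp only [List.ofFn_add, Fin.addCases_right, word, List.append_cancel_right_eq]
  congr 1
  funext i
  exact Fin.addCases_left i

theorem length_word (w : FreeMagma Y) : (word w).length = w.length := by simp [word]

theorem word_ne_nil (w : FreeMagma Y) : word w ≠ [] := by
  rw [← List.length_pos_iff_ne_nil, length_word]
  exact w.length_pos

variable [LinearOrder Y]

theorem IsLS.isAssocLS {w : FreeMagma Y} (h : IsLS w) : IsAssocLS (word w) := by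
  cases w with
  | of y => rw [word_of]; exact isAssocLS_singleton y
  | mul a b => exact h.1

/-- In a nonassociative Lyndon--Shirshov word `[[a], [b]]`, the word `b` is the greatest proper
ending of `ab`. -/
theorem IsLS.ending_le {a b : FreeMagma Y} (h : IsLS (.mul a b)) {u s : List Y} (hu : u ≠ [])
    (hs : s ≠ []) (hus : word (.mul a b) = u ++ s) : ¬ wordLT (word b) s := by
  induction a generalizing b u s with
  | ih1 y =>
    rw [word_mul, word_of] at hus
    obtain ⟨c, u, rfl⟩ := List.exists_cons_of_ne_nil hu
    simp only [List.cons_append, List.nil_append, List.cons.injEq] at hus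
    obtain ⟨-, hus⟩ := hus
    rcases eq_or_ne u [] with rfl | hu'
    · rw [hus]; exact wordLT_irrefl _
    · exact wordLT_asymm (isAssocLS_iff.1 h.2.2.1.isAssocLS u s hu' hs hus)
  | ih2 a₁ a₂ ih₁ ih₂ =>
    have hb := h.2.2.1.isAssocLS
    rw [word_mul] at hus
    rcases List.append_eq_append_iff.1 hus with ⟨t, rfl, hb'⟩ | ⟨t, ha', rfl⟩
    · rcases eq_or_ne t [] with rfl | ht
      · rw [hb']; exact wordLT_irrefl _
      · exact wordLT_asymm (isAssocLS_iff.1 hb t s ht hs hb')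
    · rcases eq_or_ne t [] with rfl | ht
      · exact wordLT_irrefl _
      · have h₁ : ¬ wordLT (word a₂) t := ih₁ h.2.1 hu ht ha'
        have h₂ : ¬ wordLT (word b) (word a₂) := h.2.2.2.2 a₁ a₂ rfl
        have h₃ : wordLT (t ++ word b) t := wordLT_append_self (word_ne_nil b)
        exact wordLT_asymm (wordLT_of_lt_of_le (wordLT_of_lt_of_le h₃ h₁) h₂)

/-- A nonassociative Lyndon--Shirshov word is determined by its associative word. -/
theorem IsLS.eq_of_word_eq {w w' : FreeMagma Y} (h : IsLS w) (h' : IsLS w')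
    (hw : word w = word w') : w = w' := by
  induction w generalizing w' with
  | ih1 y =>
    cases w' with
    | of z =>
      rw [word_of, word_of] at hw
      rw [List.singleton_injective hw]
    | mul a b =>
      have := congrArg List.length hw
      rw [length_word, length_word] at this
      have := a.length_pos
      have := b.length_pos
      simp at *; omega
  | ih2 a b iha ihb =>
    cases w' with
    | of z =>
      have := congrArg List.length hw
      rw [length_word, length_word] at this
      have := a.length_pos
      have := b.length_pos
      simp at *; omega
    | mul a' b' =>
      have h₁ : ¬ wordLT (word b) (word b') :=
        IsLS.ending_le h (word_ne_nil a') (word_ne_nil b') (hw.trans (word_mul a' b'))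
      have h₂ : ¬ wordLT (word b') (word b) :=
        IsLS.ending_le h' (word_ne_nil a) (word_ne_nil b) (hw.symm.trans (word_mul a b))
      have hb : word b = word b' := (not_wordLT_iff.1 h₁).resolve_right h₂
      change word (.mul a b) = _ at hw
      rw [word_mul, word_mul, hb] at hw
      rw [ihb h.2.2.1 h'.2.2.1 hb, iha h.2.1 h'.2.1 (List.append_cancel_right hw)]
      rfl

end Trees

/-! ### Spanning the free Lie algebra -/

section FreeLie

variable (F : Type v) [Field F] {Y : Type u}

/-- The element of the free Lie algebra given by a nonassociative word. -/
noncomputable def lieOf : FreeMagma Y → FreeLieAlgebra F Y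
  | .of y => FreeLieAlgebra.of F y
  | .mul a b => ⁅lieOf a, lieOf b⁆

variable {F}

/-- The universal property of the free Lie algebra, for Lie brackets given as bilinear maps. -/
theorem exists_freeLieAlgebra_hom {M : Type w} [AddCommGroup M] [Module F M]
    (br : M →ₗ[F] M →ₗ[F] M) (alt : ∀ x, br x x = 0)
    (jac : ∀ x y z, br x (br y z) = br (br x y) z + br y (br x z)) (f : Y → M) :
    ∃ g : FreeLieAlgebra F Y →ₗ[F] M, (∀ y, g (FreeLieAlgebra.of F y) = f y) ∧
      ∀ a b, g ⁅a, b⁆ = br (g a) (g b) := by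
  let : LieRing M :=
    { bracket := fun x y => br x y
      add_lie := fun x y z => by simp
      lie_add := fun x y z => by simp
      lie_self := alt
      leibniz_lie := jac }
  let : LieAlgebra F M := { lie_smul := fun t x y => by change br _ _ = _; simp; rfl }
  exact ⟨FreeLieAlgebra.lift F f, fun y => FreeLieAlgebra.lift_of_apply f y,
    fun a b => LieHom.map_lie (FreeLieAlgebra.lift F f) a b⟩

theorem span_range_lieOf :
    Submodule.span F (Set.range (lieOf F : FreeMagma Y → FreeLieAlgebra F Y)) = ⊤ := by
  set S := Submodule.span F (Set.range (lieOf F : FreeMagma Y → FreeLieAlgebra F Y)) with hS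
  have hlie : ∀ {a b}, a ∈ S → b ∈ S → ⁅a, b⁆ ∈ S := by
    intro a b ha hb
    induction ha, hb using Submodule.span_induction₂ with
    | mem_mem x y hx hy =>
      obtain ⟨u, rfl⟩ := hx
      obtain ⟨v, rfl⟩ := hy
      exact Submodule.subset_span ⟨.mul u v, rfl⟩
    | zero_left y hy => simp
    | zero_right x hx => simp
    | add_left x y z _ _ _ h₁ h₂ => rw [add_lie]; exact S.add_mem h₁ h₂
    | add_right x y z _ _ _ h₁ h₂ => rw [lie_add]; exact S.add_mem h₁ h₂
    | smul_left r x y _ _ h => rw [smul_lie]; exact S.smul_mem r h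
    | smul_right r x y _ _ h => rw [lie_smul]; exact S.smul_mem r h
  let T : LieSubalgebra F (FreeLieAlgebra F Y) := { S with lie_mem' := hlie }
  have hof : ∀ y, FreeLieAlgebra.of F y ∈ T := fun y => Submodule.subset_span ⟨.of y, rfl⟩
  let g := FreeLieAlgebra.lift F (fun y => (⟨FreeLieAlgebra.of F y, hof y⟩ : T))
  have hg : T.incl.comp g = LieHom.id := by
    ext y
    simp [g]
  rw [eq_top_iff]
  intro a _
  have : T.incl (g a) = a := LieHom.congr_fun hg a
  rw [← this]
  exact (g a).2

/-- The multiset of letters of a nonassociative word. -/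
def content (w : FreeMagma Y) : Multiset Y := (word w : Multiset Y)

theorem content_of (y : Y) : content (.of y) = {y} := by simp [content, word_of]

theorem content_mul (a b : FreeMagma Y) : content (.mul a b) = content a + content b := by
  rw [content, word_mul, ← Multiset.coe_add]
  rfl

theorem card_content (w : FreeMagma Y) : (content w).card = w.length := by
  simp [content, length_word]

variable [LinearOrder Y]

variable (F) in
/-- The span of the Lyndon--Shirshov words with content `M` whose associative words satisfy `p`. -/
noncomputable def lsSpan (M : Multiset Y) (p : List Y → Prop) : Submodule F (FreeLieAlgebra F Y) :=
  Submodule.span F (lieOf F '' {u | IsLS u ∧ content u = M ∧ p (word u)})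

theorem lieOf_mem_lsSpan {M : Multiset Y} {p : List Y → Prop} {u : FreeMagma Y} (h : IsLS u)
    (hM : content u = M) (hp : p (word u)) : lieOf F u ∈ lsSpan F M p :=
  Submodule.subset_span ⟨u, ⟨h, hM, hp⟩, rfl⟩

theorem lsSpan_mono {M : Multiset Y} {p q : List Y → Prop} (h : ∀ l, p l → q l) :
    lsSpan F M p ≤ lsSpan F M q :=
  Submodule.span_mono (Set.image_mono fun _ hu => ⟨hu.1, hu.2.1, h _ hu.2.2⟩)

theorem lie_mem_of_forall_lsSpan {M M' : Multiset Y} {p p' : List Y → Prop}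
    {S : Submodule F (FreeLieAlgebra F Y)}
    (h : ∀ u v, IsLS u → content u = M → p (word u) → IsLS v → content v = M' → p' (word v) →
      ⁅lieOf F u, lieOf F v⁆ ∈ S)
    {a b : FreeLieAlgebra F Y} (ha : a ∈ lsSpan F M p) (hb : b ∈ lsSpan F M' p') : ⁅a, b⁆ ∈ S := by
  induction ha, hb using Submodule.span_induction₂ with
  | mem_mem x y hx hy =>
    obtain ⟨u, ⟨h₁, h₂, h₃⟩, rfl⟩ := hx
    obtain ⟨v, ⟨h₄, h₅, h₆⟩, rfl⟩ := hy
    exact h u v h₁ h₂ h₃ h₄ h₅ h₆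
  | zero_left y hy => simp
  | zero_right x hx => simp
  | add_left x y z _ _ _ h₁ h₂ => rw [add_lie]; exact S.add_mem h₁ h₂
  | add_right x y z _ _ _ h₁ h₂ => rw [lie_add]; exact S.add_mem h₁ h₂
  | smul_left r x y _ _ h => rw [smul_lie]; exact S.smul_mem r h
  | smul_right r x y _ _ h => rw [lie_smul]; exact S.smul_mem r h

theorem finite_setOf_coe_le (M : Multiset Y) : {l : List Y | (l : Multiset Y) ≤ M}.Finite := by
  classical
  refine Set.Finite.subset (Set.Finite.biUnion (Finset.finite_toSet (Finset.Iic M))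
    fun s _ => Finset.finite_toSet s.lists.toFinset) ?_
  intro l hl
  simp only [Set.mem_iUnion]
  refine ⟨(l : Multiset Y), by simpa using hl, ?_⟩
  simp only [Finset.mem_coe, Multiset.mem_toFinset, Multiset.mem_lists_iff]
  rfl

/-- The rewriting step for products of Lyndon--Shirshov words `a > b`. If `[a][b]` is not itself a
Lyndon--Shirshov word, then `a = a₁a₂` with `a₂ > b`, and by the Jacobi identity
`[[a₁, a₂], b] = [[a₁, b], a₂] + [a₁, [a₂, b]]` is a combination of products of two words both of
which are greater than `b`. -/
theorem lie_mem_lsSpan {a b : FreeMagma Y} (ha : IsLS a) (hb : IsLS b)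
    (hab : wordLT (word b) (word a)) :
    ⁅lieOf F a, lieOf F b⁆ ∈ lsSpan F (content a + content b) (wordLT (word b)) := by
  classical
  induction hn : a.length + b.length using Nat.strong_induction_on generalizing a b with
  | _ n ihn =>
  have ihn' : ∀ a' b' : FreeMagma Y, IsLS a' → IsLS b' → wordLT (word b') (word a') →
      a'.length + b'.length < n →
      ⁅lieOf F a', lieOf F b'⁆ ∈ lsSpan F (content a' + content b') (wordLT (word b')) :=
    fun a' b' h₁ h₂ h₃ h₄ => ihn _ h₄ h₁ h₂ h₃ rfl
  clear ihn
  obtain ⟨M, hM⟩ : ∃ M, content a + content b = M := ⟨_, rfl⟩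
  induction hk : {l : List Y | (l : Multiset Y) ≤ M ∧ wordLT (word b) l}.ncard
    using Nat.strong_induction_on generalizing a b with
  | _ k ihk =>
  -- Products of two words greater than `b` are known by induction.
  have key : ∀ p q : FreeMagma Y, IsLS p → IsLS q → wordLT (word b) (word p) →
      wordLT (word b) (word q) → content p + content q = M →
      ⁅lieOf F p, lieOf F q⁆ ∈ lsSpan F M (wordLT (word b)) := by
    have step : ∀ p q : FreeMagma Y, IsLS p → IsLS q → wordLT (word q) (word p) →
        wordLT (word b) (word q) → content p + content q = M →
        ⁅lieOf F p, lieOf F q⁆ ∈ lsSpan F M (wordLT (word b)) := by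
      intro p q hp hq hpq hbq hpM
      refine lsSpan_mono (fun l hl => wordLT_trans hbq hl) (hpM ▸ ihk _ ?_ hp hq hpq ?_ hpM rfl)
      · rw [← hk]
        refine Set.ncard_lt_ncard ⟨fun l hl => ⟨hl.1, wordLT_trans hbq hl.2⟩, fun h => ?_⟩
          ((finite_setOf_coe_le M).subset fun l hl => hl.1)
        have : (word q : Multiset Y) ≤ M := hpM ▸ Multiset.le_add_left _ _
        exact wordLT_irrefl _ (h ⟨this, hbq⟩).2
      · rw [← hn, ← card_content p, ← card_content q, ← card_content a, ← card_content b,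
          ← Multiset.card_add, ← Multiset.card_add, hpM, hM]
    intro p q hp hq hbp hbq hpM
    rcases wordLT_trichotomy (word p) (word q) with h | h | h
    · rw [← lie_skew]
      exact Submodule.neg_mem _ (step q p hq hp h hbp (by rwa [add_comm]))
    · rw [hp.eq_of_word_eq hq h, lie_self]
      exact Submodule.zero_mem _
    · exact step p q hp hq h hbq hpM
  by_cases hLS : IsLS (.mul a b)
  · have hw : wordLT (word b) (word (.mul a b)) := by
      rw [word_mul]
      exact isAssocLS_iff.1 (word_mul a b ▸ hLS.1) _ _ (word_ne_nil a) (word_ne_nil b) rfl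
    exact lieOf_mem_lsSpan hLS (content_mul a b) hw
  have hassoc : IsAssocLS (word (.mul a b)) := by
    rw [word_mul]
    exact ha.isAssocLS.append hb.isAssocLS (word_ne_nil a) hab
  cases a with
  | of y => exact (hLS ⟨hassoc, ha, hb, hab, by simp⟩).elim
  | mul a₁ a₂ =>
    have hba₂ : wordLT (word b) (word a₂) := by
      by_contra hcon
      refine hLS ⟨hassoc, ha, hb, hab, ?_⟩
      rintro u₁ u₂ ⟨rfl, rfl⟩
      exact hcon
    obtain ⟨-, ha₁, ha₂, ha₁₂, -⟩ := ha
    have hba₁ := wordLT_trans hba₂ ha₁₂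
    have hlen : (FreeMagma.mul a₁ a₂).length = a₁.length + a₂.length := rfl
    have hp₁ := a₁.length_pos
    have hp₂ := a₂.length_pos
    rw [content_mul] at hM
    have h₁ := ihn' a₁ b ha₁ hb hba₁ (by omega)
    have h₂ := ihn' a₂ b ha₂ hb hba₂ (by omega)
    have hjac : ⁅lieOf F (.mul a₁ a₂), lieOf F b⁆ =
        ⁅⁅lieOf F a₁, lieOf F b⁆, lieOf F a₂⁆ + ⁅lieOf F a₁, ⁅lieOf F a₂, lieOf F b⁆⁆ := by
      change ⁅⁅lieOf F a₁, lieOf F a₂⁆, lieOf F b⁆ = _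
      rw [lie_lie, ← lie_skew ⁅lieOf F a₁, lieOf F b⁆ (lieOf F a₂)]
      abel
    rw [hjac, content_mul, hM]
    refine Submodule.add_mem _ ?_ ?_
    · refine lie_mem_of_forall_lsSpan (M' := content a₂) (p' := fun l => l = word a₂) ?_ h₁
        (lieOf_mem_lsSpan ha₂ rfl rfl)
      intro u v hu hu' hu'' hv hv' hv''
      refine key u v hu hv hu'' (hv''.symm ▸ hba₂) ?_
      rw [hu', hv', ← hM]; abel
    · refine lie_mem_of_forall_lsSpan (M := content a₁) (p := fun l => l = word a₁) ?_
        (lieOf_mem_lsSpan ha₁ rfl rfl) h₂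
      intro u v hu hu' hu'' hv hv' hv''
      refine key u v hu hv (hu''.symm ▸ hba₁) hv'' ?_
      rw [hu', hv', ← hM]; abel

/-- Lyndon--Shirshov words span the free Lie algebra, compatibly with the multidegree. -/
theorem lieOf_mem_lsSpan_content (w : FreeMagma Y) :
    lieOf F w ∈ lsSpan F (content w) fun _ => True := by
  induction w with
  | ih1 y => exact lieOf_mem_lsSpan trivial rfl trivial
  | ih2 a b iha ihb =>
    refine lie_mem_of_forall_lsSpan ?_ iha ihb
    intro u v hu hu' _ hv hv' _
    change _ ∈ lsSpan F (content (.mul a b)) _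
    rw [content_mul, ← hu', ← hv']
    rcases wordLT_trichotomy (word u) (word v) with h | h | h
    · rw [← lie_skew, add_comm]
      exact Submodule.neg_mem _ (lsSpan_mono (fun _ _ => trivial) (lie_mem_lsSpan hv hu h))
    · rw [hu.eq_of_word_eq hv h, lie_self]
      exact Submodule.zero_mem _
    · exact lsSpan_mono (fun _ _ => trivial) (lie_mem_lsSpan hu hv h)

end FreeLie

/-! ### The Lyndon--Shirshov basis -/

section Triangular

variable {F : Type v} [Field F] {ι : Type u} {M : Type w} [AddCommGroup M] [Module F M]

/-- If the family `v` is unitriangular with respect to a strict order `r` and the coordinates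
`coef`, then a maximal index of a linear combination can be read off from its value. -/
theorem exists_maximal_coef {v : ι → M} {coef : ι → M →ₗ[F] F} {r : ι → ι → Prop}
    [IsStrictOrder ι r] {f : ι →₀ F} (hf : f ≠ 0) (h₁ : ∀ i ∈ f.support, coef i (v i) = 1)
    (h₀ : ∀ i ∈ f.support, ∀ j ∈ f.support, coef i (v j) ≠ 0 → i = j ∨ r i j) :
    ∃ i ∈ f.support, (∀ j ∈ f.support, ¬ r i j) ∧
      coef i (Finsupp.linearCombination F v f) = f i := by
  have hwf : (f.support : Set ι).WellFoundedOn (Function.swap r) :=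
    f.support.finite_toSet.wellFoundedOn
  obtain ⟨i₀, hi₀⟩ := Finsupp.support_nonempty_iff.2 hf
  obtain ⟨⟨i, hi⟩, -, hmin⟩ := WellFounded.has_min hwf Set.univ ⟨⟨i₀, hi₀⟩, trivial⟩
  have hmax : ∀ j ∈ f.support, ¬ r i j := fun j hj => hmin ⟨j, hj⟩ trivial
  refine ⟨i, hi, hmax, ?_⟩
  rw [Finsupp.linearCombination_apply, Finsupp.sum, map_sum, Finset.sum_eq_single i]
  · rw [map_smul, h₁ i hi, smul_eq_mul, mul_one]
  · intro j hj hji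
    have : coef i (v j) = 0 := by
      by_contra hne
      rcases h₀ i hi j hj hne with h | h
      · exact hji h.symm
      · exact hmax j hj h
    rw [map_smul, this, smul_zero]
  · intro h
    exact (h hi).elim

theorem linearIndependent_of_unitriangular {v : ι → M} (coef : ι → M →ₗ[F] F) (r : ι → ι → Prop)
    [IsStrictOrder ι r] (h₁ : ∀ i, coef i (v i) = 1)
    (h₀ : ∀ i j, coef i (v j) ≠ 0 → i = j ∨ r i j) : LinearIndependent F v := by
  rw [linearIndependent_iff]
  intro f hf
  by_contra hne
  obtain ⟨i, hi, -, h⟩ := exists_maximal_coef (r := r) hne (fun i _ => h₁ i) fun i _ j _ => h₀ i j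
  rw [hf, map_zero] at h
  exact Finsupp.mem_support_iff.1 hi h.symm

end Triangular

section Associative

variable (F : Type v) [Field F] {Y : Type u}

theorem exists_assocHom : ∃ g : FreeLieAlgebra F Y →ₗ[F] MonoidAlgebra F (FreeMonoid Y),
    (∀ y, g (FreeLieAlgebra.of F y) = MonoidAlgebra.single (FreeMonoid.of y) 1) ∧
      ∀ a b, g ⁅a, b⁆ = g a * g b - g b * g a :=
  exists_freeLieAlgebra_hom
    (LinearMap.mul F (MonoidAlgebra F (FreeMonoid Y)) - (LinearMap.mul F _).flip)
    (fun x => by simp) (fun x y z => by simp; noncomm_ring) _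

/-- The homomorphism from the free Lie algebra to the free associative algebra with its
commutator that fixes the letters. -/
noncomputable def assocHom : FreeLieAlgebra F Y →ₗ[F] MonoidAlgebra F (FreeMonoid Y) :=
  Classical.choose (exists_assocHom F)

theorem assocHom_lie (a b : FreeLieAlgebra F Y) :
    assocHom F ⁅a, b⁆ = assocHom F a * assocHom F b - assocHom F b * assocHom F a :=
  (Classical.choose_spec (exists_assocHom F)).2 a b

/-- The span of the associative words in the set `S`. -/
noncomputable def wordSpan (S : Set (List Y)) : Submodule F (MonoidAlgebra F (FreeMonoid Y)) :=
  Submodule.span F ((fun l => MonoidAlgebra.single (FreeMonoid.ofList l) 1) '' S)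

variable {F}

theorem assocHom_of (y : Y) :
    assocHom F (lieOf F (.of y)) = MonoidAlgebra.single (FreeMonoid.ofList [y]) 1 :=
  (Classical.choose_spec (exists_assocHom F)).1 y

theorem wordSpan_mono {S T : Set (List Y)} (h : S ⊆ T) : wordSpan F S ≤ wordSpan F T :=
  Submodule.span_mono (Set.image_mono h)

theorem mul_mem_wordSpan {S T R : Set (List Y)} (h : ∀ s ∈ S, ∀ t ∈ T, s ++ t ∈ R)
    {a b : MonoidAlgebra F (FreeMonoid Y)} (ha : a ∈ wordSpan F S) (hb : b ∈ wordSpan F T) :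
    a * b ∈ wordSpan F R := by
  refine Submodule.mul_le.1 ?_ a ha b hb
  rw [wordSpan, wordSpan, Submodule.span_mul_span, Submodule.span_le]
  rintro _ ⟨_, ⟨s, hs, rfl⟩, _, ⟨t, ht, rfl⟩, rfl⟩
  refine Submodule.subset_span ⟨s ++ t, h s hs t ht, ?_⟩
  simp [MonoidAlgebra.single_mul_single]

theorem coeff_eq_zero_of_mem_wordSpan {S : Set (List Y)} {a : MonoidAlgebra F (FreeMonoid Y)}
    (ha : a ∈ wordSpan F S) {l : List Y} (hl : l ∉ S) : a.coeff (FreeMonoid.ofList l) = 0 := by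
  induction ha using Submodule.span_induction with
  | mem x hx =>
    obtain ⟨s, hs, rfl⟩ := hx
    rw [MonoidAlgebra.coeff_single, Finsupp.single_eq_of_ne]
    intro h
    exact hl (FreeMonoid.ofList.injective h ▸ hs)
  | zero => simp
  | add x y _ _ h₁ h₂ => simp [h₁, h₂]
  | smul r x _ h => simp [h]

variable [LinearOrder Y]

/-- Words of the same length as `w` that are at most `w`. -/
def wordsLE (w : List Y) : Set (List Y) := {l | l.length = w.length ∧ ¬ wordLT w l}

/-- Words of the same length as `w` that are less than `w`. -/
def wordsLT (w : List Y) : Set (List Y) := {l | l.length = w.length ∧ wordLT l w}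

theorem wordsLT_subset (w : List Y) : wordsLT w ⊆ wordsLE w :=
  fun _ h => ⟨h.1, wordLT_asymm h.2⟩

theorem append_mem_wordsLE {u v l m : List Y} (hl : l ∈ wordsLE u) (hm : m ∈ wordsLE v) :
    l ++ m ∈ wordsLE (u ++ v) := by
  refine ⟨by simp [hl.1, hm.1], ?_⟩
  rw [not_wordLT_iff]
  rcases not_wordLT_iff.1 hl.2 with rfl | h
  · rcases not_wordLT_iff.1 hm.2 with rfl | h
    · exact Or.inl rfl
    · exact Or.inr (wordLT_append_left.2 h)
  · exact Or.inr (wordLT_append_of_length_le h hl.1.le _ _)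

theorem append_mem_wordsLT_left {u v l m : List Y} (hl : l ∈ wordsLT u) (hm : m ∈ wordsLE v) :
    l ++ m ∈ wordsLT (u ++ v) :=
  ⟨by simp [hl.1, hm.1], wordLT_append_of_length_le hl.2 hl.1.le _ _⟩

theorem append_mem_wordsLT_right {u v l m : List Y} (hl : l ∈ wordsLE u) (hm : m ∈ wordsLT v) :
    l ++ m ∈ wordsLT (u ++ v) := by
  refine ⟨by simp [hl.1, hm.1], ?_⟩
  rcases not_wordLT_iff.1 hl.2 with rfl | h
  · exact wordLT_append_left.2 hm.2
  · exact wordLT_append_of_length_le h hl.1.le _ _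

/-- `w'` is obtained from `w` by replacing letters by letters that are not greater. -/
def LetterwiseLE : FreeMagma Y → FreeMagma Y → Prop
  | .of z, .of y => z ≤ y
  | .mul a b, .mul a' b' => LetterwiseLE a a' ∧ LetterwiseLE b b'
  | _, _ => False

theorem LetterwiseLE.refl (w : FreeMagma Y) : LetterwiseLE w w := by
  induction w with
  | ih1 y => exact le_refl y
  | ih2 a b iha ihb => exact ⟨iha, ihb⟩

theorem LetterwiseLE.length_eq {w' w : FreeMagma Y} (h : LetterwiseLE w' w) :
    w'.length = w.length := by
  induction w' generalizing w with
  | ih1 z => cases w with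
    | of y => rfl
    | mul a b => exact h.elim
  | ih2 a b iha ihb => cases w with
    | of y => exact h.elim
    | mul a' b' => exact congrArg₂ (· + ·) (iha h.1) (ihb h.2)

theorem rotate_mem_wordsLT {a b : FreeMagma Y} (h : IsLS (.mul a b)) {l : List Y}
    (hl : l ∈ wordsLE (word b ++ word a)) : l ∈ wordsLT (word a ++ word b) := by
  have : wordLT (word b ++ word a) (word a ++ word b) := by
    rw [← word_mul a b]
    exact h.1 _ _ (word_ne_nil a) (word_ne_nil b) (word_mul a b)
  exact ⟨by rw [hl.1]; simp [add_comm], wordLT_of_le_of_lt hl.2 this⟩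

/-- In the associative expansion of a Lyndon--Shirshov word `w`, or of a word that is letterwise at
most `w`, there are only words that are at most the associative word of `w`; all of them are
strictly less as soon as some letter has been lowered. -/
theorem assocHom_mem_wordSpan {w' w : FreeMagma Y} (h : LetterwiseLE w' w) (hw : IsLS w) :
    assocHom F (lieOf F w') ∈ wordSpan F (wordsLE (word w)) ∧
      (w' ≠ w → assocHom F (lieOf F w') ∈ wordSpan F (wordsLT (word w))) := by
  induction w' generalizing w with
  | ih1 z =>
    cases w with
    | mul a b => exact h.elim
    | of y =>
      have h' : z ≤ y := h
      rw [word_of]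
      erw [assocHom_of]
      constructor
      · exact Submodule.subset_span ⟨[z], ⟨rfl, by simp [wordLT, h']⟩, rfl⟩
      · intro hne
        have : z ≠ y := fun hzy => hne (hzy ▸ rfl)
        exact Submodule.subset_span ⟨[z], ⟨rfl, by simp [wordLT, lt_of_le_of_ne h' this]⟩, rfl⟩
  | ih2 a' b' iha ihb =>
    cases w with
    | of y => exact h.elim
    | mul a b =>
      obtain ⟨ha₁, ha₂⟩ := iha h.1 hw.2.1
      obtain ⟨hb₁, hb₂⟩ := ihb h.2 hw.2.2.1
      have hexp : assocHom F (lieOf F (a' * b')) = assocHom F (lieOf F a') * assocHom F (lieOf F b')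
          - assocHom F (lieOf F b') * assocHom F (lieOf F a') := assocHom_lie F _ _
      have hrot : assocHom F (lieOf F b') * assocHom F (lieOf F a') ∈
          wordSpan F (wordsLT (word a ++ word b)) :=
        wordSpan_mono (fun l => rotate_mem_wordsLT hw)
          (mul_mem_wordSpan (fun _ hs _ ht => append_mem_wordsLE hs ht) hb₁ ha₁)
      rw [hexp, word_mul]
      constructor
      · exact Submodule.sub_mem _
          (mul_mem_wordSpan (fun _ hs _ ht => append_mem_wordsLE hs ht) ha₁ hb₁)
          (wordSpan_mono (wordsLT_subset _) hrot)
      · intro hne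
        refine Submodule.sub_mem _ ?_ hrot
        by_cases haa : a' = a
        · have hbb : b' ≠ b := fun hbb => hne (haa ▸ hbb ▸ rfl)
          exact mul_mem_wordSpan (fun _ hs _ ht => append_mem_wordsLT_right hs ht) ha₁ (hb₂ hbb)
        · exact mul_mem_wordSpan (fun _ hs _ ht => append_mem_wordsLT_left hs ht) (ha₂ haa) hb₁

/-- The leading word of a Lyndon--Shirshov word is its associative word, with coefficient `1`. -/
theorem assocHom_sub_mem_wordSpan {w : FreeMagma Y} (hw : IsLS w) :
    assocHom F (lieOf F w) - MonoidAlgebra.single (FreeMonoid.ofList (word w)) 1 ∈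
      wordSpan F (wordsLT (word w)) := by
  induction w with
  | ih1 y =>
    erw [assocHom_of, word_of, sub_self]
    exact Submodule.zero_mem _
  | ih2 a b iha ihb =>
    have ha₁ := (assocHom_mem_wordSpan (F := F) (LetterwiseLE.refl a) hw.2.1).1
    have hb₁ := (assocHom_mem_wordSpan (F := F) (LetterwiseLE.refl b) hw.2.2.1).1
    have hself : MonoidAlgebra.single (FreeMonoid.ofList (word a)) 1 ∈
        wordSpan F (wordsLE (word a)) :=
      Submodule.subset_span ⟨_, ⟨rfl, wordLT_irrefl _⟩, rfl⟩
    have hrot : assocHom F (lieOf F b) * assocHom F (lieOf F a) ∈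
        wordSpan F (wordsLT (word a ++ word b)) :=
      wordSpan_mono (fun l => rotate_mem_wordsLT hw)
        (mul_mem_wordSpan (fun _ hs _ ht => append_mem_wordsLE hs ht) hb₁ ha₁)
    have hexp : assocHom F (lieOf F (a * b)) -
          MonoidAlgebra.single (FreeMonoid.ofList (word a ++ word b)) 1 =
        (assocHom F (lieOf F a) - MonoidAlgebra.single (FreeMonoid.ofList (word a)) 1) *
          assocHom F (lieOf F b) +
        MonoidAlgebra.single (FreeMonoid.ofList (word a)) 1 *
          (assocHom F (lieOf F b) - MonoidAlgebra.single (FreeMonoid.ofList (word b)) 1) -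
        assocHom F (lieOf F b) * assocHom F (lieOf F a) := by
      rw [show assocHom F (lieOf F (a * b)) = _ from assocHom_lie F _ _, FreeMonoid.ofList_append,
        ← mul_one (1 : F), ← MonoidAlgebra.single_mul_single, mul_one]
      noncomm_ring
    have hword : word (a * b) = word a ++ word b := word_mul a b
    rw [hword, hexp]
    exact Submodule.sub_mem _ (Submodule.add_mem _
      (mul_mem_wordSpan (fun _ hs _ ht => append_mem_wordsLT_left hs ht) (iha hw.2.1) hb₁)
      (mul_mem_wordSpan (fun _ hs _ ht => append_mem_wordsLT_right hs ht) hself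
        (ihb hw.2.2.1))) hrot

variable (F) in
/-- The coefficient of an associative word. -/
noncomputable def wordCoef (l : List Y) : MonoidAlgebra F (FreeMonoid Y) →ₗ[F] F where
  toFun a := a.coeff (FreeMonoid.ofList l)
  map_add' _ _ := by simp
  map_smul' _ _ := by simp

theorem wordCoef_self {w : FreeMagma Y} (hw : IsLS w) :
    wordCoef F (word w) (assocHom F (lieOf F w)) = 1 := by
  have h : wordCoef F (word w) (assocHom F (lieOf F w) -
      MonoidAlgebra.single (FreeMonoid.ofList (word w)) 1) = 0 :=
    coeff_eq_zero_of_mem_wordSpan (assocHom_sub_mem_wordSpan (F := F) hw)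
    (l := word w) fun h => wordLT_irrefl _ h.2
  rw [map_sub, sub_eq_zero] at h
  rw [h]
  change (MonoidAlgebra.single _ (1 : F)).coeff _ = 1
  simp [MonoidAlgebra.coeff_single]

theorem eq_or_wordLT_of_wordCoef_ne_zero {u w : FreeMagma Y} (hu : IsLS u) (hw : IsLS w)
    (h : wordCoef F (word u) (assocHom F (lieOf F w)) ≠ 0) :
    u = w ∨ wordLT (word u) (word w) := by
  by_contra hcon
  rw [not_or] at hcon
  refine h (coeff_eq_zero_of_mem_wordSpan
    (assocHom_mem_wordSpan (LetterwiseLE.refl w) hw).1 fun hmem => ?_)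
  rcases not_wordLT_iff.1 hmem.2 with h' | h'
  · exact hcon.1 (hu.eq_of_word_eq hw h'.symm)
  · exact hcon.2 h'

instance isStrictOrder_wordLT_word :
    IsStrictOrder (FreeMagma Y) fun u v => wordLT (word u) (word v) where
  irrefl _ := wordLT_irrefl _
  trans _ _ _ := wordLT_trans

instance isStrictOrder_wordLT_word_coe : IsStrictOrder {u : FreeMagma Y // IsLS u}
    fun u v => wordLT (word u.1) (word v.1) where
  irrefl _ := wordLT_irrefl _
  trans _ _ _ := wordLT_trans

variable (F Y) in
/-- The Lyndon--Shirshov basis of the free Lie algebra. -/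
noncomputable def lsBasis : Module.Basis {u : FreeMagma Y // IsLS u} F (FreeLieAlgebra F Y) :=
  Module.Basis.mk (v := fun u => lieOf F u.1)
    (linearIndependent_of_unitriangular (fun u => wordCoef F (word u.1) ∘ₗ assocHom F)
      (fun u v => wordLT (word u.1) (word v.1)) (fun u => wordCoef_self u.2)
      (fun u v h => (eq_or_wordLT_of_wordCoef_ne_zero u.2 v.2 h).imp_left Subtype.ext))
    (by
      rw [← span_range_lieOf, Submodule.span_le]
      rintro _ ⟨w, rfl⟩
      refine Submodule.span_mono ?_ (lieOf_mem_lsSpan_content w)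
      rintro _ ⟨u, ⟨hu, -, -⟩, rfl⟩
      exact ⟨⟨u, hu⟩, rfl⟩)

theorem lsBasis_apply (u : {u : FreeMagma Y // IsLS u}) : lsBasis F Y u = lieOf F u.1 := by
  simp [lsBasis]

theorem mem_lsSpan_of_assocHom_mem {M : Multiset Y} {a : FreeLieAlgebra F Y}
    (ha : a ∈ lsSpan F M fun _ => True) {l : List Y} (hl : assocHom F a ∈ wordSpan F (wordsLT l)) :
    a ∈ lsSpan F M fun m => wordLT m l := by
  obtain ⟨f, hf, rfl⟩ := (Finsupp.mem_span_image_iff_linearCombination F).1 ha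
  have hf' : ∀ u ∈ f.support, IsLS u ∧ content u = M ∧ True := fun u hu => hf hu
  rcases eq_or_ne f 0 with rfl | hne
  · rw [map_zero]; exact Submodule.zero_mem _
  obtain ⟨u, hu, hmax, hcoef⟩ := exists_maximal_coef
    (v := lieOf F) (coef := fun u => wordCoef F (word u) ∘ₗ assocHom F)
    (r := fun u v => wordLT (word u) (word v)) hne (fun i hi => wordCoef_self (hf' i hi).1)
    (fun i hi j hj h => eq_or_wordLT_of_wordCoef_ne_zero (hf' i hi).1 (hf' j hj).1 h)
  have hul : wordLT (word u) l := by
    by_contra hcon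
    refine Finsupp.mem_support_iff.1 hu (hcoef.symm.trans ?_)
    exact coeff_eq_zero_of_mem_wordSpan hl fun h => hcon h.2
  refine (Finsupp.mem_span_image_iff_linearCombination F).2 ⟨f, ?_, rfl⟩
  intro v hv
  exact ⟨(hf' v hv).1, (hf' v hv).2.1, wordLT_of_le_of_lt (hmax v hv) hul⟩

/-- Lowering letters of a Lyndon--Shirshov word gives a combination of smaller ones. -/
theorem lieOf_mem_lsSpan_of_letterwiseLE {w' w : FreeMagma Y} (h : LetterwiseLE w' w)
    (hw : IsLS w) (hne : w' ≠ w) :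
    lieOf F w' ∈ lsSpan F (content w') fun m => wordLT m (word w) :=
  mem_lsSpan_of_assocHom_mem (lieOf_mem_lsSpan_content w') ((assocHom_mem_wordSpan h hw).2 hne)

end Associative

/-! ### Poisson brackets on symmetric algebras -/

section PoissonPolynomials

open MvPolynomial

variable {F : Type v} [Field F] {L : Type w} [LieRing L] [LieAlgebra F L] {ι : Type u}
  (b : Module.Basis ι F L)

/-- The inclusion of a Lie algebra with basis `ι` into its symmetric algebra, that is, into the
polynomials in variables `ι`. -/
noncomputable def lieIncl : L →ₗ[F] MvPolynomial ι F := b.constr F X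

theorem lieIncl_basis (i : ι) : lieIncl b (b i) = X i := by
  simp [lieIncl]

/-- The derivation of the symmetric algebra that extends the adjoint action of a basis vector. -/
noncomputable def adBasis (i : ι) : Derivation F (MvPolynomial ι F) (MvPolynomial ι F) :=
  mkDerivation F fun j => lieIncl b ⁅b i, b j⁆

/-- The Poisson bracket on the symmetric algebra of a Lie algebra that extends the Lie bracket. -/
noncomputable def polyBrk : MvPolynomial ι F →ₗ[F] MvPolynomial ι F →ₗ[F] MvPolynomial ι F :=
  LinearMap.mk₂ F (fun f g => mkDerivation F (fun i => adBasis b i g) f)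
    (fun _ _ _ => map_add _ _ _) (fun _ _ _ => Derivation.map_smul _ _ _)
    (fun f g g' => by
      have : mkDerivation F (fun i => adBasis b i (g + g')) =
          mkDerivation F (fun i => adBasis b i g) + mkDerivation F (fun i => adBasis b i g') :=
        derivation_ext fun i => by simp
      rw [this]; rfl)
    (fun c f g => by
      have : mkDerivation F (fun i => adBasis b i (c • g)) =
          c • mkDerivation F (fun i => adBasis b i g) :=
        derivation_ext fun i => by simp
      rw [this]; rfl)

theorem polyBrk_apply (f g : MvPolynomial ι F) :
    polyBrk b f g = mkDerivation F (fun i => adBasis b i g) f := rfl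

theorem polyBrk_mul_left (f g h : MvPolynomial ι F) :
    polyBrk b (f * g) h = f * polyBrk b g h + g * polyBrk b f h := by
  simp [polyBrk_apply, Derivation.leibniz]

theorem polyBrk_C_left (c : F) (g : MvPolynomial ι F) : polyBrk b (C c) g = 0 := by
  simp [polyBrk_apply]

theorem polyBrk_X_left (i : ι) (g : MvPolynomial ι F) : polyBrk b (X i) g = adBasis b i g := by
  simp [polyBrk_apply]

/-- Polynomials are built from constants and variables by sums and products. -/
theorem mvPolynomial_induction {p : MvPolynomial ι F → Prop} (hC : ∀ c, p (C c))
    (hX : ∀ i, p (X i)) (hadd : ∀ f g, p f → p g → p (f + g))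
    (hmul : ∀ f g, p f → p g → p (f * g)) (f : MvPolynomial ι F) : p f :=
  MvPolynomial.induction_on f hC hadd fun f i hf => hmul f (X i) hf (hX i)

theorem polyBrk_mul_right (f g h : MvPolynomial ι F) :
    polyBrk b f (g * h) = g * polyBrk b f h + h * polyBrk b f g := by
  induction f using mvPolynomial_induction with
  | hC c => simp [polyBrk_C_left]
  | hX i => simp [polyBrk_X_left, Derivation.leibniz]
  | hadd f f' h₁ h₂ => simp only [map_add, LinearMap.add_apply, h₁, h₂]; ring
  | hmul f f' h₁ h₂ => simp only [polyBrk_mul_left, h₁, h₂]; ring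

theorem polyBrk_C_right (c : F) (f : MvPolynomial ι F) : polyBrk b f (C c) = 0 := by
  induction f using mvPolynomial_induction with
  | hC c => simp [polyBrk_C_left]
  | hX i => simp [polyBrk_X_left]
  | hadd f f' h₁ h₂ => simp [h₁, h₂]
  | hmul f f' h₁ h₂ => simp [polyBrk_mul_left, h₁, h₂]

theorem polyBrk_lieIncl (x y : L) :
    polyBrk b (lieIncl b x) (lieIncl b y) = lieIncl b ⁅x, y⁆ := by
  have hbr : (polyBrk b).compl₁₂ (lieIncl b) (lieIncl b) =
      (LinearMap.mk₂ F (fun x y : L => ⁅x, y⁆) add_lie smul_lie lie_add lie_smul).compr₂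
        (lieIncl b) := by
    refine b.ext fun i => b.ext fun j => ?_
    simp [lieIncl_basis, polyBrk_X_left, adBasis]
  exact LinearMap.congr_fun (LinearMap.congr_fun hbr x) y

theorem polyBrk_skew (f g : MvPolynomial ι F) : polyBrk b f g = - polyBrk b g f := by
  induction f using mvPolynomial_induction with
  | hC c => simp [polyBrk_C_left, polyBrk_C_right]
  | hadd f f' h₁ h₂ => simp only [map_add, LinearMap.add_apply, h₁, h₂]; ring
  | hmul f f' h₁ h₂ => simp only [polyBrk_mul_left, polyBrk_mul_right, h₁, h₂]; ring
  | hX i =>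
    induction g using mvPolynomial_induction with
    | hC c => simp [polyBrk_C_left, polyBrk_C_right]
    | hadd f f' h₁ h₂ => simp only [map_add, LinearMap.add_apply, h₁, h₂]; ring
    | hmul f f' h₁ h₂ => simp only [polyBrk_mul_left, polyBrk_mul_right, h₁, h₂]; ring
    | hX j =>
      rw [← lieIncl_basis b, ← lieIncl_basis b, polyBrk_lieIncl, polyBrk_lieIncl, ← map_neg, lie_skew]

theorem lie_lie_jacobi (x y z : L) : ⁅⁅x, y⁆, z⁆ + ⁅⁅y, z⁆, x⁆ + ⁅⁅z, x⁆, y⁆ = 0 := by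
  rw [← lie_skew ⁅x, y⁆ z, ← lie_skew ⁅y, z⁆ x, ← lie_skew ⁅z, x⁆ y, ← neg_add, ← neg_add,
    neg_eq_zero, ← lie_jacobi x y z]
  abel

theorem polyBrk_jacobi (f g h : MvPolynomial ι F) :
    polyBrk b (polyBrk b f g) h + polyBrk b (polyBrk b g h) f + polyBrk b (polyBrk b h f) g = 0 := by
  -- The Jacobi identity is stable under products in the first argument and under rotation.
  have hmul : ∀ f f' g h : MvPolynomial ι F,
      polyBrk b (polyBrk b f g) h + polyBrk b (polyBrk b g h) f + polyBrk b (polyBrk b h f) g = 0 →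
      polyBrk b (polyBrk b f' g) h + polyBrk b (polyBrk b g h) f' +
        polyBrk b (polyBrk b h f') g = 0 →
      polyBrk b (polyBrk b (f * f') g) h + polyBrk b (polyBrk b g h) (f * f') +
        polyBrk b (polyBrk b h (f * f')) g = 0 := by
    intro f f' g h h₁ h₂
    simp only [polyBrk_mul_left, polyBrk_mul_right, map_add, LinearMap.add_apply]
    rw [polyBrk_skew b h f, polyBrk_skew b h f'] at *
    simp only [map_neg, LinearMap.neg_apply] at *
    linear_combination f' * h₁ + f * h₂
  have hadd : ∀ f f' g h : MvPolynomial ι F,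
      polyBrk b (polyBrk b f g) h + polyBrk b (polyBrk b g h) f + polyBrk b (polyBrk b h f) g = 0 →
      polyBrk b (polyBrk b f' g) h + polyBrk b (polyBrk b g h) f' +
        polyBrk b (polyBrk b h f') g = 0 →
      polyBrk b (polyBrk b (f + f') g) h + polyBrk b (polyBrk b g h) (f + f') +
        polyBrk b (polyBrk b h (f + f')) g = 0 := by
    intro f f' g h h₁ h₂
    simp only [map_add, LinearMap.add_apply]
    linear_combination h₁ + h₂
  induction f using mvPolynomial_induction with
  | hC c => simp [polyBrk_C_left, polyBrk_C_right]
  | hadd f f' h₁ h₂ => exact hadd f f' g h h₁ h₂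
  | hmul f f' h₁ h₂ => exact hmul f f' g h h₁ h₂
  | hX i =>
    rw [add_rotate]
    induction g using mvPolynomial_induction with
    | hC c => simp [polyBrk_C_left, polyBrk_C_right]
    | hadd f f' h₁ h₂ => exact hadd f f' _ _ h₁ h₂
    | hmul f f' h₁ h₂ => exact hmul f f' _ _ h₁ h₂
    | hX j =>
      rw [add_rotate]
      induction h using mvPolynomial_induction with
      | hC c => simp [polyBrk_C_left, polyBrk_C_right]
      | hadd f f' h₁ h₂ => exact hadd f f' _ _ h₁ h₂
      | hmul f f' h₁ h₂ => exact hmul f f' _ _ h₁ h₂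
      | hX k =>
        simp only [← lieIncl_basis b, polyBrk_lieIncl, ← map_add]
        rw [lie_lie_jacobi, map_zero]

theorem isPoisson_polyBrk : IsPoisson (LinearMap.mul F (MvPolynomial ι F)) (polyBrk b) where
  mul_comm x y := mul_comm x y
  mul_assoc x y z := mul_assoc x y z
  lie := ⟨polyBrk_skew b, polyBrk_jacobi b⟩
  leibniz x y z := by
    simp only [LinearMap.mul_apply', polyBrk_mul_right]
    ring

/-- The derivation of the symmetric algebra that extends a linear map of the Lie algebra. -/
noncomputable def polyDer (D : L →ₗ[F] L) : Derivation F (MvPolynomial ι F) (MvPolynomial ι F) :=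
  mkDerivation F fun i => lieIncl b (D (b i))

theorem polyDer_lieIncl (D : L →ₗ[F] L) (x : L) :
    polyDer b D (lieIncl b x) = lieIncl b (D x) := by
  have h : (polyDer b D).toLinearMap ∘ₗ lieIncl b = lieIncl b ∘ₗ D :=
    b.ext fun i => by simp [lieIncl_basis, polyDer]
  exact LinearMap.congr_fun h x

theorem polyDer_polyBrk {D : L →ₗ[F] L} (hD : ∀ x y, D ⁅x, y⁆ = ⁅D x, y⁆ + ⁅x, D y⁆)
    (f g : MvPolynomial ι F) :
    polyDer b D (polyBrk b f g) = polyBrk b (polyDer b D f) g + polyBrk b f (polyDer b D g) := by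
  induction f using mvPolynomial_induction with
  | hC c => simp [polyBrk_C_left]
  | hadd f f' h₁ h₂ => simp only [map_add, LinearMap.add_apply, h₁, h₂]; ring
  | hmul f f' h₁ h₂ =>
    simp only [polyBrk_mul_left, map_add, Derivation.leibniz, smul_eq_mul, h₁, h₂,
      LinearMap.add_apply]
    ring
  | hX i =>
    induction g using mvPolynomial_induction with
    | hC c => simp [polyBrk_C_right]
    | hadd f f' h₁ h₂ => simp only [map_add, h₁, h₂]; ring
    | hmul f f' h₁ h₂ =>
      simp only [polyBrk_mul_right, map_add, Derivation.leibniz, smul_eq_mul, h₁, h₂]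
      ring
    | hX j => simp only [← lieIncl_basis b, polyDer_lieIncl, polyBrk_lieIncl, hD, map_add]

end PoissonPolynomials

section FreeLieDerivation

variable (F : Type v) [Field F] {Y : Type u}

theorem exists_lieDer (s : Y → Y) : ∃ D : FreeLieAlgebra F Y →ₗ[F] FreeLieAlgebra F Y,
    (∀ y, D (FreeLieAlgebra.of F y) = FreeLieAlgebra.of F (s y)) ∧
      ∀ a b, D ⁅a, b⁆ = ⁅D a, b⁆ + ⁅a, D b⁆ := by
  -- The graph of a derivation is a homomorphism to the tangent Lie algebra `L ⊕ εL`, `ε² = 0`.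
  let br : (FreeLieAlgebra F Y × FreeLieAlgebra F Y) →ₗ[F]
      (FreeLieAlgebra F Y × FreeLieAlgebra F Y) →ₗ[F]
      (FreeLieAlgebra F Y × FreeLieAlgebra F Y) :=
    LinearMap.mk₂ F (fun x y => (⁅x.1, y.1⁆, ⁅x.2, y.1⁆ + ⁅x.1, y.2⁆))
      (fun x y z => by ext <;> simp; abel) (fun c x y => by ext <;> simp)
      (fun x y z => by ext <;> simp; abel) (fun c x y => by ext <;> simp)
  have hbr : ∀ x y, br x y = (⁅x.1, y.1⁆, ⁅x.2, y.1⁆ + ⁅x.1, y.2⁆) := fun _ _ => rfl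
  obtain ⟨g, hg₁, hg₂⟩ := exists_freeLieAlgebra_hom br
    (fun x => by
      rw [hbr, lie_self, ← lie_skew x.2 x.1, neg_add_cancel]; rfl)
    (fun x y z => by
      simp only [hbr, lie_add, add_lie, Prod.mk_add_mk]
      ext
      · exact leibniz_lie _ _ _
      · simp only
        rw [leibniz_lie x.2 y.1 z.1, leibniz_lie x.1 y.2 z.1, leibniz_lie x.1 y.1 z.2]
        abel)
    (fun y => (FreeLieAlgebra.of F y, FreeLieAlgebra.of F (s y)))
  have hfst : ∀ a, (g a).1 = a := by
    intro a
    have : LinearMap.fst F _ _ ∘ₗ g = LinearMap.id := by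
      refine LinearMap.ext_on_range span_range_lieOf fun w => ?_
      induction w with
      | ih1 y => exact congrArg Prod.fst (hg₁ y)
      | ih2 u v ihu ihv =>
        change (g ⁅lieOf F u, lieOf F v⁆).1 = ⁅lieOf F u, lieOf F v⁆
        rw [hg₂, hbr]
        exact congrArg₂ (fun x y => ⁅x, y⁆) ihu ihv
    exact LinearMap.congr_fun this a
  refine ⟨LinearMap.snd F _ _ ∘ₗ g, fun y => congrArg Prod.snd (hg₁ y), fun a b => ?_⟩
  simp [hg₂, hbr, hfst]

/-- The derivation of the free Lie algebra that extends a map of the alphabet. -/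
noncomputable def lieDer (s : Y → Y) : FreeLieAlgebra F Y →ₗ[F] FreeLieAlgebra F Y :=
  Classical.choose (exists_lieDer F s)

theorem lieDer_of (s : Y → Y) (y : Y) :
    lieDer F s (FreeLieAlgebra.of F y) = FreeLieAlgebra.of F (s y) :=
  (Classical.choose_spec (exists_lieDer F s)).1 y

theorem lieDer_lie (s : Y → Y) (a b : FreeLieAlgebra F Y) :
    lieDer F s ⁅a, b⁆ = ⁅lieDer F s a, b⁆ + ⁅a, lieDer F s b⁆ :=
  (Classical.choose_spec (exists_lieDer F s)).2 a b

end FreeLieDerivation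

/-! ### The free differential Poisson algebra -/

section PoissonToGelfandDorfman

variable {F : Type v} [Field F] {P : Type w} [AddCommGroup P] [Module F P]
  {mul pbrk : P →ₗ[F] P →ₗ[F] P} {d : P →ₗ[F] P}

/-- The algebra `P^(d)` of a differential Poisson algebra is a Gelfand--Dorfman algebra. -/
theorem IsPoisson.isGelfandDorfman (h : IsPoisson mul pbrk) (hd : IsDerivation mul d)
    (hd' : IsDerivation pbrk d) : IsGelfandDorfman (mul.compl₂ d) pbrk where
  novikov :=
    { left_symm := fun x y z => by
        simp only [LinearMap.compl₂_apply, hd _ _, map_add, h.mul_assoc]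
        rw [← h.mul_assoc x y, ← h.mul_assoc y x, h.mul_comm x y]
        abel
      right_comm := fun x y z => by
        simp only [LinearMap.compl₂_apply, h.mul_assoc]
        rw [h.mul_comm (d y)] }
  lie := h.lie
  compat x y z := by
    simp only [LinearMap.compl₂_apply, hd' _ _, map_add, h.leibniz]
    rw [h.lie.skew y x, h.lie.skew z y, h.lie.skew (d x) z]
    simp only [map_neg, LinearMap.neg_apply]
    abel

theorem IsPoisson.isSpecialGD (h : IsPoisson mul pbrk) (hd : IsDerivation mul d)
    (hd' : IsDerivation pbrk d) : IsSpecialGD (mul.compl₂ d) pbrk :=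
  ⟨h.isGelfandDorfman hd hd', P, inferInstance, inferInstance, mul, pbrk, d, LinearMap.id, h, hd,
    hd', Function.injective_id, fun _ _ => rfl, fun _ _ => rfl⟩

end PoissonToGelfandDorfman

section FreePoisson

open MvPolynomial

variable (F : Type v) [Field F] (X : Type u) [LinearOrder X]

/-- Lyndon--Shirshov words in the letters `x^(n)`. -/
abbrev LSWord : Type u := {w : FreeMagma (DLetter X) // IsLS w}

/-- The free unital differential Poisson algebra on `X`: the symmetric algebra of the free Lie
algebra on the letters `x^(n)`, written in the Lyndon--Shirshov basis. -/
abbrev FreePoisson : Type (max u v) := MvPolynomial (LSWord X) F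

variable {X}

/-- The letter `x^(n+1)`. -/
def DLetter.next (y : DLetter X) : DLetter X := dl (DLetter.gen y) (DLetter.ord y + 1)

/-- The Poisson bracket of the free differential Poisson algebra. -/
noncomputable def pBrk : FreePoisson F X →ₗ[F] FreePoisson F X →ₗ[F] FreePoisson F X :=
  polyBrk (lsBasis F (DLetter X))

/-- The derivation of the free differential Poisson algebra, which maps `x^(n)` to `x^(n+1)`. -/
noncomputable def pDer : Derivation F (FreePoisson F X) (FreePoisson F X) :=
  polyDer (lsBasis F (DLetter X)) (lieDer F DLetter.next)

/-- The value of a nonassociative word in the free differential Poisson algebra. -/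
noncomputable def pLie (w : FreeMagma (DLetter X)) : FreePoisson F X :=
  lieIncl (lsBasis F (DLetter X)) (lieOf F w)

variable {F}

theorem pLie_coe (w : LSWord X) : pLie F w.1 = MvPolynomial.X w := by
  rw [pLie, ← lsBasis_apply, lieIncl_basis]

theorem pLie_mul (a b : FreeMagma (DLetter X)) : pLie F (.mul a b) = pBrk F (pLie F a) (pLie F b) :=
  (polyBrk_lieIncl _ _ _).symm

theorem pBrk_mul_left (f g h : FreePoisson F X) :
    pBrk F (f * g) h = f * pBrk F g h + g * pBrk F f h := polyBrk_mul_left _ f g h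

theorem pBrk_mul_right (f g h : FreePoisson F X) :
    pBrk F f (g * h) = g * pBrk F f h + h * pBrk F f g := polyBrk_mul_right _ f g h

theorem pBrk_one_left (g : FreePoisson F X) : pBrk F 1 g = 0 := by
  rw [← C_1]
  exact polyBrk_C_left _ _ _

theorem pBrk_one_right (g : FreePoisson F X) : pBrk F g 1 = 0 := by
  rw [← C_1]
  exact polyBrk_C_right _ _ _

theorem pDer_pLie_of (y : DLetter X) : pDer F (pLie F (.of y)) = pLie F (.of y.next) := by
  rw [pLie, pDer, polyDer_lieIncl]
  exact congrArg _ (lieDer_of F DLetter.next y)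

theorem pDer_pBrk (f g : FreePoisson F X) :
    pDer F (pBrk F f g) = pBrk F (pDer F f) g + pBrk F f (pDer F g) :=
  polyDer_polyBrk _ (lieDer_lie F _) f g

variable (F) in
/-- The operation `x ∘ y = x · d y` on the free differential Poisson algebra. -/
noncomputable def pCirc : FreePoisson F X →ₗ[F] FreePoisson F X →ₗ[F] FreePoisson F X :=
  (LinearMap.mul F (FreePoisson F X)).compl₂ (pDer F).toLinearMap

theorem isSpecialGD_freePoisson : IsSpecialGD (pCirc F : FreePoisson F X →ₗ[F] _) (pBrk F) := by
  refine IsPoisson.isSpecialGD (isPoisson_polyBrk _) (fun x y => ?_) (fun x y => pDer_pBrk x y)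
  simp [Derivation.leibniz, mul_comm, add_comm]

variable (F) in
/-- The value of a monomial in the free differential Poisson algebra. -/
noncomputable def pEval (m : Magma₂ X) : FreePoisson F X :=
  m.eval (pCirc F) (pBrk F) fun x => pLie F (.of (dl x 0))

theorem pEval_of (x : X) : pEval F (.of x) = pLie F (.of (dl x 0)) := rfl

theorem pEval_circ (a b : Magma₂ X) : pEval F (.circ a b) = pEval F a * pDer F (pEval F b) := rfl

theorem pEval_brk (a b : Magma₂ X) : pEval F (.brk a b) = pBrk F (pEval F a) (pEval F b) := rfl

/-- The universal property of the free differential Poisson algebra. -/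
theorem exists_freePoisson_hom {Q : Type w} [CommRing Q] [Algebra F Q]
    {br : Q →ₗ[F] Q →ₗ[F] Q} {δ : Q →ₗ[F] Q} (alt : ∀ x, br x x = 0)
    (jac : ∀ x y z, br x (br y z) = br (br x y) z + br y (br x z))
    (leib : ∀ x y z, br x (y * z) = br x y * z + y * br x z)
    (hδ : ∀ x y, δ (x * y) = δ x * y + x * δ y) (hδ' : ∀ x y, δ (br x y) = br (δ x) y + br x (δ y))
    (ρ : X → Q) :
    ∃ θ : FreePoisson F X →ₐ[F] Q, (∀ x, θ (pLie F (.of (dl x 0))) = ρ x) ∧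
      (∀ f g, θ (pBrk F f g) = br (θ f) (θ g)) ∧ ∀ f, θ (pDer F f) = δ (θ f) := by
  obtain ⟨g, hg₁, hg₂⟩ := exists_freeLieAlgebra_hom br alt jac
    fun y : DLetter X => (δ ^ DLetter.ord y) (ρ (DLetter.gen y))
  have skew : ∀ x y, br x y = - br y x := by
    intro x y
    have := alt (x + y)
    simp only [map_add, LinearMap.add_apply, alt, zero_add, add_zero] at this
    exact eq_neg_of_add_eq_zero_right this
  have br_one : ∀ x, br x 1 = 0 := by
    intro x
    have := leib x 1 1
    simpa using this
  have δ_one : δ 1 = 0 := by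
    have := hδ 1 1
    simpa using this
  have br_C : ∀ c x, br x (algebraMap F Q c) = 0 := by
    intro c x
    rw [Algebra.algebraMap_eq_smul_one, map_smul, br_one, smul_zero]
  have leib' : ∀ x y z, br (x * y) z = br x z * y + x * br y z := by
    intro x y z
    rw [skew, leib, skew z x, skew z y]
    ring
  set b := lsBasis F (DLetter X)
  let θ : FreePoisson F X →ₐ[F] Q := aeval fun i => g (b i)
  have hθ : ∀ a, θ (lieIncl b a) = g a := by
    intro a
    have : θ.toLinearMap ∘ₗ lieIncl b = g := b.ext fun i => by simp [lieIncl_basis, θ]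
    exact LinearMap.congr_fun this a
  have hgδ : ∀ a, g (lieDer F DLetter.next a) = δ (g a) := by
    intro a
    have : g ∘ₗ lieDer F DLetter.next = δ ∘ₗ g := by
      refine LinearMap.ext_on_range span_range_lieOf fun w => ?_
      induction w with
      | ih1 y =>
        have h₁ := congrArg g (lieDer_of F DLetter.next y)
        rw [hg₁] at h₁
        refine h₁.trans ?_
        change (δ ^ (DLetter.ord y + 1)) (ρ (DLetter.gen y)) = δ (g (FreeLieAlgebra.of F y))
        rw [hg₁, pow_succ']
        rfl
      | ih2 u v ihu ihv =>
        simp only [LinearMap.comp_apply] at ihu ihv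
        change g (lieDer F _ ⁅lieOf F u, lieOf F v⁆) = δ (g ⁅lieOf F u, lieOf F v⁆)
        rw [lieDer_lie, map_add, hg₂, hg₂, hg₂, hδ', ihu, ihv]
    exact LinearMap.congr_fun this a
  refine ⟨θ, fun x => ?_, fun f h => ?_, fun f => ?_⟩
  · rw [pLie, hθ]
    exact hg₁ (dl x 0)
  · induction f using mvPolynomial_induction with
    | hC c =>
      rw [skew, ← algebraMap_eq, AlgHom.commutes, br_C, neg_zero]
      rw [algebraMap_eq, pBrk, polyBrk_C_left, map_zero]
    | hadd f f' h₁ h₂ => simp only [map_add, LinearMap.add_apply, h₁, h₂]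
    | hmul f f' h₁ h₂ => simp only [pBrk_mul_left, map_add, map_mul, h₁, h₂, leib']; ring
    | hX i =>
      induction h using mvPolynomial_induction with
      | hC c =>
        rw [← algebraMap_eq, AlgHom.commutes, br_C]
        rw [algebraMap_eq, pBrk, polyBrk_C_right, map_zero]
      | hadd f f' h₁ h₂ => simp only [map_add, h₁, h₂]
      | hmul f f' h₁ h₂ => simp only [pBrk_mul_right, map_add, map_mul, h₁, h₂, leib]; ring
      | hX j =>
        rw [← lieIncl_basis b, ← lieIncl_basis b, pBrk, polyBrk_lieIncl, hθ, hθ, hθ, hg₂]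
  · induction f using mvPolynomial_induction with
    | hC c =>
      rw [← algebraMap_eq, AlgHom.commutes, Derivation.map_algebraMap, map_zero,
        Algebra.algebraMap_eq_smul_one, map_smul, δ_one, smul_zero]
    | hadd f f' h₁ h₂ => simp only [map_add, h₁, h₂]
    | hmul f f' h₁ h₂ =>
      simp only [Derivation.leibniz, smul_eq_mul, map_add, map_mul, h₁, h₂, hδ]; ring
    | hX i => rw [← lieIncl_basis b, pDer, polyDer_lieIncl, hθ, hθ, hgδ]

/-- Adjoining a unit to a differential Poisson algebra. -/
theorem exists_unital_poisson [CharZero F] {P : Type w} [AddCommGroup P] [Module F P]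
    {mul pbrk : P →ₗ[F] P →ₗ[F] P} {d : P →ₗ[F] P} (h : IsPoisson mul pbrk)
    (hd : IsDerivation mul d) (hd' : IsDerivation pbrk d) :
    ∃ (Q : Type (max v w)) (_ : CommRing Q) (_ : Algebra F Q) (br : Q →ₗ[F] Q →ₗ[F] Q)
      (δ : Q →ₗ[F] Q) (κ : P →ₗ[F] Q), Function.Injective κ ∧
      (∀ x y, κ (mul x y) = κ x * κ y) ∧ (∀ x y, κ (pbrk x y) = br (κ x) (κ y)) ∧
      (∀ x, κ (d x) = δ (κ x)) ∧ (∀ x, br x x = 0) ∧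
      (∀ x y z, br x (br y z) = br (br x y) z + br y (br x z)) ∧
      (∀ x y z, br x (y * z) = br x y * z + y * br x z) ∧
      (∀ x y, δ (x * y) = δ x * y + x * δ y) ∧
      ∀ x y, δ (br x y) = br (δ x) y + br x (δ y) := by
  let _ : NonUnitalCommRing P :=
    { (inferInstance : AddCommGroup P) with
      mul := fun x y => mul x y
      left_distrib := fun x y z => map_add (mul x) y z
      right_distrib := fun x y z => LinearMap.congr_fun (map_add mul x y) z
      zero_mul := fun x => LinearMap.congr_fun (map_zero mul) x
      mul_zero := fun x => map_zero (mul x)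
      mul_assoc := h.mul_assoc
      mul_comm := h.mul_comm }
  have hmul : ∀ x y : P, x * y = mul x y := fun _ _ => rfl
  have _ : IsScalarTower F P P := ⟨fun c x y => by simp [hmul]⟩
  have _ : SMulCommClass F P P := ⟨fun c x y => by simp [hmul]⟩
  have alt : ∀ x, pbrk x x = 0 := by
    intro x
    have h2 : (2 : F) • pbrk x x = 0 := by
      rw [two_smul]
      exact eq_neg_iff_add_eq_zero.1 (h.lie.skew x x)
    exact (smul_eq_zero.1 h2).resolve_left two_ne_zero
  let inr : P →ₗ[F] Unitization F P := Unitization.inrHom F F P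
  let snd : Unitization F P →ₗ[F] P := Unitization.sndHom F F P
  refine ⟨Unitization F P, inferInstance, inferInstance, (pbrk.compl₁₂ snd snd).compr₂ inr,
    inr ∘ₗ d ∘ₗ snd, inr, ?_, ?_, ?_, ?_, ?_, ?_, ?_, ?_, ?_⟩
  · exact Unitization.inr_injective
  · intro x y
    exact Unitization.inr_mul F x y
  · intro x y; rfl
  · intro x; rfl
  · intro x
    simp [alt]
  · intro x y z
    change inr (pbrk x.snd (pbrk y.snd z.snd)) =
      inr (pbrk (pbrk x.snd y.snd) z.snd) + inr (pbrk y.snd (pbrk x.snd z.snd))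
    rw [← map_add]
    refine congrArg inr ?_
    have := h.lie.jacobi x.snd y.snd z.snd
    rw [h.lie.skew (pbrk y.snd z.snd), h.lie.skew (pbrk z.snd x.snd), h.lie.skew z.snd x.snd,
      map_neg, neg_neg] at this
    rw [← sub_eq_zero, ← neg_eq_zero, ← this]
    abel
  · intro x y z
    ext
    · simp [inr, snd]
    · simp [inr, snd, hmul, h.leibniz]
      abel
  · intro x y
    ext
    · simp [inr, snd]
    · simp [inr, snd, hmul, hd _ _]
      abel
  · intro x y
    change inr (d (pbrk x.snd y.snd)) = inr (pbrk (d x.snd) y.snd) + inr (pbrk x.snd (d y.snd))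
    rw [← map_add, hd']

theorem mem_specialIdentities [CharZero F] {f : Magma₂ X →₀ F}
    (hf : Finsupp.linearCombination F (pEval F) f = 0) : f ∈ specialIdentities F X := by
  rintro G _ _ circ brk ⟨-, P, _, _, mul, pbrk, d, j, hP, hd, hd', hj, hj₁, hj₂⟩ ρ
  obtain ⟨Q, _, _, br, δ, κ, hκ, hκ₁, hκ₂, hκ₃, h₁, h₂, h₃, h₄, h₅⟩ :=
    exists_unital_poisson hP hd hd'
  obtain ⟨θ, hθ₁, hθ₂, hθ₃⟩ := exists_freePoisson_hom h₁ h₂ h₃ h₄ h₅ fun x => κ (j (ρ x))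
  have heval : ∀ m : Magma₂ X, θ (pEval F m) = κ (j (m.eval circ brk ρ)) := by
    intro m
    induction m with
    | of x => exact hθ₁ x
    | circ a b iha ihb =>
      rw [pEval_circ, map_mul, hθ₃, iha, ihb, Magma₂.eval, hj₁, hκ₁, hκ₃]
    | brk a b iha ihb => rw [pEval_brk, hθ₂, iha, ihb, Magma₂.eval, hj₂, hκ₂]
  refine hj (hκ ?_)
  have : θ.toLinearMap ∘ₗ Finsupp.linearCombination F (pEval F) =
      κ ∘ₗ j ∘ₗ Finsupp.linearCombination F (Magma₂.eval circ brk ρ) :=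
    Finsupp.lhom_ext fun m c => by simp [heval]
  have := LinearMap.congr_fun this f
  simp only [LinearMap.comp_apply, hf, map_zero] at this ⊢
  exact this.symm

variable (F X) in
/-- The homomorphism from the free special Gelfand--Dorfman algebra to the free differential
Poisson algebra that fixes the generators. -/
noncomputable def toFreePoisson : FreeSGD F X →ₗ[F] FreePoisson F X :=
  FreeSGD.lift isSpecialGD_freePoisson fun x => pLie F (.of (dl x 0))

theorem toFreePoisson_mon (m : Magma₂ X) : toFreePoisson F X (FreeSGD.mon F X m) = pEval F m :=
  FreeSGD.lift_mon _ _ _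

/-- Since every special algebra lies in a differential Poisson algebra, the free special algebra
lies in the free one. -/
theorem toFreePoisson_injective [CharZero F] : Function.Injective (toFreePoisson F X) := by
  rw [injective_iff_map_eq_zero]
  intro a ha
  obtain ⟨f, rfl⟩ := (specialIdentities F X).mkQ_surjective a
  rw [Submodule.mkQ_apply, Submodule.Quotient.mk_eq_zero]
  exact mem_specialIdentities ha

end FreePoisson

/-! ### Leading terms of the operations -/

section Order

variable {Y : Type u} [LinearOrder Y]

/-- The linear order on Lyndon--Shirshov words: first by degree, then by the associative words. -/
noncomputable instance instLinearOrderIsLS : LinearOrder {w : FreeMagma Y // IsLS w} where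
  le u v := lieLE u.1 v.1
  le_refl u := Or.inr ⟨rfl, wordLT_irrefl _⟩
  le_trans u v w h h' := by
    rcases h with h | ⟨h, h₁⟩ <;> rcases h' with h' | ⟨h', h₂⟩
    · exact Or.inl (h.trans h')
    · exact Or.inl (h.trans_eq h')
    · exact Or.inl (h.trans_lt h')
    · refine Or.inr ⟨h.trans h', fun hcon => h₂ ?_⟩
      exact wordLT_of_lt_of_le hcon h₁
  le_antisymm u v h h' := by
    rcases h with h | ⟨h, h₁⟩ <;> rcases h' with h' | ⟨h', h₂⟩
    · omega
    · omega
    · omega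
    · exact Subtype.ext (u.2.eq_of_word_eq v.2 ((not_wordLT_iff.1 h₂).resolve_right h₁))
  le_total u v := by
    rcases lt_trichotomy u.1.length v.1.length with h | h | h
    · exact Or.inl (Or.inl h)
    · by_cases h' : wordLT (word v.1) (word u.1)
      · exact Or.inr (Or.inr ⟨h.symm, wordLT_asymm h'⟩)
      · exact Or.inl (Or.inr ⟨h, h'⟩)
    · exact Or.inr (Or.inl h)
  toDecidableLE := Classical.decRel _

theorem lsWord_le_iff {u v : {w : FreeMagma Y // IsLS w}} : u ≤ v ↔ lieLE u.1 v.1 := Iff.rfl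

theorem lsWord_lt_of_length_lt {u v : {w : FreeMagma Y // IsLS w}}
    (h : u.1.length < v.1.length) : u < v := by
  rw [← not_le, lsWord_le_iff]
  rintro (h' | ⟨h', -⟩) <;> omega

theorem lsWord_lt_of_wordLT {u v : {w : FreeMagma Y // IsLS w}} (h : u.1.length = v.1.length)
    (h' : wordLT (word u.1) (word v.1)) : u < v := by
  rw [← not_le, lsWord_le_iff]
  rintro (h'' | ⟨-, h''⟩)
  · omega
  · exact h'' h'

end Order

section LeadingTerm

open MvPolynomial

variable {F : Type v} [Field F] {X : Type u}

theorem derivs_eq_sum_content (w : FreeMagma (DLetter X)) :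
    derivs w = ((content w).map DLetter.ord).sum := by
  induction w with
  | ih1 y => erw [content_of]; simp [derivs]
  | ih2 a b iha ihb =>
    erw [content_mul, Multiset.map_add, Multiset.sum_add, ← iha, ← ihb]
    rfl

theorem sum_ord_leaf (w : FreeMagma (DLetter X)) :
    ∑ i, DLetter.ord (leaf w i) = derivs w := by
  rw [derivs_eq_sum_content, content, Multiset.map_coe, Multiset.sum_coe, word, List.map_ofFn,
    List.sum_ofFn]
  rfl

theorem dl_gen_ord (y : DLetter X) : dl (DLetter.gen y) (DLetter.ord y) = y := rfl

theorem leaf_mul_castAdd (a b : FreeMagma (DLetter X)) (i : Fin a.length) :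
    leaf (.mul a b) (Fin.castAdd b.length i) = leaf a i :=
  Fin.addCases_left (motive := fun _ => DLetter X) i

theorem leaf_mul_natAdd (a b : FreeMagma (DLetter X)) (i : Fin b.length) :
    leaf (.mul a b) (Fin.natAdd a.length i) = leaf b i :=
  Fin.addCases_right (motive := fun _ => DLetter X) i

theorem length_mul_eq (a b : FreeMagma (DLetter X)) :
    (FreeMagma.mul a b).length = a.length + b.length := rfl

variable [LinearOrder X]

variable (F) in
/-- The ideal of the free Poisson algebra generated by a set of nonassociative words. -/
noncomputable def treeIdeal (S : Set (FreeMagma (DLetter X))) : Ideal (FreePoisson F X) :=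
  Ideal.span (pLie F '' S)

theorem pLie_mem_treeIdeal {S : Set (FreeMagma (DLetter X))} {u : FreeMagma (DLetter X)}
    (h : u ∈ S) : pLie F u ∈ treeIdeal F S := Ideal.subset_span ⟨u, h, rfl⟩

theorem treeIdeal_mono {S T : Set (FreeMagma (DLetter X))} (h : S ⊆ T) :
    treeIdeal F S ≤ treeIdeal F T := Ideal.span_mono (Set.image_mono h)

theorem pBrk_skew (f g : FreePoisson F X) : pBrk F f g = - pBrk F g f := polyBrk_skew _ f g

theorem pBrk_mem_treeIdeal_left {S R : Set (FreeMagma (DLetter X))} (hSR : S ⊆ R)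
    {g : FreePoisson F X} (h : ∀ u ∈ S, pBrk F (pLie F u) g ∈ treeIdeal F R)
    {f : FreePoisson F X} (hf : f ∈ treeIdeal F S) : pBrk F f g ∈ treeIdeal F R := by
  induction hf using Submodule.span_induction with
  | mem x hx =>
    obtain ⟨u, hu, rfl⟩ := hx
    exact h u hu
  | zero => simp
  | add x y _ _ h₁ h₂ => rw [map_add, LinearMap.add_apply]; exact Ideal.add_mem _ h₁ h₂
  | smul r x hx h =>
    rw [smul_eq_mul, pBrk_mul_left]
    exact Ideal.add_mem _ (Ideal.mul_mem_left _ _ h)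
      (Ideal.mul_mem_right _ _ (treeIdeal_mono hSR hx))

theorem pBrk_mem_treeIdeal_right {S R : Set (FreeMagma (DLetter X))} (hSR : S ⊆ R)
    {f : FreePoisson F X} (h : ∀ u ∈ S, pBrk F f (pLie F u) ∈ treeIdeal F R)
    {g : FreePoisson F X} (hg : g ∈ treeIdeal F S) : pBrk F f g ∈ treeIdeal F R := by
  rw [pBrk_skew, Ideal.neg_mem_iff]
  refine pBrk_mem_treeIdeal_left hSR (fun u hu => ?_) hg
  rw [pBrk_skew, Ideal.neg_mem_iff]
  exact h u hu

theorem pBrk_mem_treeIdeal {S T R : Set (FreeMagma (DLetter X))} (hSR : S ⊆ R) (hTR : T ⊆ R)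
    (h : ∀ u ∈ S, ∀ v ∈ T, FreeMagma.mul u v ∈ R) {f g : FreePoisson F X}
    (hf : f ∈ treeIdeal F S) (hg : g ∈ treeIdeal F T) : pBrk F f g ∈ treeIdeal F R :=
  pBrk_mem_treeIdeal_left hSR (fun u hu => pBrk_mem_treeIdeal_right hTR (fun v hv => by
    rw [← pLie_mul]
    exact pLie_mem_treeIdeal (h u hu v hv)) hg) hf

/-- The leading term of `c_p ∘ (c_{p-1} ∘ ... ∘ (c_1 ∘ x))` is `c_1 ... c_p x^(p)`: in all other
terms fewer derivations fall on `x`, but at least one does. -/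
theorem pEval_phi (c : List (Magma₂ X)) (x : X) :
    pEval F (phi c x) - (c.map (pEval F)).prod * pLie F (.of (dl x c.length)) ∈
      treeIdeal F {u | ∃ s, 1 ≤ s ∧ s < c.length ∧ u = .of (dl x s)} := by
  induction c using List.reverseRecOn with
  | nil => simp [phi, pEval_of]
  | append_singleton c a ih =>
    set I := treeIdeal F {u | ∃ s, 1 ≤ s ∧ s < (c ++ [a]).length ∧ u = .of (dl x s)} with hI
    have hder : ∀ j ∈ treeIdeal F {u | ∃ s, 1 ≤ s ∧ s < c.length ∧ u = .of (dl x s)},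
        pDer F j ∈ I := by
      intro j hj
      have hle : treeIdeal F {u | ∃ s, 1 ≤ s ∧ s < c.length ∧ u = .of (dl x s)} ≤ I :=
        treeIdeal_mono fun u ⟨s, h₁, h₂, h₃⟩ => ⟨s, h₁, by simp; omega, h₃⟩
      induction hj using Submodule.span_induction with
      | mem y hy =>
        obtain ⟨_, ⟨s, hs₁, hs₂, rfl⟩, rfl⟩ := hy
        rw [pDer_pLie_of]
        exact pLie_mem_treeIdeal ⟨s + 1, by omega, by simp; omega, rfl⟩
      | zero => simp
      | add y z _ _ h₁ h₂ => rw [map_add]; exact Ideal.add_mem _ h₁ h₂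
      | smul r y hy h =>
        rw [smul_eq_mul, Derivation.leibniz]
        exact Ideal.add_mem _ (Ideal.mul_mem_left _ _ h) (Ideal.mul_mem_right _ _ (hle hy))
    have hphi : phi (c ++ [a]) x = .circ a (phi c x) := by simp [phi]
    have hlow : pLie F (.of (dl x c.length)) * pDer F (c.map (pEval F)).prod ∈ I := by
      rcases Nat.eq_zero_or_pos c.length with h | h
      · rw [List.length_eq_zero_iff.1 h]
        simp
      · exact Ideal.mul_mem_right _ _ (pLie_mem_treeIdeal ⟨c.length, h, by simp, rfl⟩)
    have hnext : pLie F (.of (dl x (c ++ [a]).length)) = pDer F (pLie F (.of (dl x c.length))) := by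
      rw [pDer_pLie_of, List.length_append]
      rfl
    rw [hphi, pEval_circ, hnext]
    have hsplit : pEval F a * pDer F (pEval F (phi c x)) -
          ((c ++ [a]).map (pEval F)).prod * pDer F (pLie F (.of (dl x c.length))) =
        pEval F a * (pDer F (pEval F (phi c x) -
          (c.map (pEval F)).prod * pLie F (.of (dl x c.length))) +
          pLie F (.of (dl x c.length)) * pDer F (c.map (pEval F)).prod) := by
      rw [map_sub, Derivation.leibniz]
      simp
      ring
    rw [hsplit]
    exact Ideal.mul_mem_left _ _ (Ideal.add_mem _ (hder _ ih) hlow)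

/-- Words with derivations that are shorter than `w`, or are obtained from `w` by lowering some
of its letters. -/
def lowerTrees (w : FreeMagma (DLetter X)) : Set (FreeMagma (DLetter X)) :=
  {u | 1 ≤ derivs u ∧ (u.length < w.length ∨ (LetterwiseLE u w ∧ u ≠ w))}

theorem length_le_of_mem_lowerTrees {u w : FreeMagma (DLetter X)} (h : u ∈ lowerTrees w) :
    u.length ≤ w.length :=
  h.2.elim le_of_lt fun h => h.1.length_eq.le

theorem left_mem_lowerTrees {u a : FreeMagma (DLetter X)} (b : FreeMagma (DLetter X))
    (hu : 1 ≤ derivs u) (h : u.length ≤ a.length) : u ∈ lowerTrees (.mul a b) :=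
  ⟨hu, Or.inl (by have := b.length_pos; rw [length_mul_eq]; omega)⟩

theorem right_mem_lowerTrees {u b : FreeMagma (DLetter X)} (a : FreeMagma (DLetter X))
    (hu : 1 ≤ derivs u) (h : u.length ≤ b.length) : u ∈ lowerTrees (.mul a b) :=
  ⟨hu, Or.inl (by have := a.length_pos; rw [length_mul_eq]; omega)⟩

theorem mul_mem_lowerTrees_left {u v a b : FreeMagma (DLetter X)} (hu : u ∈ lowerTrees a)
    (hv : v ∈ lowerTrees b ∨ v = b) : FreeMagma.mul u v ∈ lowerTrees (.mul a b) := by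
  refine ⟨le_add_right hu.1, ?_⟩
  rw [length_mul_eq, length_mul_eq]
  have hul := length_le_of_mem_lowerTrees hu
  rcases hu.2 with h | ⟨h, hne⟩
  · left
    rcases hv with hv | rfl
    · have := length_le_of_mem_lowerTrees hv; omega
    · omega
  · have hne' : ∀ v', FreeMagma.mul u v' ≠ .mul a b := by
      rintro v' ⟨rfl, rfl⟩
      exact hne rfl
    rcases hv with hv | rfl
    · rcases hv.2 with h' | ⟨h', -⟩
      · left; omega
      · exact Or.inr ⟨⟨h, h'⟩, hne' _⟩
    · exact Or.inr ⟨⟨h, LetterwiseLE.refl _⟩, hne' _⟩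

theorem mul_mem_lowerTrees_right {u v a b : FreeMagma (DLetter X)} (hu : u = a)
    (hv : v ∈ lowerTrees b) : FreeMagma.mul u v ∈ lowerTrees (.mul a b) := by
  subst hu
  refine ⟨le_add_left hv.1, ?_⟩
  rw [length_mul_eq, length_mul_eq]
  rcases hv.2 with h | ⟨h, hne⟩
  · left; omega
  · refine Or.inr ⟨⟨LetterwiseLE.refl _, h⟩, ?_⟩
    rintro ⟨-, rfl⟩
    exact hne rfl

theorem letters_subset_lowerTrees (y : DLetter X) :
    {u | ∃ s, 1 ≤ s ∧ s < DLetter.ord y ∧ u = .of (dl (DLetter.gen y) s)} ⊆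
      lowerTrees (.of y) := by
  rintro _ ⟨t, ht₁, ht₂, rfl⟩
  have hlt : dl (DLetter.gen y) t < y := by
    rw [← dl_gen_ord y]
    exact Prod.Lex.toLex_lt_toLex.2 (Or.inl ht₂)
  exact ⟨ht₁, Or.inr ⟨hlt.le, fun h => hlt.ne (by injection h)⟩⟩

/-- Substituting `C_i y_i + (terms with lower letters)` for the letters `y_i` of a word `w`, where
letters without derivations are kept, gives `C_1 C_2 ... w` up to terms with lower words: the
remaining terms of the Leibniz rule split the word `w` into shorter ones, at least one of which
contains a derivation. -/
theorem pEval_toBrk_relabel (w : FreeMagma (DLetter X)) (V : Fin w.length → Magma₂ X)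
    (C : Fin w.length → FreePoisson F X)
    (h₀ : ∀ i, DLetter.ord (leaf w i) = 0 → pEval F (V i) = pLie F (.of (leaf w i)) ∧ C i = 1)
    (h₁ : ∀ i, 1 ≤ DLetter.ord (leaf w i) → pEval F (V i) - C i * pLie F (.of (leaf w i)) ∈
      treeIdeal F (lowerTrees (.of (leaf w i)))) :
    (derivs w = 0 → pEval F (toBrk (relabel w V)) = pLie F w ∧ ∏ i, C i = 1) ∧
      (1 ≤ derivs w → pEval F (toBrk (relabel w V)) - (∏ i, C i) * pLie F w ∈
        treeIdeal F (lowerTrees w)) := by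
  induction w with
  | ih1 y =>
    have hprod : ∏ i, C i = C (0 : Fin 1) := Fin.prod_univ_one C
    rw [hprod]
    exact ⟨fun h => h₀ (0 : Fin 1) h, fun h => h₁ (0 : Fin 1) h⟩
  | ih2 a b iha ihb =>
    obtain ⟨ha₀, ha₁⟩ := iha (fun i => V (Fin.castAdd b.length i))
      (fun i => C (Fin.castAdd b.length i))
      (fun i hi => by
        rw [← leaf_mul_castAdd a b] at hi ⊢; exact h₀ _ hi)
      (fun i hi => by
        rw [← leaf_mul_castAdd a b] at hi ⊢; exact h₁ _ hi)
    obtain ⟨hb₀, hb₁⟩ := ihb (fun i => V (Fin.natAdd a.length i))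
      (fun i => C (Fin.natAdd a.length i))
      (fun i hi => by
        rw [← leaf_mul_natAdd a b] at hi ⊢; exact h₀ _ hi)
      (fun i hi => by
        rw [← leaf_mul_natAdd a b] at hi ⊢; exact h₁ _ hi)
    have hprod : ∏ i, C i = (∏ i, C (Fin.castAdd b.length i)) * ∏ i, C (Fin.natAdd a.length i) :=
      Fin.prod_univ_add (M := FreePoisson F X) (a := a.length) (b := b.length) C
    have hV : pEval F (toBrk (relabel (a * b) V)) =
        pBrk F (pEval F (toBrk (relabel a fun i => V (Fin.castAdd b.length i))))
          (pEval F (toBrk (relabel b fun i => V (Fin.natAdd a.length i)))) := rfl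
    have hE : pLie F (a * b) = pBrk F (pLie F a) (pLie F b) := pLie_mul a b
    have hd : derivs (a * b) = derivs a + derivs b := rfl
    rw [hprod, hV, hE, hd]
    clear hprod hV hE hd iha ihb h₀ h₁
    generalize pEval F (toBrk (relabel a fun i => V (Fin.castAdd b.length i))) = f at *
    generalize pEval F (toBrk (relabel b fun i => V (Fin.natAdd a.length i))) = g at *
    generalize ∏ i, C (Fin.castAdd b.length i) = p at *
    generalize ∏ i, C (Fin.natAdd a.length i) = q at *
    have hlowa : lowerTrees a ⊆ lowerTrees (.mul a b) := fun u hu =>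
      left_mem_lowerTrees b hu.1 (length_le_of_mem_lowerTrees hu)
    have hlowb : lowerTrees b ⊆ lowerTrees (.mul a b) := fun u hu =>
      right_mem_lowerTrees a hu.1 (length_le_of_mem_lowerTrees hu)
    constructor
    · intro h
      obtain ⟨rfl, rfl⟩ := ha₀ (by omega)
      obtain ⟨rfl, rfl⟩ := hb₀ (by omega)
      exact ⟨rfl, one_mul 1⟩
    intro h
    change _ ∈ treeIdeal F (lowerTrees (.mul a b))
    rcases Nat.eq_zero_or_pos (derivs a) with hda | hda
    · obtain ⟨rfl, rfl⟩ := ha₀ hda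
      have hdb : 1 ≤ derivs b := by omega
      have hj := hb₁ hdb
      have hsplit : pBrk F (pLie F a) g - 1 * q * pBrk F (pLie F a) (pLie F b) =
          pLie F b * pBrk F (pLie F a) q + pBrk F (pLie F a) (g - q * pLie F b) := by
        rw [map_sub, pBrk_mul_right]; ring
      rw [hsplit]
      refine Ideal.add_mem _ (Ideal.mul_mem_right _ _
        (pLie_mem_treeIdeal (right_mem_lowerTrees a hdb le_rfl))) ?_
      refine pBrk_mem_treeIdeal_right hlowb (fun u hu => ?_) hj
      rw [← pLie_mul]
      exact pLie_mem_treeIdeal (mul_mem_lowerTrees_right rfl hu)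
    have hi := ha₁ hda
    have hEa := pLie_mem_treeIdeal (F := F) (left_mem_lowerTrees b hda (le_refl a.length))
    rcases Nat.eq_zero_or_pos (derivs b) with hdb | hdb
    · obtain ⟨rfl, rfl⟩ := hb₀ hdb
      have hsplit : pBrk F f (pLie F b) - p * 1 * pBrk F (pLie F a) (pLie F b) =
          pLie F a * pBrk F p (pLie F b) + pBrk F (f - p * pLie F a) (pLie F b) := by
        rw [map_sub, LinearMap.sub_apply, pBrk_mul_left]; ring
      rw [hsplit]
      refine Ideal.add_mem _ (Ideal.mul_mem_right _ _ hEa) ?_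
      refine pBrk_mem_treeIdeal_left hlowa (fun u hu => ?_) hi
      rw [← pLie_mul]
      exact pLie_mem_treeIdeal (mul_mem_lowerTrees_left hu (Or.inr rfl))
    have hj := hb₁ hdb
    have hEb := pLie_mem_treeIdeal (F := F) (right_mem_lowerTrees a hdb (le_refl b.length))
    have hsplit : pBrk F f g - p * q * pBrk F (pLie F a) (pLie F b) =
        pLie F a * pBrk F p (q * pLie F b) + pLie F b * (p * pBrk F (pLie F a) q) +
        pBrk F (p * pLie F a) (g - q * pLie F b) + pBrk F (f - p * pLie F a) (q * pLie F b) +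
        pBrk F (f - p * pLie F a) (g - q * pLie F b) := by
      simp only [map_sub, LinearMap.sub_apply, pBrk_mul_left, pBrk_mul_right]; ring
    have hpa : p * pLie F a ∈ treeIdeal F {a} := Ideal.mul_mem_left _ _ (pLie_mem_treeIdeal rfl)
    have hqb : q * pLie F b ∈ treeIdeal F {b} := Ideal.mul_mem_left _ _ (pLie_mem_treeIdeal rfl)
    have ha : ({a} : Set _) ⊆ lowerTrees (.mul a b) :=
      Set.singleton_subset_iff.2 (left_mem_lowerTrees b hda le_rfl)
    have hb : ({b} : Set _) ⊆ lowerTrees (.mul a b) :=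
      Set.singleton_subset_iff.2 (right_mem_lowerTrees a hdb le_rfl)
    rw [hsplit]
    refine Ideal.add_mem _ (Ideal.add_mem _ (Ideal.add_mem _ (Ideal.add_mem _
      (Ideal.mul_mem_right _ _ hEa) (Ideal.mul_mem_right _ _ hEb)) ?_) ?_) ?_
    · exact pBrk_mem_treeIdeal ha hlowb (fun u hu v hv => mul_mem_lowerTrees_right hu hv) hpa hj
    · exact pBrk_mem_treeIdeal hlowa hb (fun u hu v hv => mul_mem_lowerTrees_left hu (Or.inr hv))
        hi hqb
    · exact pBrk_mem_treeIdeal hlowa hlowb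
        (fun u hu v hv => mul_mem_lowerTrees_left hu (Or.inl hv)) hi hj

/-- Cutting consecutive pieces of lengths `p 0, p 1, ...` off the end of a list. -/
theorem prod_slices {α : Type*} {M : Type*} [CommMonoid M] (g : α → M) (c : List α) {n : ℕ}
    (p : Fin n → ℕ) :
    (∏ m, (((c.take (c.length - ∑ i ∈ Finset.univ.filter (· < m), p i)).drop
      (c.length - ∑ i ∈ Finset.univ.filter (· < m), p i - p m)).map g).prod) *
      ((c.take (c.length - ∑ i, p i)).map g).prod = (c.map g).prod := by
  induction n with
  | zero => simp
  | succ n ih =>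
    have hlast : ∑ i ∈ Finset.univ.filter (· < Fin.last n), p i = ∑ i : Fin n, p i.castSucc := by
      rw [Finset.sum_filter, Fin.sum_univ_castSucc]
      simp [Fin.castSucc_lt_last]
    have hcast : ∀ m : Fin n, ∑ i ∈ Finset.univ.filter (· < m.castSucc), p i =
        ∑ i ∈ Finset.univ.filter (· < m), p i.castSucc := by
      intro m
      rw [Finset.sum_filter, Fin.sum_univ_castSucc, Finset.sum_filter]
      simp [(Fin.castSucc_lt_last m).not_gt]
    rw [Fin.prod_univ_castSucc, hlast, Fin.sum_univ_castSucc]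
    simp only [hcast]
    rw [← ih fun i => p i.castSucc, mul_assoc]
    congr 1
    rw [mul_comm, ← List.prod_append, ← List.map_append, ← Nat.sub_sub]
    congr 2
    have : (c.take (c.length - ∑ i : Fin n, p i.castSucc - p (Fin.last n))) =
        (c.take (c.length - ∑ i : Fin n, p i.castSucc)).take
          (c.length - ∑ i : Fin n, p i.castSucc - p (Fin.last n)) := by
      rw [List.take_take, min_eq_left (Nat.sub_le _ _)]
    rw [this, List.take_append_drop]

/-- The leading term of `ψ(c_1 ... c_k w)` is `c_1 ... c_k w`, for each order of the letters. -/
theorem pEval_psiLie {w : FreeMagma (DLetter X)} (hw : 1 ≤ derivs w) (c : List (Magma₂ X))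
    (hc : c.length = derivs w) (π : Equiv.Perm (Fin w.length)) :
    pEval F (psiLie c w π) - (c.map (pEval F)).prod * pLie F w ∈
      treeIdeal F (lowerTrees w) := by
  set p : Fin w.length → ℕ := fun i => DLetter.ord (leaf w (π i)) with hp
  set s : Fin w.length → ℕ := fun m => ∑ i ∈ Finset.univ.filter (· < m), p i with hs
  set sl : Fin w.length → List (Magma₂ X) := fun m =>
    (c.take (c.length - s m)).drop (c.length - s m - p m) with hsl
  have hsum : ∑ i, p i = c.length := by
    rw [hc, ← sum_ord_leaf w]
    exact Equiv.sum_comp π fun i => DLetter.ord (leaf w i)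
  have hslen : ∀ m, (sl m).length = p m := by
    intro m
    have : s m + p m ≤ c.length := by
      rw [← hsum, hs]
      have hnot : m ∉ Finset.univ.filter (· < m) := by simp
      rw [add_comm, ← Finset.sum_insert hnot]
      exact Finset.sum_le_sum_of_subset (Finset.subset_univ _)
    simp only [hsl, List.length_drop, List.length_take]
    omega
  have hprod : ∏ i, ((sl (π.symm i)).map (pEval F)).prod = (c.map (pEval F)).prod := by
    rw [Equiv.prod_comp π.symm fun m => ((sl m).map (pEval F)).prod,
      ← prod_slices (pEval F) c p, hsum]
    simp [hsl, hs]
  have hV : ∀ m, vLetter c w π m = phi (sl m) (DLetter.gen (leaf w (π m))) := fun _ => rfl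
  have hpi : ∀ i, p (π.symm i) = DLetter.ord (leaf w i) := fun i => by simp [hp]
  have key := (pEval_toBrk_relabel (F := F) w (fun i => vLetter c w π (π.symm i))
    (fun i => ((sl (π.symm i)).map (pEval F)).prod) ?_ ?_).2 hw
  · rw [hprod] at key
    exact key
  · intro i hi
    have : sl (π.symm i) = [] := by
      rw [← List.length_eq_zero_iff, hslen, hpi, hi]
    rw [hV, this, Equiv.apply_symm_apply]
    refine ⟨?_, by simp⟩
    rw [← dl_gen_ord (leaf w i), hi]
    rfl
  · intro i hi
    rw [hV, Equiv.apply_symm_apply]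
    have h := pEval_phi (F := F) (sl (π.symm i)) (DLetter.gen (leaf w i))
    rw [hslen, hpi, dl_gen_ord] at h
    refine treeIdeal_mono ?_ h
    exact letters_subset_lowerTrees _

variable (F) in
/-- The ideal generated by the Lyndon--Shirshov words with derivations that are less than `w`. -/
noncomputable def lowerIdeal (w : LSWord X) : Ideal (FreePoisson F X) :=
  Ideal.span (MvPolynomial.X '' {u : LSWord X | 1 ≤ derivs u.1 ∧ u < w})

theorem lieIncl_mem_of_mem_lsSpan {M : Multiset (DLetter X)} {p : List (DLetter X) → Prop}
    {I : Ideal (FreePoisson F X)}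
    (h : ∀ u : LSWord X, content u.1 = M → p (word u.1) → MvPolynomial.X u ∈ I)
    {a : FreeLieAlgebra F (DLetter X)} (ha : a ∈ lsSpan F M p) :
    lieIncl (lsBasis F (DLetter X)) a ∈ I := by
  induction ha using Submodule.span_induction with
  | mem x hx =>
    obtain ⟨u, ⟨h₁, h₂, h₃⟩, rfl⟩ := hx
    have := h ⟨u, h₁⟩ h₂ h₃
    rwa [← pLie_coe] at this
  | zero => simp
  | add x y _ _ h₁ h₂ => rw [map_add]; exact I.add_mem h₁ h₂
  | smul c x _ h =>
    rw [map_smul, Algebra.smul_def]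
    exact I.mul_mem_left _ h

theorem treeIdeal_lowerTrees_le (w : LSWord X) : treeIdeal F (lowerTrees w.1) ≤ lowerIdeal F w := by
  refine Ideal.span_le.2 ?_
  rintro _ ⟨u, ⟨hu, hlt⟩, rfl⟩
  have hder : ∀ v : LSWord X, content v.1 = content u → 1 ≤ derivs v.1 := by
    intro v hv
    rwa [derivs_eq_sum_content, hv, ← derivs_eq_sum_content]
  have hlen : ∀ v : LSWord X, content v.1 = content u → v.1.length = u.length := by
    intro v hv
    rw [← card_content, hv, card_content]
  rcases hlt with hlt | ⟨hle, hne⟩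
  · refine lieIncl_mem_of_mem_lsSpan (fun v hv _ => ?_) (lieOf_mem_lsSpan_content u)
    exact Ideal.subset_span ⟨v, ⟨hder v hv, lsWord_lt_of_length_lt (hlen v hv ▸ hlt)⟩, rfl⟩
  · refine lieIncl_mem_of_mem_lsSpan (fun v hv hv' => ?_)
      (lieOf_mem_lsSpan_of_letterwiseLE hle w.2 hne)
    exact Ideal.subset_span ⟨v, ⟨hder v hv,
      lsWord_lt_of_wordLT ((hlen v hv).trans hle.length_eq) hv'⟩, rfl⟩

end LeadingTerm

/-! ### Monomials and their order -/

section Monomials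

open MvPolynomial

variable {F : Type v} [Field F] {X : Type u} [LinearOrder X]

variable (F X) in
/-- The basis of the free Poisson algebra that consists of the commutative products of
Lyndon--Shirshov words. -/
noncomputable def monoBasis : Module.Basis (Multiset (LSWord X)) F (FreePoisson F X) :=
  (basisMonomials (LSWord X) F).reindex Multiset.toFinsupp.symm.toEquiv

theorem monoBasis_apply (s : Multiset (LSWord X)) :
    monoBasis F X s = (s.map MvPolynomial.X).prod := by
  have h : ∀ s, monoBasis F X s = monomial (Multiset.toFinsupp s) 1 := by
    intro s
    simp only [monoBasis, Module.Basis.reindex_apply, coe_basisMonomials]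
    rfl
  induction s using Multiset.induction_on with
  | empty => simp [h]
  | cons u s ih =>
    rw [Multiset.map_cons, Multiset.prod_cons, ← ih, h, h, ← Multiset.singleton_add,
      Multiset.toFinsupp_add, Multiset.toFinsupp_singleton, MvPolynomial.X, monomial_mul, one_mul]

theorem monoBasis_add (s t : Multiset (LSWord X)) :
    monoBasis F X (s + t) = monoBasis F X s * monoBasis F X t := by
  simp [monoBasis_apply]

theorem monoBasis_cons (u : LSWord X) (s : Multiset (LSWord X)) :
    monoBasis F X (u ::ₘ s) = MvPolynomial.X u * monoBasis F X s := by
  simp [monoBasis_apply]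

variable (F) in
/-- The span of the monomials in the set `S`. -/
noncomputable def monoSpan (S : Set (Multiset (LSWord X))) : Submodule F (FreePoisson F X) :=
  Submodule.span F (monoBasis F X '' S)

theorem monoBasis_mem_monoSpan {S : Set (Multiset (LSWord X))} {s : Multiset (LSWord X)}
    (h : s ∈ S) : monoBasis F X s ∈ monoSpan F S := Submodule.subset_span ⟨s, h, rfl⟩

theorem monoSpan_mono {S T : Set (Multiset (LSWord X))} (h : S ⊆ T) :
    monoSpan F S ≤ monoSpan F T := Submodule.span_mono (Set.image_mono h)

theorem mem_monoSpan_iff {S : Set (Multiset (LSWord X))} {f : FreePoisson F X} :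
    f ∈ monoSpan F S ↔ ∀ s, (monoBasis F X).coord s f ≠ 0 → s ∈ S := by
  rw [monoSpan, Module.Basis.mem_span_image]
  constructor
  · intro h s hs
    exact h (by simpa using hs)
  · intro h s hs
    exact h s (by simpa using hs)

theorem mem_monoSpan_univ (f : FreePoisson F X) : f ∈ monoSpan F Set.univ :=
  mem_monoSpan_iff.2 fun _ _ => trivial

theorem mul_mem_monoSpan {S T R : Set (Multiset (LSWord X))} (h : ∀ s ∈ S, ∀ t ∈ T, s + t ∈ R)
    {f g : FreePoisson F X} (hf : f ∈ monoSpan F S) (hg : g ∈ monoSpan F T) :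
    f * g ∈ monoSpan F R := by
  refine Submodule.mul_le.1 ?_ f hf g hg
  rw [monoSpan, monoSpan, Submodule.span_mul_span, Submodule.span_le]
  rintro _ ⟨_, ⟨s, hs, rfl⟩, _, ⟨t, ht, rfl⟩, rfl⟩
  exact Submodule.subset_span ⟨s + t, h s hs t ht, monoBasis_add s t⟩

/-- The factors with derivations of a monomial, in increasing order. -/
noncomputable def posFactors (s : Multiset (LSWord X)) : List (LSWord X) :=
  (s.filter fun u => 1 ≤ derivs u.1).sort (· ≤ ·)

/-- The monomials that are lower than those with the list `l` of factors with derivations. The lists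
are compared lexicographically, and a longer list is lower than its beginnings. -/
def lowerMonos (l : List (LSWord X)) : Set (Multiset (LSWord X)) := {t | wordLT (posFactors t) l}

theorem posFactors_eq_of_perm {s : Multiset (LSWord X)} {l : List (LSWord X)}
    (hl : l.Pairwise (· ≤ ·)) (h : (l : Multiset (LSWord X)) = s.filter fun u => 1 ≤ derivs u.1) :
    posFactors s = l := by
  refine List.Perm.eq_of_pairwise (fun a b _ _ => le_antisymm) (Multiset.pairwise_sort _ _) hl ?_
  rw [← Multiset.coe_eq_coe, posFactors, Multiset.sort_eq, h]

theorem mem_lowerMonos_of_mem {s : Multiset (LSWord X)} {u w : LSWord X} (hu : u ∈ s)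
    (hd : 1 ≤ derivs u.1) (huw : u < w) (l : List (LSWord X)) : s ∈ lowerMonos (w :: l) := by
  have hmem : u ∈ posFactors s := by
    rw [posFactors, Multiset.mem_sort, Multiset.mem_filter]
    exact ⟨hu, hd⟩
  have hsort : (posFactors s).Pairwise (· ≤ ·) := Multiset.pairwise_sort _ _
  change wordLT (posFactors s) (w :: l)
  cases hp : posFactors s with
  | nil => rw [hp] at hmem; simp at hmem
  | cons h t =>
    rw [hp] at hmem hsort
    refine Or.inl (lt_of_le_of_lt ?_ huw)
    rcases List.mem_cons.1 hmem with rfl | hmem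
    · exact le_rfl
    · exact List.rel_of_pairwise_cons hsort hmem

theorem cons_mem_lowerMonos {s : Multiset (LSWord X)} {w : LSWord X} {l : List (LSWord X)}
    (hw : 1 ≤ derivs w.1) (hs : s ∈ lowerMonos l) : w ::ₘ s ∈ lowerMonos (w :: l) := by
  by_cases h : ∃ u ∈ s, 1 ≤ derivs u.1 ∧ u < w
  · obtain ⟨u, hu, hd, huw⟩ := h
    exact mem_lowerMonos_of_mem (Multiset.mem_cons_of_mem hu) hd huw l
  · push Not at h
    have : posFactors (w ::ₘ s) = w :: posFactors s := by
      rw [posFactors, Multiset.filter_cons_of_pos (p := fun u : LSWord X => 1 ≤ derivs u.1) _ hw,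
        Multiset.sort_cons]
      · rfl
      · intro u hu
        rw [Multiset.mem_filter] at hu
        exact h u hu.1 hu.2
    change wordLT (posFactors (w ::ₘ s)) (w :: l)
    rw [this]
    exact Or.inr ⟨rfl, hs⟩

theorem mem_monoSpan_of_mem_lowerIdeal {w : LSWord X} (l : List (LSWord X)) {f : FreePoisson F X}
    (hf : f ∈ lowerIdeal F w) : f ∈ monoSpan F (lowerMonos (w :: l)) := by
  -- The span of the monomials with some factor below `w` is stable under multiplication.
  set S : Set (Multiset (LSWord X)) := {s | ∃ u ∈ s, 1 ≤ derivs u.1 ∧ u < w} with hS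
  have hle : monoSpan F S ≤ monoSpan F (lowerMonos (w :: l)) :=
    monoSpan_mono fun s ⟨u, hu, hd, huw⟩ => mem_lowerMonos_of_mem hu hd huw l
  refine hle ?_
  induction hf using Submodule.span_induction with
  | zero => exact Submodule.zero_mem _
  | add x y _ _ h₁ h₂ => exact Submodule.add_mem _ h₁ h₂
  | mem x hx =>
    obtain ⟨u, ⟨hu, huw⟩, rfl⟩ := hx
    have : (MvPolynomial.X u : FreePoisson F X) = monoBasis F X {u} := by simp [monoBasis_apply]
    rw [this]
    exact monoBasis_mem_monoSpan ⟨u, Multiset.mem_singleton_self u, hu, huw⟩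
  | smul r x _ hx =>
    refine mul_mem_monoSpan ?_ (mem_monoSpan_univ r) hx
    rintro s - t ⟨u, hu, h⟩
    exact ⟨u, Multiset.mem_add.2 (Or.inr hu), h⟩

theorem mul_X_mem_monoSpan {w : LSWord X} (hw : 1 ≤ derivs w.1) {l : List (LSWord X)}
    {f : FreePoisson F X} (hf : f ∈ monoSpan F (lowerMonos l)) :
    f * MvPolynomial.X w ∈ monoSpan F (lowerMonos (w :: l)) := by
  have : (MvPolynomial.X w : FreePoisson F X) = monoBasis F X {w} := by simp [monoBasis_apply]
  rw [this]
  refine mul_mem_monoSpan (T := {{w}}) ?_ hf (monoBasis_mem_monoSpan rfl)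
  rintro s hs _ rfl
  rw [add_comm, Multiset.singleton_add]
  exact cons_mem_lowerMonos hw hs

/-- If turning a list of `k a` letters into one letter multiplies the leading term by `W a`, then
the successive steps multiply the leading term by all the words `W a`. -/
theorem prod_foldl_absorb_sub_mem {α : Type w} (W : α → LSWord X)
    (f : α → List (Magma₂ X) → Magma₂ X)
    (hf : ∀ a c, 1 ≤ derivs (W a).1 → c.length = derivs (W a).1 →
      pEval F (f a c) - (c.map (pEval F)).prod * MvPolynomial.X (W a) ∈ lowerIdeal F (W a))
    (l : List α) (hl : ∀ a ∈ l, 1 ≤ derivs (W a).1) (c : List (Magma₂ X)) (r : ℕ)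
    (hc : (c.length : ℤ) = r + 1 + (l.map fun a => (derivs (W a).1 : ℤ) - 1).sum)
    (A : FreePoisson F X) (l₀ : List (LSWord X))
    (hA : (c.map (pEval F)).prod - A ∈ monoSpan F (lowerMonos l₀)) :
    ((l.foldl (fun c a => absorb (derivs (W a).1) (f a) c) c).map (pEval F)).prod -
        A * ((l.map W).map MvPolynomial.X).prod ∈
      monoSpan F (lowerMonos ((l.map W).reverse ++ l₀)) := by
  induction l generalizing c A l₀ with
  | nil => simpa using hA
  | cons a l ih =>
    have hnn : 0 ≤ (l.map fun a => (derivs (W a).1 : ℤ) - 1).sum := by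
      apply List.sum_nonneg
      intro z hz
      obtain ⟨b, hb, rfl⟩ := List.mem_map.1 hz
      have := hl b (List.mem_cons_of_mem _ hb)
      omega
    have ha := hl a List.mem_cons_self
    rw [List.map_cons, List.sum_cons] at hc
    have hlen : derivs (W a).1 ≤ c.length := by omega
    have hstep := ih (fun b hb => hl b (List.mem_cons_of_mem _ hb))
      (absorb (derivs (W a).1) (f a) c) (by rw [length_absorb]; omega)
      (A * MvPolynomial.X (W a)) (W a :: l₀) ?_
    · rw [List.foldl_cons]
      simpa [mul_assoc] using hstep
    · have hlead := hf a (c.drop (c.length - derivs (W a).1)) ha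
        (by rw [List.length_drop]; omega)
      have hsplit : (c.map (pEval F)).prod =
          ((c.take (c.length - derivs (W a).1)).map (pEval F)).prod *
            ((c.drop (c.length - derivs (W a).1)).map (pEval F)).prod := by
        rw [← List.prod_append, ← List.map_append, List.take_append_drop]
      have habs : ((absorb (derivs (W a).1) (f a) c).map (pEval F)).prod =
          ((c.take (c.length - derivs (W a).1)).map (pEval F)).prod *
            pEval F (f a (c.drop (c.length - derivs (W a).1))) := by
        simp [absorb]
      have hsum : ((absorb (derivs (W a).1) (f a) c).map (pEval F)).prod -
            A * MvPolynomial.X (W a) =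
          ((c.map (pEval F)).prod - A) * MvPolynomial.X (W a) +
          ((c.take (c.length - derivs (W a).1)).map (pEval F)).prod *
            (pEval F (f a (c.drop (c.length - derivs (W a).1))) -
              ((c.drop (c.length - derivs (W a).1)).map (pEval F)).prod *
                MvPolynomial.X (W a)) := by
        rw [habs, hsplit]; ring
      rw [hsum]
      exact Submodule.add_mem _ (mul_X_mem_monoSpan ha hA)
        (mem_monoSpan_of_mem_lowerIdeal l₀ (Ideal.mul_mem_left _ _ hlead))

end Monomials

section Grading

open MvPolynomial

variable {F : Type v} [Field F] {X : Type u}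

/-- The multiset of generators that occur in a Lie word in the letters `x^(n)`. -/
def gens (w : FreeMagma (DLetter X)) : Multiset X := (content w).map DLetter.gen

theorem gens_mul (a b : FreeMagma (DLetter X)) : gens (.mul a b) = gens a + gens b := by
  rw [gens, content_mul, Multiset.map_add]
  rfl

variable [LinearOrder X]

/-- The multiset of generators that occur in a monomial. -/
def monoGens (s : Multiset (LSWord X)) : Multiset X := (s.map fun u => gens u.1).sum

/-- The weight of a monomial. -/
def monoWeight (s : Multiset (LSWord X)) : ℤ := (s.map fun u => weight u.1).sum

/-- The monomials with given multiset of generators and given weight. -/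
def bidegree (M : Multiset X) (k : ℤ) : Set (Multiset (LSWord X)) :=
  {s | monoGens s = M ∧ monoWeight s = k}

theorem mul_mem_bidegree {M M' : Multiset X} {k k' : ℤ} {f g : FreePoisson F X}
    (hf : f ∈ monoSpan F (bidegree M k)) (hg : g ∈ monoSpan F (bidegree M' k')) :
    f * g ∈ monoSpan F (bidegree (M + M') (k + k')) := by
  refine mul_mem_monoSpan ?_ hf hg
  rintro s ⟨rfl, rfl⟩ t ⟨rfl, rfl⟩
  exact ⟨by simp [monoGens], by simp [monoWeight]⟩

theorem pLie_mem_bidegree (w : FreeMagma (DLetter X)) :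
    pLie F w ∈ monoSpan F (bidegree (gens w) (weight w)) := by
  have h := lieOf_mem_lsSpan_content (F := F) w
  rw [pLie]
  generalize lieOf F w = a at h
  induction h using Submodule.span_induction with
  | mem x hx =>
    obtain ⟨u, ⟨hu, huw, -⟩, rfl⟩ := hx
    have h₁ : lieIncl (lsBasis F (DLetter X)) (lieOf F u) = monoBasis F X {⟨u, hu⟩} := by
      rw [monoBasis_apply, Multiset.map_singleton, Multiset.prod_singleton, ← pLie_coe]
      rfl
    rw [h₁]
    refine monoBasis_mem_monoSpan ⟨?_, ?_⟩
    · simp [monoGens, gens, huw]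
    · simp [monoWeight, weight_eq_derivs, derivs_eq_sum_content, huw]
  | zero => simp
  | add x y _ _ h₁ h₂ => rw [map_add]; exact Submodule.add_mem _ h₁ h₂
  | smul c x _ h => rw [map_smul]; exact Submodule.smul_mem _ c h

theorem bidegree_cons (u : LSWord X) (s : Multiset (LSWord X)) :
    monoGens (u ::ₘ s) = gens u.1 + monoGens s ∧
      monoWeight (u ::ₘ s) = weight u.1 + monoWeight s := by
  simp [monoGens, monoWeight]

theorem X_mem_bidegree (u : LSWord X) :
    (MvPolynomial.X u : FreePoisson F X) ∈ monoSpan F (bidegree (gens u.1) (weight u.1)) := by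
  rw [← pLie_coe]
  exact pLie_mem_bidegree u.1

theorem monoBasis_mem_bidegree (s : Multiset (LSWord X)) :
    monoBasis F X s ∈ monoSpan F (bidegree (monoGens s) (monoWeight s)) :=
  monoBasis_mem_monoSpan ⟨rfl, rfl⟩

theorem mem_bidegree_of_eq {M M' : Multiset X} {k k' : ℤ} {f : FreePoisson F X}
    (hf : f ∈ monoSpan F (bidegree M k)) (hM : M = M') (hk : k = k') :
    f ∈ monoSpan F (bidegree M' k') := hM ▸ hk ▸ hf

theorem monoBasis_zero : monoBasis F X 0 = 1 := by simp [monoBasis_apply]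

theorem pBrk_X_monoBasis_mem (u : LSWord X) (t : Multiset (LSWord X)) :
    pBrk F (MvPolynomial.X u) (monoBasis F X t) ∈
      monoSpan F (bidegree (gens u.1 + monoGens t) (weight u.1 + monoWeight t + 1)) := by
  induction t using Multiset.induction_on with
  | empty => rw [monoBasis_zero, pBrk_one_right]; exact Submodule.zero_mem _
  | cons v t ih =>
    obtain ⟨h₁, h₂⟩ := bidegree_cons v t
    rw [monoBasis_cons, pBrk_mul_right, h₁, h₂]
    refine Submodule.add_mem _ ?_ ?_
    · exact mem_bidegree_of_eq (mul_mem_bidegree (X_mem_bidegree v) ih) (by abel) (by ring)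
    · have h : pBrk F (MvPolynomial.X u) (MvPolynomial.X v) ∈
          monoSpan F (bidegree (gens u.1 + gens v.1) (weight u.1 + weight v.1 + 1)) := by
        rw [← pLie_coe, ← pLie_coe, ← pLie_mul, ← gens_mul]
        exact pLie_mem_bidegree _
      exact mem_bidegree_of_eq (mul_mem_bidegree (monoBasis_mem_bidegree t) h) (by abel) (by ring)

theorem pBrk_monoBasis_mem (s t : Multiset (LSWord X)) :
    pBrk F (monoBasis F X s) (monoBasis F X t) ∈
      monoSpan F (bidegree (monoGens s + monoGens t) (monoWeight s + monoWeight t + 1)) := by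
  induction s using Multiset.induction_on with
  | empty => rw [monoBasis_zero, pBrk_one_left]; exact Submodule.zero_mem _
  | cons v s ih =>
    obtain ⟨h₁, h₂⟩ := bidegree_cons v s
    rw [monoBasis_cons, pBrk_mul_left, h₁, h₂]
    refine Submodule.add_mem _ ?_ ?_
    · exact mem_bidegree_of_eq (mul_mem_bidegree (X_mem_bidegree v) ih) (by abel) (by ring)
    · exact mem_bidegree_of_eq (mul_mem_bidegree (monoBasis_mem_bidegree s)
        (pBrk_X_monoBasis_mem v t)) (by abel) (by ring)

theorem pBrk_mem_bidegree {M M' : Multiset X} {k k' : ℤ} {f g : FreePoisson F X}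
    (hf : f ∈ monoSpan F (bidegree M k)) (hg : g ∈ monoSpan F (bidegree M' k')) :
    pBrk F f g ∈ monoSpan F (bidegree (M + M') (k + k' + 1)) := by
  induction hf, hg using Submodule.span_induction₂ with
  | mem_mem x y hx hy =>
    obtain ⟨s, ⟨rfl, rfl⟩, rfl⟩ := hx
    obtain ⟨t, ⟨rfl, rfl⟩, rfl⟩ := hy
    exact pBrk_monoBasis_mem s t
  | zero_left y hy => simp
  | zero_right x hx => simp
  | add_left x y z _ _ _ h₁ h₂ =>
    rw [map_add, LinearMap.add_apply]; exact Submodule.add_mem _ h₁ h₂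
  | add_right x y z _ _ _ h₁ h₂ => rw [map_add]; exact Submodule.add_mem _ h₁ h₂
  | smul_left r x y _ _ h =>
    rw [map_smul, LinearMap.smul_apply]; exact Submodule.smul_mem _ r h
  | smul_right r x y _ _ h => rw [map_smul]; exact Submodule.smul_mem _ r h

theorem pDer_pLie_mem_bidegree (w : FreeMagma (DLetter X)) :
    pDer F (pLie F w) ∈ monoSpan F (bidegree (gens w) (weight w + 1)) := by
  induction w with
  | ih1 y =>
    erw [pDer_pLie_of]
    refine mem_bidegree_of_eq (pLie_mem_bidegree _) ?_ ?_
    · rw [gens, content_of]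
      erw [gens, content_of]
      rfl
    · change -1 + ((DLetter.ord y + 1 : ℕ) : ℤ) = -1 + (DLetter.ord y : ℤ) + 1
      push_cast
      ring
  | ih2 a b iha ihb =>
    change pDer F (pLie F (.mul a b)) ∈
      monoSpan F (bidegree (gens (.mul a b)) (weight a + weight b + 1 + 1))
    rw [pLie_mul, pDer_pBrk, gens_mul]
    exact Submodule.add_mem _
      (mem_bidegree_of_eq (pBrk_mem_bidegree iha (pLie_mem_bidegree b)) rfl (by ring))
      (mem_bidegree_of_eq (pBrk_mem_bidegree (pLie_mem_bidegree a) ihb) rfl (by ring))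

theorem pDer_mem_bidegree {M : Multiset X} {k : ℤ} {f : FreePoisson F X}
    (hf : f ∈ monoSpan F (bidegree M k)) : pDer F f ∈ monoSpan F (bidegree M (k + 1)) := by
  induction hf using Submodule.span_induction with
  | mem x hx =>
    obtain ⟨s, ⟨rfl, rfl⟩, rfl⟩ := hx
    induction s using Multiset.induction_on with
    | empty => rw [monoBasis_zero, Derivation.map_one_eq_zero]; exact Submodule.zero_mem _
    | cons v s ih =>
      obtain ⟨h₁, h₂⟩ := bidegree_cons v s
      rw [monoBasis_cons, Derivation.leibniz, h₁, h₂, smul_eq_mul, smul_eq_mul]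
      refine Submodule.add_mem _ ?_ ?_
      · exact mem_bidegree_of_eq (mul_mem_bidegree (X_mem_bidegree v) ih) rfl (by ring)
      · rw [← pLie_coe]
        exact mem_bidegree_of_eq (mul_mem_bidegree (monoBasis_mem_bidegree s)
          (pDer_pLie_mem_bidegree v.1)) (by abel) (by ring)
  | zero => simp
  | add x y _ _ h₁ h₂ => rw [map_add]; exact Submodule.add_mem _ h₁ h₂
  | smul c x _ h => rw [Derivation.map_smul]; exact Submodule.smul_mem _ c h

/-- The value of a monomial in `∘` and `[,]` is homogeneous, and its weight is `-1`. -/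
theorem exists_pEval_mem_bidegree (m : Magma₂ X) :
    ∃ M, pEval F m ∈ monoSpan F (bidegree M (-1)) := by
  induction m with
  | of x => exact ⟨gens (.of (dl x 0)), mem_bidegree_of_eq (pLie_mem_bidegree _) rfl rfl⟩
  | circ a b iha ihb =>
    obtain ⟨M, hM⟩ := iha
    obtain ⟨M', hM'⟩ := ihb
    refine ⟨M + M', ?_⟩
    rw [pEval_circ]
    exact mem_bidegree_of_eq (mul_mem_bidegree hM (pDer_mem_bidegree hM')) rfl (by ring)
  | brk a b iha ihb =>
    obtain ⟨M, hM⟩ := iha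
    obtain ⟨M', hM'⟩ := ihb
    refine ⟨M + M', ?_⟩
    rw [pEval_brk]
    exact mem_bidegree_of_eq (pBrk_mem_bidegree hM hM') rfl (by ring)

theorem finite_setOf_freeMagma {Y : Type*} {A : Set Y} (hA : A.Finite) (n : ℕ) :
    {w : FreeMagma Y | w.length ≤ n ∧ ∀ y ∈ content w, y ∈ A}.Finite := by
  induction n with
  | zero =>
    refine Set.finite_empty.subset fun w hw => ?_
    have := w.length_pos
    have := hw.1
    omega
  | succ n ih =>
    refine ((hA.image FreeMagma.of).union (ih.image2 FreeMagma.mul ih)).subset ?_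
    rintro (y | ⟨a, b⟩) ⟨hlen, hmem⟩
    · exact Or.inl ⟨y, hmem y (by rw [content_of]; exact Multiset.mem_singleton_self y), rfl⟩
    · rw [content_mul] at hmem
      change a.length + b.length ≤ n + 1 at hlen
      have ha := a.length_pos
      have hb := b.length_pos
      exact Or.inr ⟨a, ⟨by omega, fun y hy => hmem y (Multiset.mem_add.2 (Or.inl hy))⟩,
        b, ⟨by omega, fun y hy => hmem y (Multiset.mem_add.2 (Or.inr hy))⟩, rfl⟩

theorem finite_setOf_multiset {α : Type*} {T : Set α} (hT : T.Finite) (n : ℕ) :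
    {s : Multiset α | s.card ≤ n ∧ ∀ a ∈ s, a ∈ T}.Finite := by
  classical
  refine (Finset.finite_toSet (Finset.Iic (n • hT.toFinset.val))).subset ?_
  rintro s ⟨hs, hmem⟩
  simp only [Finset.coe_Iic, Set.mem_Iic, Multiset.le_iff_count, Multiset.count_nsmul]
  intro a
  by_cases ha : a ∈ s
  · have : 1 ≤ hT.toFinset.val.count a :=
      Multiset.one_le_count_iff_mem.2 (hT.mem_toFinset.2 (hmem a ha))
    calc s.count a ≤ n := (Multiset.count_le_card a s).trans hs
      _ ≤ n * hT.toFinset.val.count a := Nat.le_mul_of_pos_right n this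
  · rw [Multiset.count_eq_zero_of_notMem ha]
    exact Nat.zero_le _

theorem card_le_card_monoGens (s : Multiset (LSWord X)) : s.card ≤ (monoGens s).card := by
  induction s using Multiset.induction_on with
  | empty => simp
  | cons u s ih =>
    rw [(bidegree_cons u s).1, Multiset.card_add, Multiset.card_cons, gens, Multiset.card_map,
      card_content]
    have := u.1.length_pos
    omega

theorem monoWeight_eq (s : Multiset (LSWord X)) :
    monoWeight s = ((s.map fun u => derivs u.1).sum : ℤ) - s.card := by
  induction s using Multiset.induction_on with
  | empty => simp [monoWeight]
  | cons u s ih =>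
    rw [(bidegree_cons u s).2, ih, weight_eq_derivs]
    simp
    ring

theorem finite_bidegree (M : Multiset X) : (bidegree M (-1)).Finite := by
  classical
  set n := M.card
  have hA : {y : DLetter X | DLetter.ord y < n ∧ DLetter.gen y ∈ M}.Finite := by
    refine ((Finset.finite_toSet (Finset.range n)).image2 (fun k x => dl x k)
      (Finset.finite_toSet M.toFinset)).subset ?_
    rintro y ⟨h₁, h₂⟩
    exact ⟨DLetter.ord y, by simpa using h₁, DLetter.gen y, by simpa using h₂, rfl⟩
  have hT : {u : LSWord X | u.1.length ≤ n ∧ ∀ y ∈ content u.1,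
      y ∈ {y : DLetter X | DLetter.ord y < n ∧ DLetter.gen y ∈ M}}.Finite :=
    (finite_setOf_freeMagma hA n).preimage Subtype.val_injective.injOn
  refine (finite_setOf_multiset hT n).subset ?_
  rintro s ⟨hM, hk⟩
  have hcard : s.card ≤ n := (card_le_card_monoGens s).trans_eq (by rw [hM])
  refine ⟨hcard, fun u hu => ?_⟩
  have hgens : gens u.1 ≤ M := by
    rw [← hM]
    have hmem : gens u.1 ∈ s.map fun u => gens u.1 :=
      Multiset.mem_map_of_mem (fun u : LSWord X => gens u.1) hu
    exact Multiset.le_sum_of_mem hmem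
  have hder : derivs u.1 ≤ (s.map fun u => derivs u.1).sum :=
    Multiset.le_sum_of_mem (Multiset.mem_map_of_mem (fun u : LSWord X => derivs u.1) hu)
  rw [monoWeight_eq] at hk
  have hpos : 0 < s.card := Multiset.card_pos_iff_exists_mem.2 ⟨u, hu⟩
  refine ⟨?_, fun y hy => ⟨?_, ?_⟩⟩
  · have := Multiset.card_le_card hgens
    rwa [gens, Multiset.card_map, card_content] at this
  · have h₁ : DLetter.ord y ≤ derivs u.1 := by
      rw [derivs_eq_sum_content]
      have hmem : DLetter.ord y ∈ (content u.1).map DLetter.ord := Multiset.mem_map_of_mem _ hy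
      exact Multiset.le_sum_of_mem hmem
    omega
  · exact Multiset.mem_of_le hgens (Multiset.mem_map_of_mem _ hy)

end Grading

/-! ### Canonical forms and the basis -/

section CanonicalForms

variable {X : Type u} [LinearOrder X]

/-- A letter `x^(n)` as a Lyndon--Shirshov word. -/
def letterLS (y : DLetter X) : LSWord X := ⟨.of y, trivial⟩

theorem letterLS_le {y z : DLetter X} : letterLS y ≤ letterLS z ↔ y ≤ z := by
  rw [lsWord_le_iff, lieLE]
  change 1 < 1 ∨ (1 = 1 ∧ ¬ wordLT (word (.of z)) (word (.of y))) ↔ _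
  rw [word_of, word_of]
  simp [wordLT]

theorem letterLS_injective : Function.Injective (letterLS : DLetter X → LSWord X) :=
  fun _ _ h => by
    injection h with h
    injection h

namespace CanonicalForm

/-- The factors `x_{i_1}, ..., x_{i_k}` as Lyndon--Shirshov words. -/
def xsLS (a : CanonicalForm X) : List (LSWord X) := a.xs.map fun x => letterLS (dl x 0)

/-- The factors `B_1, ..., B_m` as Lyndon--Shirshov words. -/
def BsLS (a : CanonicalForm X) : List (LSWord X) :=
  a.Bs.pmap Subtype.mk fun B hB => (a.Bs_spec B hB).1

/-- The factors `A_n, ..., A_1` as Lyndon--Shirshov words. -/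
def AsLS (a : CanonicalForm X) : List (LSWord X) :=
  a.As.pmap Subtype.mk fun A hA => (a.As_spec A hA).1

/-- The factors `x_{j_l}^(r_l), ..., x_{j_1}^(r_1)` as Lyndon--Shirshov words. -/
def ysLS (a : CanonicalForm X) : List (LSWord X) := a.ys.map letterLS

/-- The monomial written in a canonical form. -/
def toMonomial (a : CanonicalForm X) : Multiset (LSWord X) :=
  a.xsLS + a.BsLS + a.AsLS + a.ysLS

variable (a b : CanonicalForm X)

theorem map_BsLS : a.BsLS.map Subtype.val = a.Bs := by simp [BsLS, List.map_pmap]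

theorem map_AsLS : a.AsLS.map Subtype.val = a.As := by simp [AsLS, List.map_pmap]

theorem spec_of_mem_BsLS {u : LSWord X} (hu : u ∈ a.BsLS) : 2 ≤ u.1.length ∧ derivs u.1 = 0 :=
  (a.Bs_spec u.1 (a.map_BsLS ▸ List.mem_map_of_mem hu)).2

theorem spec_of_mem_AsLS {u : LSWord X} (hu : u ∈ a.AsLS) : 2 ≤ u.1.length ∧ 1 ≤ derivs u.1 :=
  (a.As_spec u.1 (a.map_AsLS ▸ List.mem_map_of_mem hu)).2

theorem spec_of_mem_xsLS {u : LSWord X} (hu : u ∈ a.xsLS) : u.1.length = 1 ∧ derivs u.1 = 0 := by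
  obtain ⟨x, -, rfl⟩ := List.mem_map.1 hu
  exact ⟨rfl, rfl⟩

theorem spec_of_mem_ysLS {u : LSWord X} (hu : u ∈ a.ysLS) : u.1.length = 1 ∧ 1 ≤ derivs u.1 := by
  obtain ⟨y, hy, rfl⟩ := List.mem_map.1 hu
  exact ⟨rfl, a.ys_spec y hy⟩

theorem xsLS_sorted : a.xsLS.Pairwise (· ≤ ·) := by
  refine List.pairwise_map.2 (a.xs_sorted.imp fun {x y} h => letterLS_le.2 ?_)
  exact Prod.Lex.toLex_le_toLex.2 (Or.inr ⟨rfl, h⟩)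

theorem BsLS_sorted : a.BsLS.Pairwise (· ≤ ·) := by
  have := a.Bs_sorted
  rw [← a.map_BsLS, List.pairwise_map] at this
  exact this

theorem AsLS_sorted : a.AsLS.Pairwise (· ≥ ·) := by
  have := a.As_sorted
  rw [← a.map_AsLS, List.pairwise_map] at this
  exact this

theorem ysLS_sorted : a.ysLS.Pairwise (· ≥ ·) :=
  List.pairwise_map.2 (a.ys_sorted.imp fun h => letterLS_le.2 h)

theorem toMonomial_filter (p : LSWord X → Prop) [DecidablePred p] :
    a.toMonomial.filter p = (a.xsLS : Multiset (LSWord X)).filter p +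
      (a.BsLS : Multiset (LSWord X)).filter p + (a.AsLS : Multiset (LSWord X)).filter p +
      (a.ysLS : Multiset (LSWord X)).filter p := by
  simp only [toMonomial, Multiset.filter_add]

theorem filter_coe_self {p : LSWord X → Prop} [DecidablePred p] {l : List (LSWord X)}
    (h : ∀ u ∈ l, p u) : (l : Multiset (LSWord X)).filter p = l :=
  Multiset.filter_eq_self.2 fun u hu => h u (Multiset.mem_coe.1 hu)

theorem filter_coe_zero {p : LSWord X → Prop} [DecidablePred p] {l : List (LSWord X)}
    (h : ∀ u ∈ l, ¬ p u) : (l : Multiset (LSWord X)).filter p = 0 :=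
  Multiset.filter_eq_nil.2 fun u hu => h u (Multiset.mem_coe.1 hu)

theorem filter_xs : a.toMonomial.filter (fun u => u.1.length = 1 ∧ derivs u.1 = 0) = a.xsLS := by
  rw [toMonomial_filter, filter_coe_self fun u hu => a.spec_of_mem_xsLS hu, filter_coe_zero,
    filter_coe_zero, filter_coe_zero]
  · simp
  · intro u hu; have := a.spec_of_mem_ysLS hu; omega
  · intro u hu; have := a.spec_of_mem_AsLS hu; omega
  · intro u hu; have := a.spec_of_mem_BsLS hu; omega

theorem filter_Bs : a.toMonomial.filter (fun u => 2 ≤ u.1.length ∧ derivs u.1 = 0) = a.BsLS := by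
  rw [toMonomial_filter, filter_coe_zero, filter_coe_self fun u hu => a.spec_of_mem_BsLS hu,
    filter_coe_zero, filter_coe_zero]
  · simp
  · intro u hu; have := a.spec_of_mem_ysLS hu; omega
  · intro u hu; have := a.spec_of_mem_AsLS hu; omega
  · intro u hu; have := a.spec_of_mem_xsLS hu; omega

theorem filter_As : a.toMonomial.filter (fun u => 2 ≤ u.1.length ∧ 1 ≤ derivs u.1) = a.AsLS := by
  rw [toMonomial_filter, filter_coe_zero, filter_coe_zero,
    filter_coe_self fun u hu => a.spec_of_mem_AsLS hu, filter_coe_zero]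
  · simp
  · intro u hu; have := a.spec_of_mem_ysLS hu; omega
  · intro u hu; have := a.spec_of_mem_BsLS hu; omega
  · intro u hu; have := a.spec_of_mem_xsLS hu; omega

theorem filter_ys : a.toMonomial.filter (fun u => u.1.length = 1 ∧ 1 ≤ derivs u.1) = a.ysLS := by
  rw [toMonomial_filter, filter_coe_zero, filter_coe_zero, filter_coe_zero,
    filter_coe_self fun u hu => a.spec_of_mem_ysLS hu]
  · simp
  · intro u hu; have := a.spec_of_mem_AsLS hu; omega
  · intro u hu; have := a.spec_of_mem_BsLS hu; omega
  · intro u hu; have := a.spec_of_mem_xsLS hu; omega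

theorem toMonomial_injective :
    Function.Injective (toMonomial : CanonicalForm X → Multiset (LSWord X)) := by
  intro a b h
  have hxs : a.xsLS = b.xsLS := List.Perm.eq_of_pairwise (fun _ _ _ _ => le_antisymm)
    a.xsLS_sorted b.xsLS_sorted (Multiset.coe_eq_coe.1 (by rw [← filter_xs, h, filter_xs]))
  have hBs : a.BsLS = b.BsLS := List.Perm.eq_of_pairwise (fun _ _ _ _ => le_antisymm)
    a.BsLS_sorted b.BsLS_sorted (Multiset.coe_eq_coe.1 (by rw [← filter_Bs, h, filter_Bs]))
  have hAs : a.AsLS = b.AsLS := List.Perm.eq_of_pairwise (fun _ _ _ _ h h' => le_antisymm h' h)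
    a.AsLS_sorted b.AsLS_sorted (Multiset.coe_eq_coe.1 (by rw [← filter_As, h, filter_As]))
  have hys : a.ysLS = b.ysLS := List.Perm.eq_of_pairwise (fun _ _ _ _ h h' => le_antisymm h' h)
    a.ysLS_sorted b.ysLS_sorted (Multiset.coe_eq_coe.1 (by rw [← filter_ys, h, filter_ys]))
  ext1
  · refine List.map_injective_iff.2 (fun x y hxy => ?_) hxs
    exact congrArg DLetter.gen (letterLS_injective hxy)
  · rw [← map_BsLS, hBs, map_BsLS]
  · rw [← map_AsLS, hAs, map_AsLS]
  · exact List.map_injective_iff.2 letterLS_injective hys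

theorem posFactors_toMonomial : posFactors a.toMonomial = a.ysLS.reverse ++ a.AsLS.reverse := by
  refine posFactors_eq_of_perm ?_ ?_
  · refine List.pairwise_append.2 ⟨List.pairwise_reverse.2 a.ysLS_sorted,
      List.pairwise_reverse.2 a.AsLS_sorted, ?_⟩
    intro u hu v hv
    have hu' := a.spec_of_mem_ysLS (List.mem_reverse.1 hu)
    have hv' := a.spec_of_mem_AsLS (List.mem_reverse.1 hv)
    exact (lsWord_lt_of_length_lt (by omega)).le
  · rw [toMonomial_filter, filter_coe_zero, filter_coe_zero,
      filter_coe_self fun u hu => (a.spec_of_mem_AsLS hu).2,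
      filter_coe_self fun u hu => (a.spec_of_mem_ysLS hu).2, zero_add, zero_add, add_comm,
      ← Multiset.coe_add, Multiset.coe_reverse, Multiset.coe_reverse]
    · intro u hu; have := a.spec_of_mem_BsLS hu; omega
    · intro u hu; have := a.spec_of_mem_xsLS hu; omega

theorem exists_multiset_map_eq {α β : Type*} {f : α → β} {t : Multiset β}
    (h : ∀ b ∈ t, ∃ a, f a = b) : ∃ s : Multiset α, s.map f = t := by
  induction t using Multiset.induction_on with
  | empty => exact ⟨0, rfl⟩
  | cons b t ih =>
    obtain ⟨s, rfl⟩ := ih fun c hc => h c (Multiset.mem_cons_of_mem hc)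
    obtain ⟨a, rfl⟩ := h b (Multiset.mem_cons_self b _)
    exact ⟨a ::ₘ s, Multiset.map_cons f a s⟩

theorem exists_letterLS_eq {u : LSWord X} (h : u.1.length = 1) : ∃ y, letterLS y = u := by
  obtain ⟨w, hw⟩ := u
  cases w with
  | of y => exact ⟨y, rfl⟩
  | mul a b =>
    have ha := a.length_pos
    have hb := b.length_pos
    change a.length + b.length = 1 at h
    omega

theorem pmap_mk_map_val (l : List (LSWord X)) (h : ∀ w ∈ l.map Subtype.val, IsLS w) :
    (l.map Subtype.val).pmap Subtype.mk h = l := by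
  refine List.map_injective_iff.2 Subtype.val_injective ?_
  simp [List.map_pmap]

/-- Each monomial of weight `-1` has a canonical form. -/
theorem exists_toMonomial_eq {s : Multiset (LSWord X)} (hs : monoWeight s = -1) :
    ∃ a : CanonicalForm X, a.toMonomial = s := by
  obtain ⟨S₁, h₁⟩ : ∃ S : Multiset X, S.map (fun x => letterLS (dl x 0)) =
      s.filter fun u => u.1.length = 1 ∧ derivs u.1 = 0 := by
    refine exists_multiset_map_eq fun u hu => ?_
    obtain ⟨-, hlen, hder⟩ := Multiset.mem_filter.1 hu
    obtain ⟨y, rfl⟩ := exists_letterLS_eq hlen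
    refine ⟨DLetter.gen y, ?_⟩
    have : DLetter.ord y = 0 := hder
    rw [← this, dl_gen_ord]
  obtain ⟨S₄, h₄⟩ : ∃ S : Multiset (DLetter X), S.map letterLS =
      s.filter fun u => u.1.length = 1 ∧ ¬ derivs u.1 = 0 := by
    refine exists_multiset_map_eq fun u hu => ?_
    exact exists_letterLS_eq (Multiset.mem_filter.1 hu).2.1
  set S₂ := s.filter fun u => ¬ u.1.length = 1 ∧ derivs u.1 = 0 with h₂
  set S₃ := s.filter fun u => ¬ u.1.length = 1 ∧ ¬ derivs u.1 = 0 with h₃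
  have hsum : S₁.map (fun x => letterLS (dl x 0)) + S₂ + S₃ + S₄.map letterLS = s := by
    rw [h₁, h₄, h₂, h₃]
    conv_rhs => rw [← Multiset.filter_add_not (fun u : LSWord X => u.1.length = 1) s,
      ← Multiset.filter_add_not (fun u : LSWord X => derivs u.1 = 0) (s.filter _),
      ← Multiset.filter_add_not (fun u : LSWord X => derivs u.1 = 0)
        (s.filter fun u => ¬ u.1.length = 1)]
    simp only [Multiset.filter_filter, and_comm]
    abel
  have hlen : ∀ u : LSWord X, ¬ u.1.length = 1 → 2 ≤ u.1.length := by
    intro u hu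
    have := u.1.length_pos
    omega
  have hS₂ : ∀ u ∈ S₂.sort (· ≤ ·), 2 ≤ u.1.length ∧ derivs u.1 = 0 := by
    intro u hu
    have := (Multiset.mem_filter.1 ((Multiset.mem_sort _).1 hu)).2
    exact ⟨hlen u this.1, this.2⟩
  have hS₃ : ∀ u ∈ S₃.sort (· ≥ ·), 2 ≤ u.1.length ∧ 1 ≤ derivs u.1 := by
    intro u hu
    have := (Multiset.mem_filter.1 ((Multiset.mem_sort _).1 hu)).2
    exact ⟨hlen u this.1, Nat.one_le_iff_ne_zero.2 this.2⟩
  have hS₄ : ∀ y ∈ S₄, 1 ≤ DLetter.ord y := by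
    intro y hy
    have := (Multiset.mem_filter.1 (h₄ ▸ Multiset.mem_map_of_mem letterLS hy)).2.2
    exact Nat.one_le_iff_ne_zero.2 this
  let a : CanonicalForm X :=
    { xs := S₁.sort (· ≤ ·)
      Bs := (S₂.sort (· ≤ ·)).map Subtype.val
      As := (S₃.sort (· ≥ ·)).map Subtype.val
      ys := S₄.sort (· ≥ ·)
      xs_sorted := Multiset.pairwise_sort _ _
      Bs_spec := by
        intro B hB
        obtain ⟨u, hu, rfl⟩ := List.mem_map.1 hB
        exact ⟨u.2, hS₂ u hu⟩
      Bs_sorted := List.pairwise_map.2 (Multiset.pairwise_sort S₂ (· ≤ ·))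
      As_spec := by
        intro A hA
        obtain ⟨u, hu, rfl⟩ := List.mem_map.1 hA
        exact ⟨u.2, hS₃ u hu⟩
      As_sorted := List.pairwise_map.2 (Multiset.pairwise_sort S₃ (· ≥ ·))
      ys_spec := fun y hy => hS₄ y ((Multiset.mem_sort _).1 hy)
      ys_sorted := Multiset.pairwise_sort _ _
      weight_eq := by
        rw [← hs, ← hsum]
        simp only [monoWeight, Multiset.map_add, Multiset.sum_add, Multiset.map_map, List.map_map]
        simp only [← Multiset.sum_coe, ← Multiset.map_coe, Multiset.sort_eq]
        rfl }
  refine ⟨a, ?_⟩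
  have e₁ : (a.xsLS : Multiset (LSWord X)) = S₁.map fun x => letterLS (dl x 0) := by
    rw [show a.xsLS = (S₁.sort (· ≤ ·)).map fun x => letterLS (dl x 0) from rfl,
      ← Multiset.map_coe, Multiset.sort_eq]
  have e₂ : (a.BsLS : Multiset (LSWord X)) = S₂ := by
    have : a.BsLS = S₂.sort (· ≤ ·) := pmap_mk_map_val _ _
    rw [this, Multiset.sort_eq]
  have e₃ : (a.AsLS : Multiset (LSWord X)) = S₃ := by
    have : a.AsLS = S₃.sort (· ≥ ·) := pmap_mk_map_val _ _
    rw [this, Multiset.sort_eq]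
  have e₄ : (a.ysLS : Multiset (LSWord X)) = S₄.map letterLS := by
    rw [show a.ysLS = (S₄.sort (· ≥ ·)).map letterLS from rfl,
      ← Multiset.map_coe, Multiset.sort_eq]
  rw [toMonomial, e₁, e₂, e₃, e₄, hsum]

end CanonicalForm

end CanonicalForms

section Basis

variable {F : Type v} [Field F] {X : Type u} [LinearOrder X]

theorem pEval_toBrk_of_derivs_eq_zero {B : FreeMagma (DLetter X)} (hB : derivs B = 0) :
    pEval F (toBrk (relabel B fun i => .of (DLetter.gen (leaf B i)))) = pLie F B := by
  have hord : ∀ i, DLetter.ord (leaf B i) = 0 := by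
    intro i
    rw [← sum_ord_leaf, Finset.sum_eq_zero_iff] at hB
    exact hB i (Finset.mem_univ i)
  refine ((pEval_toBrk_relabel B (fun i => .of (DLetter.gen (leaf B i))) (fun _ => 1)
    (fun i hi => ⟨?_, rfl⟩) (fun i hi => ?_)).1 hB).1
  · rw [pEval_of, ← hi, dl_gen_ord]
  · rw [hord i] at hi
    omega

theorem pEval_phi_sub_mem {y : DLetter X} (c : List (Magma₂ X)) (hc : c.length = DLetter.ord y) :
    pEval F (phi c (DLetter.gen y)) - (c.map (pEval F)).prod * MvPolynomial.X (letterLS y) ∈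
      lowerIdeal F (letterLS y) := by
  have h := pEval_phi (F := F) c (DLetter.gen y)
  rw [hc, dl_gen_ord] at h
  rw [← pLie_coe]
  refine treeIdeal_lowerTrees_le _ (treeIdeal_mono ?_ h)
  exact letters_subset_lowerTrees y

theorem prod_initialLetters (a : CanonicalForm X) :
    ((initialLetters a).map (pEval F)).prod = monoBasis F X (a.xsLS + a.BsLS) := by
  have hxs : (a.xs.map .of).map (pEval F) = a.xsLS.map MvPolynomial.X := by
    rw [CanonicalForm.xsLS, List.map_map, List.map_map]
    refine List.map_congr_left fun x _ => ?_
    exact (pEval_of x).trans (pLie_coe (letterLS (dl x 0)))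
  have hBs : (a.Bs.map fun B => toBrk (relabel B fun i => .of (DLetter.gen (leaf B i)))).map
      (pEval F) = a.BsLS.map MvPolynomial.X := by
    rw [← a.map_BsLS, List.map_map, List.map_map]
    refine List.map_congr_left fun B hB => ?_
    exact (pEval_toBrk_of_derivs_eq_zero (a.spec_of_mem_BsLS hB).2).trans (pLie_coe B)
  rw [initialLetters, List.map_append, hxs, hBs, monoBasis_apply]
  simp

/-- The leading monomial of `ψ(a)` is `a`, with coefficient `1`. -/
theorem pEval_psi_sub_mem (σ : Sorting X) (a : CanonicalForm X) :
    pEval F (psi σ a) - monoBasis F X a.toMonomial ∈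
      monoSpan F (lowerMonos (posFactors a.toMonomial)) := by
  have hysum : (a.ys.map fun y => weight (.of y)).sum =
      (a.ys.map fun y => (derivs (letterLS y).1 : ℤ) - 1).sum :=
    congrArg List.sum (List.map_congr_left fun y _ => weight_eq_derivs (.of y))
  have hnn : 0 ≤ (a.ys.map fun y => (derivs (letterLS y).1 : ℤ) - 1).sum := by
    apply List.sum_nonneg
    intro z hz
    obtain ⟨y, hy, rfl⟩ := List.mem_map.1 hz
    have : 1 ≤ derivs (letterLS y).1 := a.ys_spec y hy
    omega
  obtain ⟨r, hr⟩ := Int.eq_ofNat_of_zero_le hnn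
  have hlen : ((initialLetters a).length : ℤ) =
      r + 1 + (a.AsLS.map fun A => (derivs A.1 : ℤ) - 1).sum := by
    have hw := a.weight_eq
    have hx : (a.xs.map fun x => weight (.of (dl x 0))).sum = -(a.xs.length : ℤ) := by
      have : ∀ x : X, weight (.of (dl x 0)) = -1 := fun x => rfl
      simp [this]
    have hB : (a.Bs.map weight).sum = -(a.Bs.length : ℤ) := by
      have : a.Bs.map weight = a.Bs.map fun _ => (-1 : ℤ) := by
        apply List.map_congr_left
        intro B hB
        rw [weight_eq_derivs, (a.Bs_spec B hB).2.2]; rfl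
      rw [this]; simp
    have hA : (a.As.map weight).sum = (a.AsLS.map fun A => (derivs A.1 : ℤ) - 1).sum := by
      rw [← a.map_AsLS, List.map_map]
      exact congrArg List.sum (List.map_congr_left fun A _ => weight_eq_derivs A.1)
    rw [hx, hB, hA, hysum, hr] at hw
    simp only [initialLetters, List.length_append, List.length_map, Nat.cast_add]
    omega
  have hstage : stageLie σ a = a.AsLS.foldl
      (fun c A => absorb (derivs A.1) (fun c' => psiLie c' A.1 (σ A.1)) c) (initialLetters a) := by
    rw [stageLie]
    conv_lhs => rw [← a.map_AsLS, List.foldl_map]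
  have hAs := prod_foldl_absorb_sub_mem (F := F) (fun A : LSWord X => A)
    (fun A c' => psiLie c' A.1 (σ A.1))
    (fun A c hA hc => by
      have h := treeIdeal_lowerTrees_le A (pEval_psiLie (F := F) hA c hc (σ A.1))
      rwa [pLie_coe] at h)
    a.AsLS (fun A hA => (a.spec_of_mem_AsLS hA).2) (initialLetters a) r hlen
    (monoBasis F X (a.xsLS + a.BsLS)) []
    (by rw [prod_initialLetters, sub_self]; exact Submodule.zero_mem _)
  rw [← hstage] at hAs
  have hlen' : ((stageLie σ a).length : ℤ) =
      (0 : ℕ) + 1 + (a.ys.map fun y => (derivs (letterLS y).1 : ℤ) - 1).sum := by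
    have := length_foldl_absorb (fun A : LSWord X => derivs A.1)
      (fun A c' => psiLie c' A.1 (σ A.1)) a.AsLS (fun A hA => (a.spec_of_mem_AsLS hA).2)
      (initialLetters a) r hlen
    rw [hstage, this, hr]
    push_cast
    ring
  have hys := prod_foldl_absorb_sub_mem (F := F) letterLS (fun y c' => phi c' (DLetter.gen y))
    (fun y c _ hc => pEval_phi_sub_mem c hc) a.ys a.ys_spec (stageLie σ a) 0 hlen' _ _ hAs
  have hfinal : stageFinal σ a = [psi σ a] := by
    obtain ⟨m, hm⟩ := List.length_eq_one_iff.1 (length_stageFinal σ a)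
    have : psi σ a = m := by simp [psi, hm]
    rw [hm, this]
  have hpos : (a.ys.map letterLS).reverse ++ ((a.AsLS.map fun A => A).reverse ++ []) =
      posFactors a.toMonomial := by
    rw [a.posFactors_toMonomial, List.map_id', List.append_nil]
    rfl
  have hmono : monoBasis F X (a.xsLS + a.BsLS) *
      ((a.AsLS.map fun A => A).map MvPolynomial.X).prod *
      ((a.ys.map letterLS).map MvPolynomial.X).prod = monoBasis F X a.toMonomial := by
    symm
    rw [CanonicalForm.toMonomial, monoBasis_add, monoBasis_add,
      monoBasis_apply (a.AsLS : Multiset (LSWord X)),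
      monoBasis_apply (a.ysLS : Multiset (LSWord X)), List.map_id']
    simp [CanonicalForm.ysLS]
  rw [hpos, hmono] at hys
  have hprod : ((stageFinal σ a).map (pEval F)).prod = pEval F (psi σ a) := by
    rw [hfinal]; simp
  rw [← hprod]
  exact hys

theorem coord_pEval_psi_self (σ : Sorting X) (a : CanonicalForm X) :
    (monoBasis F X).coord a.toMonomial (pEval F (psi σ a)) = 1 := by
  have h : (monoBasis F X).coord a.toMonomial
      (pEval F (psi σ a) - monoBasis F X a.toMonomial) = 0 := by
    by_contra hne
    exact wordLT_irrefl _ (mem_monoSpan_iff.1 (pEval_psi_sub_mem σ a) _ hne)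
  rw [map_sub, sub_eq_zero] at h
  rw [h]
  simp

instance isStrictOrder_posFactors : IsStrictOrder (Multiset (LSWord X))
    fun s t => wordLT (posFactors s) (posFactors t) where
  irrefl _ := wordLT_irrefl _
  trans _ _ _ := wordLT_trans

instance isStrictOrder_posFactors_toMonomial : IsStrictOrder (CanonicalForm X)
    fun a b => wordLT (posFactors a.toMonomial) (posFactors b.toMonomial) where
  irrefl _ := wordLT_irrefl _
  trans _ _ _ := wordLT_trans

theorem linearIndependent_pEval_psi (σ : Sorting X) :
    LinearIndependent F fun a : CanonicalForm X => pEval F (psi σ a) := by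
  refine linearIndependent_of_unitriangular (fun a => (monoBasis F X).coord a.toMonomial)
    (fun a b => wordLT (posFactors a.toMonomial) (posFactors b.toMonomial))
    (fun a => coord_pEval_psi_self σ a) fun a b h => ?_
  by_contra hcon
  rw [not_or] at hcon
  have h₁ : (monoBasis F X).coord a.toMonomial (monoBasis F X b.toMonomial) = 0 := by
    have : b.toMonomial ≠ a.toMonomial := fun h =>
      hcon.1 (CanonicalForm.toMonomial_injective h.symm)
    simp [Finsupp.single_eq_of_ne this.symm]
  have h₂ : (monoBasis F X).coord a.toMonomial
      (pEval F (psi σ b) - monoBasis F X b.toMonomial) = 0 := by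
    by_contra hne
    exact hcon.2 (mem_monoSpan_iff.1 (pEval_psi_sub_mem σ b) _ hne)
  rw [map_sub, h₁, sub_zero] at h₂
  exact h h₂

/-- Each monomial of weight `-1` is a combination of the elements `ψ(a)`: the monomials of
`ψ(a) - a` are lower than `a` and have the same bidegree, and there are only finitely many
monomials of a given bidegree. -/
theorem monoBasis_mem_span_pEval_psi (σ : Sorting X) {M : Multiset X} {s : Multiset (LSWord X)}
    (hs : s ∈ bidegree M (-1)) :
    monoBasis F X s ∈ Submodule.span F (Set.range fun a : CanonicalForm X => pEval F (psi σ a)) := by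
  have hwf : (bidegree M (-1)).WellFoundedOn
      fun s t : Multiset (LSWord X) => wordLT (posFactors s) (posFactors t) :=
    (finite_bidegree M).wellFoundedOn
  refine hwf.induction (P := fun s => monoBasis F X s ∈ Submodule.span F
    (Set.range fun a : CanonicalForm X => pEval F (psi σ a))) hs fun t ht ih => ?_
  obtain ⟨a, rfl⟩ := CanonicalForm.exists_toMonomial_eq ht.2
  obtain ⟨M', hM'⟩ := exists_pEval_mem_bidegree (F := F) (psi σ a)
  have hmem : a.toMonomial ∈ bidegree M' (-1) :=
    mem_monoSpan_iff.1 hM' _ (by rw [coord_pEval_psi_self]; exact one_ne_zero)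
  have hMM : M' = M := hmem.1.symm.trans ht.1
  subst hMM
  have hlow : pEval F (psi σ a) - monoBasis F X a.toMonomial ∈
      monoSpan F (bidegree M' (-1) ∩ lowerMonos (posFactors a.toMonomial)) := by
    refine mem_monoSpan_iff.2 fun t ht => ⟨?_, mem_monoSpan_iff.1 (pEval_psi_sub_mem σ a) t ht⟩
    exact mem_monoSpan_iff.1 (Submodule.sub_mem _ hM' (monoBasis_mem_monoSpan hmem)) t ht
  have hle : monoSpan F (bidegree M' (-1) ∩ lowerMonos (posFactors a.toMonomial)) ≤
      Submodule.span F (Set.range fun a : CanonicalForm X => pEval F (psi σ a)) := by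
    refine Submodule.span_le.2 ?_
    rintro _ ⟨t, ⟨ht, hta⟩, rfl⟩
    exact ih t ht hta
  rw [← sub_sub_cancel (pEval F (psi σ a)) (monoBasis F X a.toMonomial)]
  exact Submodule.sub_mem _ (Submodule.subset_span ⟨a, rfl⟩) (hle hlow)

theorem pEval_mem_span_pEval_psi (σ : Sorting X) (m : Magma₂ X) :
    pEval F m ∈ Submodule.span F (Set.range fun a : CanonicalForm X => pEval F (psi σ a)) := by
  obtain ⟨M, hM⟩ := exists_pEval_mem_bidegree (F := F) m
  refine Submodule.span_le.2 ?_ hM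
  rintro _ ⟨s, hs, rfl⟩
  exact monoBasis_mem_span_pEval_psi σ hs

end Basis

end SGD

theorem theorem3 {F : Type v} [Field F] [CharZero F] {X : Type u} [LinearOrder X]
    [WellFoundedLT X] (σ : SGD.Sorting X) :
    LinearIndependent F (fun a : SGD.CanonicalForm X => SGD.FreeSGD.mon F X (SGD.psi σ a)) ∧
      Submodule.span F
        (Set.range fun a : SGD.CanonicalForm X => SGD.FreeSGD.mon F X (SGD.psi σ a)) = ⊤ := by
  constructor
  · refine LinearIndependent.of_comp (SGD.toFreePoisson F X) ?_
    simpa only [Function.comp_def, SGD.toFreePoisson_mon] using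
      SGD.linearIndependent_pEval_psi (F := F) σ
  · have hmon : ∀ m : SGD.Magma₂ X, SGD.FreeSGD.mon F X m ∈ Submodule.span F
        (Set.range fun a : SGD.CanonicalForm X => SGD.FreeSGD.mon F X (SGD.psi σ a)) := by
      intro m
      have h := SGD.pEval_mem_span_pEval_psi (F := F) σ m
      have hrange : (Set.range fun a : SGD.CanonicalForm X => SGD.pEval F (SGD.psi σ a)) =
          SGD.toFreePoisson F X ''
            Set.range fun a : SGD.CanonicalForm X => SGD.FreeSGD.mon F X (SGD.psi σ a) := by
        rw [← Set.range_comp]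
        simp only [Function.comp_def, SGD.toFreePoisson_mon]
      rw [hrange, ← Submodule.map_span, ← SGD.toFreePoisson_mon] at h
      obtain ⟨b, hb, hbm⟩ := h
      rwa [SGD.toFreePoisson_injective hbm] at hb
    rw [eq_top_iff]
    intro a _
    obtain ⟨f, rfl⟩ := (SGD.specialIdentities F X).mkQ_surjective a
    induction f using Finsupp.induction_linear with
    | zero => rw [map_zero]; exact Submodule.zero_mem _
    | add f g hf hg => rw [map_add]; exact Submodule.add_mem _ (hf trivial) (hg trivial)
    | single m c =>
      rw [← mul_one c, ← smul_eq_mul, ← Finsupp.smul_single, map_smul]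
      exact Submodule.smul_mem _ c (hmon m)
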